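/- Let $\mathbb T$ be the unit circle and $1\to\mathbb T\to\widehat\Gamma\xrightarrow{q}\Gamma\to1$ a central extension of (Banach-)Lie groups, with $q$ a smooth principal $\mathbb T$-bundle; identify $i\mathbb R$ with the kernel of $q_*:\mathrm{Lie}\,\widehat\Gamma\to\mathrm{Lie}\,\Gamma$. Let $X$ be a smooth paracompact Hausdorff manifold, $\pi:B\to X$ a smooth principal $\Gamma$-bundle, $\theta$ a connection form on $B$ with curvature $F_\theta=d\theta+\frac12[\theta,\theta]$, and $L$ a splitting of $B$, i.e. a vector bundle map $B\times_{\mathrm{Ad}}\mathrm{Lie}\,\widehat\Gamma\to B\times_{\mathrm{Ad}}i\mathbb R$ that is the identity on $B\times_{\mathrm{Ad}}i\mathbb R$; write $L([b,v])=[b,\overline L(b,v)]$. Let $\sigma:\mathrm{Lie}\,\Gamma\to\mathrm{Lie}\,\widehat\Gamma$ be a (continuous) linear map with $q_*\sigma=\mathrm{id}$. Let $\mu$, $\hat\mu$ be the left invariant Maurer–Cartan forms of $\Gamma$, $\widehat\Gamma$, and let $H^2(X,\mathcal F^2)$ be the Deligne cohomology group, the second hypercohomology of $\mathcal F^2=(\underline{\mathbb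 T}\xrightarrow{d\log}i\underline\Omega^1\xrightarrow{d}i\underline\Omega^2)$, computed as the direct limit of Čech cohomologies over open covers. Put $Z_\sigma(\gamma,v)=\mathrm{Ad}_\gamma\sigma(v)-\sigma(\mathrm{Ad}_\gamma v)$, where $\mathrm{Ad}_\gamma$ acts on $\mathrm{Lie}\,\widehat\Gamma$ through any lift of $\gamma$, and $\omega_\sigma(v,w)=[\sigma v,\sigma w]-\sigma[v,w]$. Let $\zeta:B^{[2]}=B\times_XB\to\Gamma$ be given by $b_1\zeta(b_1,b_2)=b_2$, and let $J_B=\zeta^*\widehat\Gamma$, with the product induced from $\widehat\Gamma$, be the lifting bundle gerbe. Writing $\tilde\zeta:J_B\to\widehat\Gamma$ for the canonical map and $\pi_1:J_B\to B$ for the first projection, put $$\nabla_{\theta,\sigma}=\tilde\zeta^*\bigl(\hat\mu-\sigma(q^*\mu)\bigr)+Z_\sigma(\zeta^{-1},\pi_1^*\theta)\quad\text{on }J_B,\qquad f_{\theta,\sigma}=-\tfrac12\omega_\sigma(\theta,\theta)-\overline L\bigl(\cdot,\sigma(F_\theta)\bigr)\quad\text{on }B.$$ Then $\nabla_{\theta,\sigma}$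 is a bundle gerbe connection on $J_B$ with curving $f_{\theta,\sigma}$, and the following two classes in $H^2(X,\mathcal F^2)$ are well defined and equal. (1) The Deligne class of $(J_B,\nabla_{\theta,\sigma},f_{\theta,\sigma})$: it is represented by $(g_{\alpha\beta\gamma},A_{\alpha\beta},f_\alpha)$, where, for local sections $s_\alpha$ of $B$ on an open cover $\{U_\alpha\}$ and sections $\sigma_{\alpha\beta}$ of $(s_\alpha,s_\beta)^*J_B$ over $U_\alpha\cap U_\beta$, $\sigma_{\alpha\beta}\sigma_{\beta\gamma}=\sigma_{\alpha\gamma}\,g_{\alpha\beta\gamma}$, $A_{\alpha\beta}=-\sigma_{\alpha\beta}^*\nabla_{\theta,\sigma}$, $f_\alpha=-s_\alpha^*f_{\theta,\sigma}$. (2) Brylinski's obstruction class of $(B,\theta,L)$: it is represented by $(z_{\alpha\beta\gamma},u_{\alpha\beta},K_\alpha)$, where, for local sections $s_\alpha$ of $B$ with $s_\beta=s_\alpha g_{\alpha\beta}$, lifts $\hat g_{\alpha\beta}:U_\alpha\cap U_\beta\to\widehat\Gamma$ of $g_{\alpha\beta}$ with $\hat g_{\beta\alpha}=\hat g_{\alpha\beta}^{-1}$,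 and lifts $\hat\theta_\alpha\in\Omega^1(U_\alpha;\mathrm{Lie}\,\widehat\Gamma)$ of $s_\alpha^*\theta$, one sets $z_{\alpha\beta\gamma}=\hat g_{\alpha\beta}\hat g_{\beta\gamma}\hat g_{\gamma\alpha}$, $u_{\alpha\beta}=\hat\theta_\beta-\bigl(\mathrm{Ad}_{\hat g_{\alpha\beta}^{-1}}\hat\theta_\alpha+\hat g_{\alpha\beta}^*\hat\mu\bigr)$, $K_\alpha=\overline L\bigl(s_\alpha,d\hat\theta_\alpha+\tfrac12[\hat\theta_\alpha,\hat\theta_\alpha]\bigr)$. Here "well defined" means that the choices exist on some open cover, and that all choices on all open covers on which they exist give cocycles representing the same class. Moreover, for all sections $s_\alpha$ and lifts $\hat g_{\alpha\beta}$ as in (2), the choices $\sigma_{\alpha\beta}=(s_\alpha,s_\beta,\hat g_{\alpha\beta})$ and $\hat\theta_\alpha=\sigma(s_\alpha^*\theta)$ give exactly equal cocycles. -/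

import Mathlib

open Set Function TopologicalSpace
open scoped Manifold ContDiff Topology

noncomputable section

namespace LiftingGerbe

/-! ### Differential forms of degree one and two on a manifold

Forms with values in a normed space `V`.  A form on an open set `U` is represented by a function on
the whole manifold that is only ever used on `U`.  Real-valued forms stand for forms with values
in `Lie 𝕋 = iℝ`, through the identification `t ↦ i t`. -/

section Forms

variable {E : Type*} [NormedAddCommGroup E] [NormedSpace ℝ E]
  {H : Type*} [TopologicalSpace H] (I : ModelWithCorners ℝ E H)
  (M : Type*) [TopologicalSpace M] [ChartedSpace H M]
  {E' : Type*} [NormedAddCommGroup E'] [NormedSpace ℝ E']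
  {H' : Type*} [TopologicalSpace H'] (I' : ModelWithCorners ℝ E' H')
  {N : Type*} [TopologicalSpace N] [ChartedSpace H' N]
  (V : Type*) [NormedAddCommGroup V] [NormedSpace ℝ V]

/-- A (not necessarily smooth) `V`-valued one-form. -/
abbrev OneForm : Type _ := (x : M) → TangentSpace I x →L[ℝ] V

/-- A (not necessarily smooth) field of `V`-valued functions of two tangent vectors; the predicate
`TwoForm.SmoothOn` says that it is a smooth (bilinear, alternating) two-form. -/
abbrev TwoForm : Type _ := (x : M) → TangentSpace I x → TangentSpace I x → V

variable {I M I' V}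

/-- The expression of a one-form in the chart around `x₀`, i.e. its pull-back to the model space
under the inverse of the chart. -/
def OneForm.inChart (η : OneForm I M V) (x₀ : M) (e : E) : E →L[ℝ] V :=
  (η ((extChartAt I x₀).symm e)).comp (mfderiv 𝓘(ℝ, E) I (extChartAt I x₀).symm e)

/-- Smoothness of a one-form on an open set, tested in charts. -/
def OneForm.SmoothOn (η : OneForm I M V) (U : Set M) : Prop :=
  ∀ x₀ : M, ContDiffOn ℝ ∞ (OneForm.inChart η x₀)
    ((extChartAt I x₀).target ∩ (extChartAt I x₀).symm ⁻¹' U)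

/-- `η` is a smooth two-form on the open set `U`: it is alternating there, and in charts it is a
smooth family of continuous bilinear maps. -/
def TwoForm.SmoothOn (η : TwoForm I M V) (U : Set M) : Prop :=
  (∀ x ∈ U, ∀ v : TangentSpace I x, η x v v = 0) ∧
  ∀ x₀ : M, ∃ G : E → E →L[ℝ] E →L[ℝ] V,
    ContDiffOn ℝ ∞ G ((extChartAt I x₀).target ∩ (extChartAt I x₀).symm ⁻¹' U) ∧
    ∀ e ∈ (extChartAt I x₀).target ∩ (extChartAt I x₀).symm ⁻¹' U, ∀ v w : E,
      η ((extChartAt I x₀).symm e) (mfderiv 𝓘(ℝ, E) I (extChartAt I x₀).symm e v)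
        (mfderiv 𝓘(ℝ, E) I (extChartAt I x₀).symm e w) = G e v w

/-- The exterior derivative of a one-form, computed at `x` in the chart around `x`:
`dη(v, w) = (D_v η)(w) - (D_w η)(v)`. -/
def OneForm.d (η : OneForm I M V) : TwoForm I M V := fun x v w =>
  let D : E →L[ℝ] E →L[ℝ] V := fderiv ℝ (OneForm.inChart η x) (extChartAt I x x)
  let A : TangentSpace I x →L[ℝ] E := mfderiv I 𝓘(ℝ, E) (extChartAt I x) x
  D (A v) (A w) - D (A w) (A v)

/-- Pull-back of a one-form. -/
def OneForm.pullback (f : N → M) (η : OneForm I M V) : OneForm I' N V := fun x =>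
  (η (f x)).comp (mfderiv I' I f x)

/-- Pull-back of a two-form. -/
def TwoForm.pullback (f : N → M) (η : TwoForm I M V) : TwoForm I' N V := fun x v w =>
  η (f x) (mfderiv I' I f x v) (mfderiv I' I f x w)

/-- The real one-form `(1/i) z⁻¹ dz` of a circle-valued function `z`; it stands for
`d log z = z⁻¹ dz`. -/
def dlog (z : M → Circle) : OneForm I M ℝ := fun x =>
  Complex.imCLM.comp ((ContinuousLinearMap.mul ℝ ℂ (starRingEnd ℂ (z x : ℂ))).comp
    (mfderiv I 𝓘(ℝ, ℂ) (fun y => (z y : ℂ)) x : TangentSpace I x →L[ℝ] ℂ))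

end Forms

/-! ### The second Deligne cohomology `H²(X, 𝕋 → iΩ¹ → iΩ²)`

It is the direct limit, over open covers and refinements, of the cohomology in degree two of the
total complex of the Čech double complex, with differential `δ + (-1)^p d` on Čech degree `p`. -/

section Deligne

universe u

variable {E : Type*} [NormedAddCommGroup E] [NormedSpace ℝ E]
  {H : Type*} [TopologicalSpace H] (I : ModelWithCorners ℝ E H)
  (X : Type u) [TopologicalSpace X] [ChartedSpace H X]

/-- An open cover of `X`. -/
structure Cover where
  /-- The index set. -/
  ι : Type u
  /-- The open sets. -/
  U : ι → Opens X
  covers : ∀ x : X, ∃ a, x ∈ U a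

variable {X}

/-- A family of functions and forms, underlying a total Čech cochain of degree two with index set
`ι`. -/
structure Cochain (ι : Type*) where
  /-- The component in `Č²(𝕋)`. -/
  z : ι → ι → ι → X → Circle
  /-- The component in `Č¹(iΩ¹)`. -/
  u : ι → ι → OneForm I X ℝ
  /-- The component in `Č⁰(iΩ²)`. -/
  K : ι → TwoForm I X ℝ

/-- The family is a smooth Čech cochain for the cover `𝔘`, and its total coboundary
`(δz, δu + d log z, δK - du)` is trivial. -/
structure Cochain.IsCocycle (𝔘 : Cover X) (c : Cochain I (X := X) 𝔘.ι) : Prop where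
  smooth_z : ∀ α β γ, ContMDiffOn I (𝓡 1) ∞ (c.z α β γ) (𝔘.U α ∩ 𝔘.U β ∩ 𝔘.U γ : Set X)
  smooth_u : ∀ α β, OneForm.SmoothOn (c.u α β) (𝔘.U α ∩ 𝔘.U β : Set X)
  smooth_K : ∀ α, TwoForm.SmoothOn (c.K α) (𝔘.U α : Set X)
  cocycle_z : ∀ α β γ δ, ∀ x, x ∈ 𝔘.U α → x ∈ 𝔘.U β → x ∈ 𝔘.U γ → x ∈ 𝔘.U δ →
    c.z β γ δ x * (c.z α γ δ x)⁻¹ * c.z α β δ x * (c.z α β γ x)⁻¹ = 1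
  cocycle_u : ∀ α β γ, ∀ x, x ∈ 𝔘.U α → x ∈ 𝔘.U β → x ∈ 𝔘.U γ →
    c.u β γ x - c.u α γ x + c.u α β x + dlog (c.z α β γ) x = 0
  cocycle_K : ∀ α β, ∀ x, x ∈ 𝔘.U α → x ∈ 𝔘.U β → ∀ v w : TangentSpace I x,
    c.K β x v w - c.K α x v w - OneForm.d (c.u α β) x v w = 0

variable (X) in
/-- A total Čech cocycle of degree two on some open cover of `X`. -/
structure Cocycle where
  /-- The cover. -/
  cover : Cover X
  /-- The cochain. -/
  cochain : Cochain I (X := X) cover.ι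
  isCocycle : cochain.IsCocycle I cover

/-- The cover of `c'` refines that of `c`, by a map `τ` of index sets, and on it `c'` differs from
the restriction `τ^* c` by the total coboundary `(δh, δk - d log h, dk)` of a smooth cochain
`(h, k)` of degree one. -/
def Cocycle.RefinesTo (c c' : Cocycle I X) : Prop :=
  ∃ τ : c'.cover.ι → c.cover.ι, (∀ α, c'.cover.U α ≤ c.cover.U (τ α)) ∧
  ∃ (h : c'.cover.ι → c'.cover.ι → X → Circle) (k : c'.cover.ι → OneForm I X ℝ),
    (∀ α β, ContMDiffOn I (𝓡 1) ∞ (h α β) (c'.cover.U α ∩ c'.cover.U β : Set X)) ∧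
    (∀ α, OneForm.SmoothOn (k α) (c'.cover.U α : Set X)) ∧
    (∀ α β γ, ∀ x, x ∈ c'.cover.U α → x ∈ c'.cover.U β → x ∈ c'.cover.U γ →
      c'.cochain.z α β γ x = c.cochain.z (τ α) (τ β) (τ γ) x *
        (h β γ x * (h α γ x)⁻¹ * h α β x)) ∧
    (∀ α β, ∀ x, x ∈ c'.cover.U α → x ∈ c'.cover.U β →
      c'.cochain.u α β x = c.cochain.u (τ α) (τ β) x + (k β x - k α x - dlog (h α β) x)) ∧
    (∀ α, ∀ x, x ∈ c'.cover.U α → ∀ v w : TangentSpace I x,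
      c'.cochain.K α x v w = c.cochain.K (τ α) x v w + OneForm.d (k α) x v w)

variable (X) in
/-- The Deligne cohomology `H²(X, ℱ²)`, as the direct limit of Čech cohomologies: cocycles on all
open covers, modulo the equivalence relation generated by passing to a refinement and adding a
coboundary. -/
def DeligneH2 : Type _ := Quot (Cocycle.RefinesTo I (X := X))

/-- Two total Čech cochains of degree two agree, i.e. agree on all intersections. -/
structure Cochain.Agree (𝔘 : Cover X) (c c' : Cochain I (X := X) 𝔘.ι) : Prop where
  z_eq : ∀ α β γ, ∀ x, x ∈ 𝔘.U α → x ∈ 𝔘.U β → x ∈ 𝔘.U γ → c.z α β γ x = c'.z α β γ x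
  u_eq : ∀ α β, ∀ x, x ∈ 𝔘.U α → x ∈ 𝔘.U β → c.u α β x = c'.u α β x
  K_eq : ∀ α, ∀ x, x ∈ 𝔘.U α → ∀ v w : TangentSpace I x, c.K α x v w = c'.K α x v w

/-- The class of a cocycle. -/
def deligneClass (𝔘 : Cover X) (c : Cochain I (X := X) 𝔘.ι) (h : c.IsCocycle I 𝔘) :
    DeligneH2 I X :=
  Quot.mk _ ⟨𝔘, c, h⟩

end Deligne

/-! ### Principal bundles -/

section Principal

variable {EG : Type*} [NormedAddCommGroup EG] [NormedSpace ℝ EG]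
  {HG : Type*} [TopologicalSpace HG] (IG : ModelWithCorners ℝ EG HG)
  {G : Type*} [Group G] [TopologicalSpace G] [ChartedSpace HG G]
  {EP : Type*} [NormedAddCommGroup EP] [NormedSpace ℝ EP]
  {HP : Type*} [TopologicalSpace HP] (IP : ModelWithCorners ℝ EP HP)
  {P : Type*} [TopologicalSpace P] [ChartedSpace HP P]
  {EM : Type*} [NormedAddCommGroup EM] [NormedSpace ℝ EM]
  {HM : Type*} [TopologicalSpace HM] (IM : ModelWithCorners ℝ EM HM)
  {M : Type*} [TopologicalSpace M] [ChartedSpace HM M]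

/-- `proj : P → M` is a smooth principal `G`-bundle for the right action `act`.  Local triviality:
over small open sets `U` there are a smooth section `s` and a smooth map `t` such that
`(y, g) ↦ s y · g` and `b ↦ (proj b, t b)` are mutually inverse between `U × G` and `proj⁻¹ U`. -/
structure IsPrincipalBundle (proj : P → M) (act : P → G → P) : Prop where
  smooth_proj : ContMDiff IP IM ∞ proj
  smooth_act : ContMDiff (IP.prod IG) IP ∞ (fun p : P × G => act p.1 p.2)
  act_one : ∀ b, act b 1 = b
  act_mul : ∀ b g g', act b (g * g') = act (act b g) g'
  proj_act : ∀ b g, proj (act b g) = proj b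
  locally_trivial : ∀ x : M, ∃ (U : Set M) (s : M → P) (t : P → G), IsOpen U ∧ x ∈ U ∧
    ContMDiffOn IM IP ∞ s U ∧ ContMDiffOn IP IG ∞ t (proj ⁻¹' U) ∧
    (∀ y ∈ U, proj (s y) = y) ∧
    (∀ b, proj b ∈ U → act (s (proj b)) (t b) = b) ∧
    (∀ y ∈ U, ∀ g, t (act (s y) g) = g)

open Classical in
/-- For `b₁, b₂` in one fibre of a principal bundle, the unique group element `g` such that
`b₁ · g = b₂`. -/
def translation (act : P → G → P) (b₁ b₂ : P) : G :=
  if h : ∃ g, act b₁ g = b₂ then h.choose else 1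

/-- A connection form on a principal circle bundle. -/
structure IsCircleConnection (act : P → Circle → P) (A : OneForm IP P ℝ) : Prop where
  smooth : OneForm.SmoothOn A univ
  vertical : ∀ p, A (act p (Circle.exp 0))
    (mfderiv 𝓘(ℝ, ℝ) IP (fun t : ℝ => act p (Circle.exp t)) 0 (1 : ℝ)) = 1
  invariant : ∀ (g : Circle) (p : P), OneForm.pullback (fun p => act p g) A p = A p

end Principal

/-! ### Bundle gerbes -/

section Gerbe

universe u

variable {EX : Type*} [NormedAddCommGroup EX] [NormedSpace ℝ EX]
  {HX : Type*} [TopologicalSpace HX] (IX : ModelWithCorners ℝ EX HX)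
  (X : Type u) [TopologicalSpace X] [ChartedSpace HX X]
  {EY : Type*} [NormedAddCommGroup EY] [NormedSpace ℝ EY]
  {HY : Type*} [TopologicalSpace HY] (IY : ModelWithCorners ℝ EY HY)
  (Y : Type*) [TopologicalSpace Y] [ChartedSpace HY Y]
  {EZ : Type*} [NormedAddCommGroup EZ] [NormedSpace ℝ EZ]
  {HZ : Type*} [TopologicalSpace HZ] (IZ : ModelWithCorners ℝ EZ HZ)
  (Z : Type*) [TopologicalSpace Z] [ChartedSpace HZ Z]
  {EP : Type*} [NormedAddCommGroup EP] [NormedSpace ℝ EP]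
  {HP : Type*} [TopologicalSpace HP] (IP : ModelWithCorners ℝ EP HP)
  (P : Type*) [TopologicalSpace P] [ChartedSpace HP P]

/-- A bundle gerbe `(P, Y)` over `X`: a locally split map `π : Y → X`, and a principal circle bundle
`P` over the fibre product `Y^[2]` with an associative product.  The manifold `Z` is a model of the
fibre product: `(pr₁, pr₂)` is a bijection from `Z` onto `{(y, y') | π y = π y'}` whose inverse
locally extends to smooth maps on open subsets of `Y × Y`. -/
structure BundleGerbe where
  /-- The locally split map. -/
  π : Y → X
  smooth_π : ContMDiff IY IX ∞ π
  locally_split : ∀ x : X, ∃ (U : Set X) (s : X → Y), IsOpen U ∧ x ∈ U ∧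
    ContMDiffOn IX IY ∞ s U ∧ ∀ y ∈ U, π (s y) = y
  /-- The first projection of the fibre product. -/
  pr₁ : Z → Y
  /-- The second projection of the fibre product. -/
  pr₂ : Z → Y
  smooth_pr₁ : ContMDiff IZ IY ∞ pr₁
  smooth_pr₂ : ContMDiff IZ IY ∞ pr₂
  π_pr : ∀ w, π (pr₁ w) = π (pr₂ w)
  pr_injective : ∀ w w', pr₁ w = pr₁ w' → pr₂ w = pr₂ w' → w = w'
  pr_local_inverse : ∀ y y' : Y, π y = π y' → ∃ (W : Set (Y × Y)) (r : Y × Y → Z),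
    IsOpen W ∧ (y, y') ∈ W ∧ ContMDiffOn (IY.prod IY) IZ ∞ r W ∧
    ∀ p ∈ W, π p.1 = π p.2 → pr₁ (r p) = p.1 ∧ pr₂ (r p) = p.2
  /-- The projection of the circle bundle. -/
  proj : P → Z
  /-- The action of the circle. -/
  act : P → Circle → P
  isPrincipal : IsPrincipalBundle (𝓡 1) IP IZ proj act
  /-- The product, meaningful on composable pairs only. -/
  mul : P → P → P
  smooth_mul : ContMDiffOn (IP.prod IP) IP ∞ (fun p : P × P => mul p.1 p.2)
    {p | pr₂ (proj p.1) = pr₁ (proj p.2)}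
  pr₁_mul : ∀ p p', pr₂ (proj p) = pr₁ (proj p') → pr₁ (proj (mul p p')) = pr₁ (proj p)
  pr₂_mul : ∀ p p', pr₂ (proj p) = pr₁ (proj p') → pr₂ (proj (mul p p')) = pr₂ (proj p')
  mul_act : ∀ p p' g g', pr₂ (proj p) = pr₁ (proj p') →
    mul (act p g) (act p' g') = act (mul p p') (g * g')
  mul_assoc : ∀ p p' p'', pr₂ (proj p) = pr₁ (proj p') → pr₂ (proj p') = pr₁ (proj p'') →
    mul (mul p p') p'' = mul p (mul p' p'')

variable {IX X IY Y IZ Z IP P}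

namespace BundleGerbe

variable (𝒢 : BundleGerbe IX X IY Y IZ Z IP P)

/-- A bundle gerbe connection: a connection on the circle bundle `P` with
`π₁₂^*∇ + π₂₃^*∇ = m^* π₁₃^*∇`.  The tangent vectors to the manifold of composable pairs are the
velocities of curves of composable pairs. -/
structure IsConnection (A : OneForm IP P ℝ) : Prop where
  isCircleConnection : IsCircleConnection IP 𝒢.act A
  mul_compatible : ∀ p p' : ℝ → P, ContMDiff 𝓘(ℝ, ℝ) IP ∞ p → ContMDiff 𝓘(ℝ, ℝ) IP ∞ p' →
    (∀ t, 𝒢.pr₂ (𝒢.proj (p t)) = 𝒢.pr₁ (𝒢.proj (p' t))) →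
    ∀ t : ℝ, (OneForm.pullback p A t + OneForm.pullback p' A t : TangentSpace 𝓘(ℝ, ℝ) t →L[ℝ] ℝ) =
      OneForm.pullback (fun t => 𝒢.mul (p t) (p' t)) A t

/-- A curving for `A`: a two-form `f` on `Y` with `dA = -π₁^* f + π₂^* f` on `P`. -/
structure IsCurving (A : OneForm IP P ℝ) (f : TwoForm IY Y ℝ) : Prop where
  smooth : TwoForm.SmoothOn f univ
  d_eq : ∀ (p : P) (v w : TangentSpace IP p), OneForm.d A p v w =
    - TwoForm.pullback (fun p => 𝒢.pr₁ (𝒢.proj p)) f p v w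
    + TwoForm.pullback (fun p => 𝒢.pr₂ (𝒢.proj p)) f p v w

/-- The choices in the definition of the Deligne class: local sections `s_α` of `Y`, and sections
`σ_αβ` of `(s_α, s_β)^* P`. -/
structure LocalData (𝔘 : Cover X) where
  /-- The local sections of `Y`. -/
  s : 𝔘.ι → X → Y
  smooth_s : ∀ α, ContMDiffOn IX IY ∞ (s α) (𝔘.U α : Set X)
  π_s : ∀ α, ∀ x ∈ 𝔘.U α, 𝒢.π (s α x) = x
  /-- The sections of `(s_α, s_β)^* P`. -/
  σ : 𝔘.ι → 𝔘.ι → X → P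
  smooth_σ : ∀ α β, ContMDiffOn IX IP ∞ (σ α β) (𝔘.U α ∩ 𝔘.U β : Set X)
  pr₁_σ : ∀ α β, ∀ x, x ∈ 𝔘.U α → x ∈ 𝔘.U β → 𝒢.pr₁ (𝒢.proj (σ α β x)) = s α x
  pr₂_σ : ∀ α β, ∀ x, x ∈ 𝔘.U α → x ∈ 𝔘.U β → 𝒢.pr₂ (𝒢.proj (σ α β x)) = s β x

/-- The Čech cochain `(g_αβγ, A_αβ, f_α)` of a bundle gerbe with connection `A` and curving `f`:
`m(σ_αβ, σ_βγ) = σ_αγ g_αβγ`, `A_αβ = -σ_αβ^* A`, `f_α = - s_α^* f`. -/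
def LocalData.cochain {𝒢 : BundleGerbe IX X IY Y IZ Z IP P} {𝔘 : Cover X} (D : 𝒢.LocalData 𝔘)
    (A : OneForm IP P ℝ) (f : TwoForm IY Y ℝ) : Cochain IX (X := X) 𝔘.ι where
  z α β γ x := translation 𝒢.act (D.σ α γ x) (𝒢.mul (D.σ α β x) (D.σ β γ x))
  u α β x := - OneForm.pullback (D.σ α β) A x
  K α x v w := - TwoForm.pullback (D.s α) f x v w

/-- `c` is the Deligne class of the bundle gerbe with connection and curving `(𝒢, A, f)`: local data
exist on some open cover, and for all local data on all open covers the associated cochain is a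
cocycle which represents `c`. -/
structure IsDeligneClass (A : OneForm IP P ℝ) (f : TwoForm IY Y ℝ) (c : DeligneH2 IX X) :
    Prop where
  exists_data : ∃ 𝔘 : Cover X, Nonempty (𝒢.LocalData 𝔘)
  represents : ∀ (𝔘 : Cover X) (D : 𝒢.LocalData 𝔘),
    ∃ h : (D.cochain A f).IsCocycle IX 𝔘, deligneClass IX 𝔘 (D.cochain A f) h = c

end BundleGerbe

end Gerbe

/-! ### Lie groups

The Lie algebra `GroupLieAlgebra 𝓘(ℝ, EG) G` of `G`, i.e. the tangent space at the identity, is by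
definition the model space `EG`. -/

section LieGroups

variable {EG : Type*} [NormedAddCommGroup EG] [NormedSpace ℝ EG]
  (G : Type*) [Group G] [TopologicalSpace G] [ChartedSpace EG G]
  {EM : Type*} [NormedAddCommGroup EM] [NormedSpace ℝ EM]
  {HM : Type*} [TopologicalSpace HM] {IM : ModelWithCorners ℝ EM HM}
  {M : Type*} [TopologicalSpace M] [ChartedSpace HM M]

variable {G} in
/-- The adjoint action of `g` on the Lie algebra. -/
def Ad (g : G) : EG →L[ℝ] EG :=
  (mfderiv 𝓘(ℝ, EG) 𝓘(ℝ, EG) (fun x : G => g * x * g⁻¹) 1 :)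

/-- The (left invariant) Maurer-Cartan form. -/
def maurerCartan : OneForm 𝓘(ℝ, EG) G EG := fun g =>
  (mfderiv 𝓘(ℝ, EG) 𝓘(ℝ, EG) (fun x : G => g⁻¹ * x) g :)

/-- The Lie bracket of the Lie algebra of `G`. -/
def lieBracket (v w : EG) : EG :=
  let v' : GroupLieAlgebra 𝓘(ℝ, EG) G := v
  let w' : GroupLieAlgebra 𝓘(ℝ, EG) G := w
  let r : GroupLieAlgebra 𝓘(ℝ, EG) G := ⁅v', w'⁆
  r

/-- The curvature `dθ + ½[θ, θ]` of a Lie algebra valued one-form. -/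
def curvature (θ : OneForm IM M EG) : TwoForm IM M EG := fun x v w =>
  OneForm.d θ x v w + lieBracket G (θ x v) (θ x w)

variable {G} in
/-- A connection form on a principal `G`-bundle. -/
structure IsPrincipalConnection (act : M → G → M) (θ : OneForm IM M EG) : Prop where
  smooth : OneForm.SmoothOn θ univ
  vertical : ∀ (b : M) (v : EG), θ (act b 1) (mfderiv 𝓘(ℝ, EG) IM (fun g : G => act b g) 1 v) = v
  equivariant : ∀ (g : G) (b : M) (v : TangentSpace IM b),
    θ (act b g) (mfderiv IM IM (fun b => act b g) b v) = Ad g⁻¹ (θ b v)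

end LieGroups

/-! ### Central extensions by the circle -/

section Extension

variable (Fh : Type*) [NormedAddCommGroup Fh] [NormedSpace ℝ Fh]
  (Γh : Type*) [Group Γh] [TopologicalSpace Γh] [ChartedSpace Fh Γh]
  (F : Type*) [NormedAddCommGroup F] [NormedSpace ℝ F]
  (Γ : Type*) [Group Γ] [TopologicalSpace Γ] [ChartedSpace F Γ]

/-- A central extension `1 → 𝕋 → Γh → Γ → 1` of Lie groups: `incl` embeds the circle into the
centre, and it makes `q` a smooth principal circle bundle. -/
structure CentralExtension where
  /-- The projection. -/
  q : Γh →* Γ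
  /-- The inclusion of the circle. -/
  incl : Circle →* Γh
  central : ∀ (z : Circle) (g : Γh), incl z * g = g * incl z
  isPrincipal : IsPrincipalBundle (𝓡 1) 𝓘(ℝ, Fh) 𝓘(ℝ, F) q (fun (g : Γh) (z : Circle) => g * incl z)

namespace CentralExtension

variable {Fh Γh F Γ} (𝔼 : CentralExtension Fh Γh F Γ)

theorem q_surjective : Surjective 𝔼.q := fun γ => by
  obtain ⟨U, s, t, -, hU, -, -, hs, -⟩ := 𝔼.isPrincipal.locally_trivial γ
  exact ⟨s γ, hs γ hU⟩

theorem q_incl (z : Circle) : 𝔼.q (𝔼.incl z) = 1 := by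
  simpa using 𝔼.isPrincipal.proj_act 1 z

theorem contMDiff_incl : ContMDiff (𝓡 1) 𝓘(ℝ, Fh) ∞ 𝔼.incl := by
  have h := 𝔼.isPrincipal.smooth_act.comp
    ((contMDiff_const (c := (1 : Γh))).prodMk (contMDiff_id (I := 𝓡 1) (M := Circle)))
  simpa [comp_def] using h

/-- The induced map `Lie Γh → Lie Γ`. -/
def dq : Fh →L[ℝ] F := (mfderiv 𝓘(ℝ, Fh) 𝓘(ℝ, F) 𝔼.q 1 :)

/-- The induced map `iℝ = Lie 𝕋 → Lie Γh`, where `iℝ` is identified with `ℝ`. -/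
def dincl : ℝ →L[ℝ] Fh :=
  (mfderiv 𝓘(ℝ, ℝ) 𝓘(ℝ, Fh) (fun t : ℝ => 𝔼.incl (Circle.exp t)) 0 :)

theorem dincl_one_ne_zero : 𝔼.dincl 1 ≠ 0 := by
  intro h0
  obtain ⟨U, s, t, hU, hx, hs, ht, h1, h2, h3⟩ := 𝔼.isPrincipal.locally_trivial 1
  set f : ℝ → Γh := fun r => 𝔼.incl (Circle.exp r) with hf
  have hfs : ContMDiff 𝓘(ℝ, ℝ) 𝓘(ℝ, Fh) ∞ f := 𝔼.contMDiff_incl.comp contMDiff_circleExp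
  have hcirc : ContMDiff (𝓡 1) 𝓘(ℝ, ℂ) ∞ (fun z : Circle => (z : ℂ)) :=
    haveI : Fact (Module.finrank ℝ ℂ = 1 + 1) := ⟨Complex.finrank_real_complex⟩
    contMDiff_coe_sphere
  -- a smooth function on `Γh` near `incl 1` which restricts to the coordinate of the circle
  set m : Γh → ℂ := fun g => (t g : ℂ) with hm
  have hopen : IsOpen (𝔼.q ⁻¹' U) := hU.preimage 𝔼.isPrincipal.smooth_proj.continuous
  have hmem : f 0 ∈ 𝔼.q ⁻¹' U := by simp [hf, hx]
  have hmd : MDifferentiableAt 𝓘(ℝ, Fh) 𝓘(ℝ, ℂ) m (f 0) := by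
    have : ContMDiffAt 𝓘(ℝ, Fh) (𝓡 1) ∞ t (f 0) := ht.contMDiffAt (hopen.mem_nhds hmem)
    exact (ContMDiffAt.comp (f 0) (hcirc (t (f 0))) this).mdifferentiableAt (by simp)
  have key : HasMFDerivAt 𝓘(ℝ, ℝ) 𝓘(ℝ, ℂ) (m ∘ f) 0 _ :=
    HasMFDerivAt.comp (0 : ℝ) hmd.hasMFDerivAt
      (((hfs 0).mdifferentiableAt (by simp)).hasMFDerivAt)
  have hfd : (mfderiv 𝓘(ℝ, ℝ) 𝓘(ℝ, Fh) f 0) (1 : ℝ) = 0 := h0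
  have hmf : m ∘ f = fun r : ℝ => ((t 1 : Circle) : ℂ) * Complex.exp (r * Complex.I) := by
    funext r
    have e1 : s 1 * 𝔼.incl (t 1) = 1 := by simpa using h2 1 (by simpa using hx)
    have e2 : f r = s 1 * 𝔼.incl (t 1 * Circle.exp r) := by
      rw [map_mul, ← mul_assoc, e1, one_mul]
    have e3 : t (f r) = t 1 * Circle.exp r := by rw [e2]; exact h3 1 hx _
    simp [hm, e3]
  have hd : HasDerivAt (m ∘ f) (((t 1 : Circle) : ℂ) * Complex.I) 0 := by
    rw [hmf]
    have h : HasDerivAt (fun r : ℝ => Complex.exp (r * Complex.I)) Complex.I 0 := by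
      have := (((Complex.ofRealCLM.hasDerivAt (x := (0 : ℝ))).mul_const Complex.I)).cexp
      simpa using this
    exact h.const_mul _
  have := hasMFDerivAt_unique key hd.hasFDerivAt.hasMFDerivAt
  have h5 := congrArg (fun A : ℝ →L[ℝ] ℂ => A 1) this
  have h6 : (mfderiv 𝓘(ℝ, Fh) 𝓘(ℝ, ℂ) m (f 0)) ((mfderiv 𝓘(ℝ, ℝ) 𝓘(ℝ, Fh) f 0) (1 : ℝ)) =
      ((1 : ℝ) • (((t 1 : Circle) : ℂ) * Complex.I) : ℂ) := h5
  rw [hfd, map_zero] at h6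
  have h7 : ((t 1 : Circle) : ℂ) * Complex.I = 0 := by
    rw [← one_smul ℝ (((t 1 : Circle) : ℂ) * Complex.I)]; exact h6.symm
  simp at h7

theorem exists_scalarPart : ∃ r : Fh →L[ℝ] ℝ, ∀ t : ℝ, r (𝔼.dincl t) = t := by
  obtain ⟨r, hr⟩ := SeparatingDual.exists_eq_one (R := ℝ) 𝔼.dincl_one_ne_zero
  refine ⟨r, fun t => ?_⟩
  have : 𝔼.dincl t = t • 𝔼.dincl 1 := by rw [← map_smul]; simp
  rw [this, map_smul, hr]; simp

/-- A left inverse of `dincl`.  It is only applied to elements of the centre `iℝ ⊆ Lie Γh`, i.e. of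
the image of `dincl`, where it is independent of the choice and identifies them with real
numbers. -/
def scalarPart : Fh →L[ℝ] ℝ := 𝔼.exists_scalarPart.choose

/-- The identification of the image of `incl` with the circle. -/
def circlePart (g : Γh) : Circle := invFun 𝔼.incl g

/-- The adjoint action of `Γ` on `Lie Γh`, through any lift of the group element to `Γh`. -/
def adLift (γ : Γ) : Fh →L[ℝ] Fh := Ad (surjInv 𝔼.q_surjective γ)

/-- `σ` is a vector space split of `Lie Γh → Lie Γ`. -/
def IsSplit (σ : F →L[ℝ] Fh) : Prop := ∀ v, 𝔼.dq (σ v) = v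

/-- The group cocycle `Z_σ(γ, v) = Ad_γ (σ v) - σ (Ad_γ v)`. -/
def groupCocycle (σ : F →L[ℝ] Fh) (γ : Γ) : F →L[ℝ] ℝ :=
  𝔼.scalarPart.comp ((𝔼.adLift γ).comp σ - σ.comp (Ad γ))

/-- The Lie algebra cocycle `[σ v, σ w] - σ [v, w]`. -/
def lieCocycle (σ : F →L[ℝ] Fh) (v w : F) : ℝ :=
  𝔼.scalarPart (lieBracket Γh (σ v) (σ w) - σ (lieBracket Γ v w))

/-- The connection `ν_σ = μh - σ (q^* μ)` on the circle bundle `q : Γh → Γ`. -/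
def nu (σ : F →L[ℝ] Fh) : OneForm 𝓘(ℝ, Fh) Γh ℝ := fun g =>
  𝔼.scalarPart.comp (maurerCartan Γh g - σ.comp (OneForm.pullback 𝔼.q (maurerCartan Γ) g))

end CentralExtension

end Extension

/-! ### Lifting problems with connection and splitting -/

section Lifting

universe u

variable {E : Type*} [NormedAddCommGroup E] [NormedSpace ℝ E]
  {X : Type u} [TopologicalSpace X] [ChartedSpace E X]
  {EB : Type*} [NormedAddCommGroup EB] [NormedSpace ℝ EB]
  {B : Type*} [TopologicalSpace B] [ChartedSpace EB B]
  {Fh : Type*} [NormedAddCommGroup Fh] [NormedSpace ℝ Fh]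
  {Γh : Type*} [Group Γh] [TopologicalSpace Γh] [ChartedSpace Fh Γh]
  {F : Type*} [NormedAddCommGroup F] [NormedSpace ℝ F]
  {Γ : Type*} [Group Γ] [TopologicalSpace Γ] [ChartedSpace F Γ]
  (𝔼 : CentralExtension Fh Γh F Γ) {proj : B → X} {act : B → Γ → B}

variable (EB) in
/-- A splitting of the principal bundle `B`, i.e. a vector bundle map
`L : B ×_Ad Lie Γh → B ×_Ad iℝ` which is the identity on `B ×_Ad iℝ`, written as the smooth
equivariant family of linear maps `L b` with `L [b, v] = [b, L b v]`. -/
structure Splitting (act : B → Γ → B) where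
  /-- The linear map at a point of `B`. -/
  L : B → Fh →L[ℝ] ℝ
  smooth : ContMDiff 𝓘(ℝ, EB) 𝓘(ℝ, Fh →L[ℝ] ℝ) ∞ L
  on_center : ∀ b t, L b (𝔼.dincl t) = t
  equivariant : ∀ b γ v, L (act b γ) (𝔼.adLift γ⁻¹ v) = L b v

variable (E) in
/-- The choices in the definition of the obstruction class of a principal bundle `B` with connection
`θ`: local sections `s_α`, lifts `g_αβ` to `Γh` of the transition functions, with
`g_βα = g_αβ⁻¹`, and lifts `θh_α` to `Lie Γh` of the connection forms `θ_α = s_α^* θ`. -/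
structure ObstructionData (proj : B → X) (act : B → Γ → B) (θ : OneForm 𝓘(ℝ, EB) B F)
    (𝔘 : Cover X) where
  /-- The local sections. -/
  s : 𝔘.ι → X → B
  smooth_s : ∀ α, ContMDiffOn 𝓘(ℝ, E) 𝓘(ℝ, EB) ∞ (s α) (𝔘.U α : Set X)
  proj_s : ∀ α, ∀ x ∈ 𝔘.U α, proj (s α x) = x
  /-- The lifted transition functions. -/
  g : 𝔘.ι → 𝔘.ι → X → Γh
  smooth_g : ∀ α β, ContMDiffOn 𝓘(ℝ, E) 𝓘(ℝ, Fh) ∞ (g α β) (𝔘.U α ∩ 𝔘.U β : Set X)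
  act_g : ∀ α β, ∀ x, x ∈ 𝔘.U α → x ∈ 𝔘.U β → act (s α x) (𝔼.q (g α β x)) = s β x
  g_inv : ∀ α β, ∀ x, x ∈ 𝔘.U α → x ∈ 𝔘.U β → g β α x = (g α β x)⁻¹
  /-- The lifted connection forms. -/
  θh : 𝔘.ι → OneForm 𝓘(ℝ, E) X Fh
  smooth_θh : ∀ α, OneForm.SmoothOn (θh α) (𝔘.U α : Set X)
  dq_θh : ∀ α, ∀ x ∈ 𝔘.U α, 𝔼.dq.comp (θh α x) = OneForm.pullback (s α) θ x

/-- The Čech cochain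
`z_αβγ = g_αβ g_βγ g_γα`, `u_αβ = θh_β - (Ad_{g_αβ⁻¹} θh_α + g_αβ^* μh)`,
`K_α = L(s_α, dθh_α + ½[θh_α, θh_α])`. -/
def ObstructionData.cochain {𝔼 : CentralExtension Fh Γh F Γ} {θ : OneForm 𝓘(ℝ, EB) B F} {𝔘 : Cover X}
    (O : ObstructionData E 𝔼 proj act θ 𝔘) (𝓛 : Splitting EB 𝔼 act) :
    Cochain 𝓘(ℝ, E) (X := X) 𝔘.ι where
  z α β γ x := 𝔼.circlePart (O.g α β x * O.g β γ x * O.g γ α x)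
  u α β x := 𝔼.scalarPart.comp (O.θh β x - ((Ad (O.g α β x)⁻¹).comp (O.θh α x) +
    OneForm.pullback (O.g α β) (maurerCartan Γh) x))
  K α x v w := 𝓛.L (O.s α x) (curvature Γh (O.θh α) x v w)

/-- `c` is the obstruction class of `(B, θ, L)`: the choices can be made on some open cover, and for
all choices on all open covers the associated cochain is a cocycle which represents `c`. -/
structure IsObstructionClass (proj : B → X) (act : B → Γ → B) (θ : OneForm 𝓘(ℝ, EB) B F)
    (𝓛 : Splitting EB 𝔼 act) (c : DeligneH2 𝓘(ℝ, E) X) : Prop where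
  exists_data : ∃ 𝔘 : Cover X, Nonempty (ObstructionData E 𝔼 proj act θ 𝔘)
  represents : ∀ (𝔘 : Cover X) (O : ObstructionData E 𝔼 proj act θ 𝔘),
    ∃ h : (O.cochain 𝓛).IsCocycle 𝓘(ℝ, E) 𝔘, deligneClass 𝓘(ℝ, E) 𝔘 (O.cochain 𝓛) h = c

/-- The lifting bundle gerbe `(J_B, B)`.  The fibre product `B^[2]` is `B × Γ`, through
`(b, γ) ↦ (b, b γ)`, so that `ζ : B^[2] → Γ` with `b₁ ζ(b₁, b₂) = b₂` is the second projection, and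
`J_B = ζ^* Γh` is `B × Γh`. -/
def liftingGerbe [LieGroup 𝓘(ℝ, F) ∞ Γ] [LieGroup 𝓘(ℝ, Fh) ∞ Γh]
    (hB : IsPrincipalBundle 𝓘(ℝ, F) 𝓘(ℝ, EB) 𝓘(ℝ, E) proj act) :
    BundleGerbe 𝓘(ℝ, E) X 𝓘(ℝ, EB) B (𝓘(ℝ, EB).prod 𝓘(ℝ, F)) (B × Γ)
      (𝓘(ℝ, EB).prod 𝓘(ℝ, Fh)) (B × Γh) where
  π := proj
  smooth_π := hB.smooth_proj
  locally_split x := by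
    obtain ⟨U, s, t, hU, hx, hs, -, h, -⟩ := hB.locally_trivial x
    exact ⟨U, s, hU, hx, hs, h⟩
  pr₁ := Prod.fst
  pr₂ p := act p.1 p.2
  smooth_pr₁ := contMDiff_fst
  smooth_pr₂ := hB.smooth_act
  π_pr p := (hB.proj_act p.1 p.2).symm
  pr_injective := by
    rintro ⟨b, γ⟩ ⟨b', γ'⟩ h h'
    obtain rfl : b = b' := h
    obtain ⟨U, s, t, -, hx, -, -, -, h1, h2⟩ := hB.locally_trivial (proj b)
    change act b γ = act b γ' at h'
    rw [← h1 b hx, ← hB.act_mul, ← hB.act_mul] at h'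
    have := congrArg t h'
    rw [h2 _ hx, h2 _ hx] at this
    rw [mul_left_cancel this]
  pr_local_inverse := by
    intro b b' hb
    obtain ⟨U, s, t, hU, hx, -, ht, -, h1, -⟩ := hB.locally_trivial (proj b)
    refine ⟨(proj ⁻¹' U) ×ˢ (proj ⁻¹' U), fun p => (p.1, (t p.1)⁻¹ * t p.2), ?_, ⟨hx, ?_⟩, ?_, ?_⟩
    · exact (hU.preimage hB.smooth_proj.continuous).prod (hU.preimage hB.smooth_proj.continuous)
    · simpa [← hb] using hx
    · refine contMDiffOn_fst.prodMk (ContMDiffOn.mul (ContMDiffOn.inv ?_) ?_)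
      · exact ht.comp contMDiffOn_fst fun p hp => hp.1
      · exact ht.comp contMDiffOn_snd fun p hp => hp.2
    · rintro ⟨p, p'⟩ ⟨hp, hp'⟩ h
      refine ⟨rfl, ?_⟩
      have h' : proj p = proj p' := h
      change act p ((t p)⁻¹ * t p') = p'
      conv_lhs => rw [← h1 p hp]
      rw [h1 p hp, hB.act_mul]
      conv_lhs => enter [1, 1]; rw [← h1 p hp]
      rw [← hB.act_mul, ← hB.act_mul, mul_inv_cancel_left, h', h1 p' hp']
  proj p := (p.1, 𝔼.q p.2)
  act p z := (p.1, p.2 * 𝔼.incl z)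
  isPrincipal :=
    { smooth_proj := contMDiff_fst.prodMk (𝔼.isPrincipal.smooth_proj.comp contMDiff_snd)
      smooth_act := (contMDiff_fst.comp contMDiff_fst).prodMk
        ((contMDiff_snd.comp contMDiff_fst).mul (𝔼.contMDiff_incl.comp contMDiff_snd))
      act_one := fun p => by simp
      act_mul := fun p z z' => by simp [mul_assoc]
      proj_act := fun p z => by simp [𝔼.q_incl]
      locally_trivial := by
        rintro ⟨b, γ⟩
        obtain ⟨U, s, t, hU, hx, hs, ht, h1, h2, h3⟩ := 𝔼.isPrincipal.locally_trivial γ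
        refine ⟨Prod.snd ⁻¹' U, fun p => (p.1, s p.2), fun p => t p.2,
          hU.preimage continuous_snd, hx, ?_, ?_, ?_, ?_, ?_⟩
        · exact contMDiffOn_fst.prodMk (hs.comp contMDiffOn_snd fun p hp => hp)
        · exact ht.comp contMDiffOn_snd fun p hp => hp
        · exact fun p hp => Prod.ext rfl (h1 p.2 hp)
        · exact fun p hp => Prod.ext rfl (h2 p.2 hp)
        · exact fun p hp z => h3 p.2 hp z }
  mul p p' := (p.1, p.2 * p'.2)
  smooth_mul := by
    refine ContMDiff.contMDiffOn ?_
    exact (contMDiff_fst.comp contMDiff_fst).prodMk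
      ((contMDiff_snd.comp contMDiff_fst).mul (contMDiff_snd.comp contMDiff_snd))
  pr₁_mul _ _ _ := rfl
  pr₂_mul := by
    intro p p' h
    have h' : act p.1 (𝔼.q p.2) = p'.1 := h
    simp [hB.act_mul, h']
  mul_act := by
    intro p p' z z' _
    refine Prod.ext rfl ?_
    simp only [map_mul]
    rw [mul_assoc, ← mul_assoc (𝔼.incl z), 𝔼.central, mul_assoc, mul_assoc]
  mul_assoc _ _ _ _ _ := by simp [mul_assoc]

/-- The connection `∇_{θ,σ} = ν_σ + Z_σ(ζ⁻¹, π₁^* θ)` on the lifting bundle gerbe; at `(b, g)` in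
`B × Γh` the value of `ζ` is `q g`. -/
def gerbeConnection (θ : OneForm 𝓘(ℝ, EB) B F) (σ : F →L[ℝ] Fh) :
    OneForm (𝓘(ℝ, EB).prod 𝓘(ℝ, Fh)) (B × Γh) ℝ := fun p =>
  OneForm.pullback Prod.snd (𝔼.nu σ) p +
    (𝔼.groupCocycle σ (𝔼.q p.2)⁻¹).comp (OneForm.pullback Prod.fst θ p)

/-- The curving `f_{θ,σ} = - ½ η_σ(θ, θ) - l_σ(b, F_θ)`, where `η_σ` is the Lie algebra cocycle and
`l_σ(b, v) = L b (σ v)` is the reduced splitting. -/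
def gerbeCurving {act : B → Γ → B} (θ : OneForm 𝓘(ℝ, EB) B F) (𝓛 : Splitting EB 𝔼 act)
    (σ : F →L[ℝ] Fh) : TwoForm 𝓘(ℝ, EB) B ℝ := fun b v w =>
  - 𝔼.lieCocycle σ (θ b v) (θ b w) - 𝓛.L b (σ (curvature Γ θ b v w))

end Lifting

end LiftingGerbe

end

/-!
Both classes are instances of one construction.  Call a one-form with values in `Lie Γh` along a
section `s` of `B` a lift if it projects to `s^* θ`, and let `ϑ · g = Ad_{g⁻¹} ϑ + g^* μh` be the
gauge transform (`gauge`).  If `ϑ` and `ϑ'` are lifts along `s` and `s' = s · q g`, then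
`ϑ' - ϑ · g` takes values in the centre `iℝ`, because `θ` transforms by gauge transformations
(`IsPrincipalConnection.pull_act`).  This central form is `CentralExtension.defect`.  Since the
centre is fixed by `Ad`, the defect is additive under composition (`CentralExtension.defect_mul`),
and multiplying `g` by a circle-valued function `z` changes it by `- d log z`
(`CentralExtension.defect_mul_incl`).  Since curvature is covariant under gauge transformations
(`curv_gauge`) and central forms contribute nothing to the bracket, the split curvature
`K = L(s, dϑ + [ϑ, ϑ]/2)` satisfies `K' - K = d(ϑ' - ϑ · g)` (`Splitting.L_curv_sub`).

For sections `s_α`, lifts `g_αβ` of the transition functions and lifts `ϑ_α` of the connection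
forms (`LiftData`), these three rules are the cocycle conditions for
`(z_αβγ, ϑ_β - ϑ_α · g_αβ, K_α)` with `g_αβ g_βγ = g_αγ z_αβγ` (`LiftData.isCocycle`).  The same
three rules, applied to local functions `r_α` with `s'_α = s_α · q r_α`, show that any other choice
gives a cohomologous cocycle on a common refinement, because such `r_α` exist on small open sets
(`LiftData.refinesTo`, `LiftData.class_eq`).

The cochain of the obstruction class is visibly of this form.  For the lifting gerbe, a section of
`J_B` over `(s_α, s_β)` is exactly a lift of the transition function, and unwinding the definitions
of the cocycles `Z_σ` and `ω_σ` shows that the pull-back of `∇_{θ,σ}` under `(b, g)` is minus the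
defect of `σ (b^* θ)` and `σ ((b · q g)^* θ)` (`pull_gerbeConnection`), while
`f_{θ,σ} = - L(·, d(σθ) + [σθ, σθ]/2)` (`gerbeCurving_eq`).  So its cochain is that of the lifted
data with `ϑ_α = σ (s_α^* θ)`, and the same rules yield that `∇_{θ,σ}` is a bundle gerbe connection
with curving `f_{θ,σ}`.

The choices exist globally because `X` is paracompact: a cover can be chosen for which the
transition functions lift on whole overlaps, not only near points (`exists_cover_liftableOn`).

The covariance of curvature rests on the Maurer-Cartan equation and the derivative of the adjoint
action in Banach-Lie groups, both of which are read off from the group product in a chart around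
the identity.
-/

noncomputable section

set_option linter.unusedSectionVars false

namespace LiftingGerbe

/-! ### Derivatives and one-forms in model-space coordinates -/

section Calculus

variable {E : Type*} [NormedAddCommGroup E] [NormedSpace ℝ E]
  {H : Type*} [TopologicalSpace H] {I : ModelWithCorners ℝ E H}
  {M : Type*} [TopologicalSpace M] [ChartedSpace H M]
  {E' : Type*} [NormedAddCommGroup E'] [NormedSpace ℝ E']
  {H' : Type*} [TopologicalSpace H'] {I' : ModelWithCorners ℝ E' H'}
  {N : Type*} [TopologicalSpace N] [ChartedSpace H' N]
  {E'' : Type*} [NormedAddCommGroup E''] [NormedSpace ℝ E'']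
  {H'' : Type*} [TopologicalSpace H''] {I'' : ModelWithCorners ℝ E'' H''}
  {P : Type*} [TopologicalSpace P] [ChartedSpace H'' P]
  {V : Type*} [NormedAddCommGroup V] [NormedSpace ℝ V]
  {W : Type*} [NormedAddCommGroup W] [NormedSpace ℝ W]

variable (I I') in
/-- The derivative of a map of manifolds, as a continuous linear map between the model spaces.
Every tangent space is by definition the model space, and this form of the derivative keeps the
algebraic operations those of the model spaces. -/
def tder (f : M → N) (x : M) : E →L[ℝ] E' := mfderiv I I' f x

theorem tder_comp {g : N → P} {f : M → N} {x : M} (hg : MDifferentiableAt I' I'' g (f x))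
    (hf : MDifferentiableAt I I' f x) :
    tder I I'' (fun y => g (f y)) x = (tder I' I'' g (f x)).comp (tder I I' f x) :=
  mfderiv_comp x hg hf

theorem tder_congr {f g : M → N} {x : M} (h : f =ᶠ[𝓝 x] g) : tder I I' f x = tder I I' g x :=
  h.mfderiv_eq

@[simp] theorem tder_const (c : N) (x : M) : tder I I' (fun _ : M => c) x = 0 := mfderiv_const

@[simp] theorem tder_id (x : M) : tder I I (fun y : M => y) x = ContinuousLinearMap.id ℝ E :=
  mfderiv_id

theorem tder_eq_fderiv (f : V → W) (x : V) : tder 𝓘(ℝ, V) 𝓘(ℝ, W) f x = fderiv ℝ f x :=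
  mfderiv_eq_fderiv

theorem tder_prodMk {f : M → N} {g : M → P} {x : M} (hf : MDifferentiableAt I I' f x)
    (hg : MDifferentiableAt I I'' g x) :
    tder I (I'.prod I'') (fun y => (f y, g y)) x = (tder I I' f x).prod (tder I I'' g x) :=
  mfderiv_prodMk hf hg

/-- The chain rule for a map of two variables. -/
theorem tder_two {E₁ : Type*} [NormedAddCommGroup E₁] [NormedSpace ℝ E₁]
    {H₁ : Type*} [TopologicalSpace H₁] {I₁ : ModelWithCorners ℝ E₁ H₁}
    {Q : Type*} [TopologicalSpace Q] [ChartedSpace H₁ Q] {f : N → P → Q}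
    {a : M → N} {b : M → P} {x : M}
    (hf : MDifferentiableAt (I'.prod I'') I₁ (uncurry f) (a x, b x))
    (ha : MDifferentiableAt I I' a x) (hb : MDifferentiableAt I I'' b x) :
    tder I I₁ (fun y => f (a y) (b y)) x =
      (tder I' I₁ (fun z => f z (b x)) (a x)).comp (tder I I' a x) +
      (tder I'' I₁ (fun z => f (a x) z) (b x)).comp (tder I I'' b x) := by
  have h := tder_comp (I := I) (f := fun y => (a y, b y)) hf (ha.prodMk hb)
  rw [tder_prodMk ha hb] at h
  refine h.trans ?_
  ext v
  exact mfderiv_prod_eq_add_apply hf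

theorem _root_.ContMDiffAt.eventually_mdifferentiableAt [IsManifold I ∞ M] [IsManifold I' ∞ N]
    {f : M → N} {x : M} (hf : ContMDiffAt I I' ∞ f x) :
    ∀ᶠ y in 𝓝 x, MDifferentiableAt I I' f y := by
  have : IsManifold I 1 M := .of_le (n := ∞) (by simp)
  have : IsManifold I' 1 N := .of_le (n := ∞) (by simp)
  filter_upwards [(contMDiffAt_iff_contMDiffAt_nhds (by simp)).1 (hf.of_le (m := 1) (by simp))]
    with y hy
  exact hy.mdifferentiableAt (by simp)

theorem tder_extChartAt_self [IsManifold I ∞ M] (x : M) :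
    tder I 𝓘(ℝ, E) (extChartAt I x) x = ContinuousLinearMap.id ℝ E :=
  have : IsManifold I 1 M := .of_le (n := ∞) (by simp)
  mfderiv_extChartAt_self

theorem contMDiffAt_extChartAt_of_mem [IsManifold I ∞ M] {x₀ x : M}
    (hx : x ∈ (extChartAt I x₀).source) : ContMDiffAt I 𝓘(ℝ, E) ∞ (extChartAt I x₀) x :=
  contMDiffAt_extChartAt' (by simpa using hx)

/-- The expression of a one-form in the chart around `x₀`. -/
def chartForm (I : ModelWithCorners ℝ E H) (η : M → E →L[ℝ] V) (x₀ : M) (e : E) : E →L[ℝ] V :=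
  (η ((extChartAt I x₀).symm e)).comp (tder 𝓘(ℝ, E) I (extChartAt I x₀).symm e)

/-- Smoothness of a one-form at a point, tested in every chart of the form `chartAt x₀`. -/
def FormSmoothAt (I : ModelWithCorners ℝ E H) (η : M → E →L[ℝ] V) (x : M) : Prop :=
  ∀ x₀ : M, x ∈ (extChartAt I x₀).source →
    ContDiffAt ℝ ∞ (chartForm I η x₀) (extChartAt I x₀ x)

/-- The exterior derivative of a one-form at `x`, in the chart around `x`. -/
def extD (I : ModelWithCorners ℝ E H) (η : M → E →L[ℝ] V) (x : M) (v w : E) : V :=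
  fderiv ℝ (chartForm I η x) (extChartAt I x x) v w -
    fderiv ℝ (chartForm I η x) (extChartAt I x x) w v

/-- The pull-back of a one-form. -/
def pull (I : ModelWithCorners ℝ E H) (I' : ModelWithCorners ℝ E' H') (f : M → N)
    (η : N → E' →L[ℝ] V) (x : M) : E →L[ℝ] V := (η (f x)).comp (tder I I' f x)

theorem OneForm.d_eq_extD [IsManifold I ∞ M] (η : OneForm I M V) (x : M) (v w : E) :
    OneForm.d η x v w = extD I η x v w := by
  have h := tder_extChartAt_self (I := I) x
  change fderiv ℝ (chartForm I η x) _ (tder I 𝓘(ℝ, E) (extChartAt I x) x v)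
    (tder I 𝓘(ℝ, E) (extChartAt I x) x w) - fderiv ℝ (chartForm I η x) _
    (tder I 𝓘(ℝ, E) (extChartAt I x) x w) (tder I 𝓘(ℝ, E) (extChartAt I x) x v) = _
  rw [h]
  rfl

theorem FormSmoothAt.oneForm_smoothOn {η : OneForm I M V} {U : Set M}
    (h : ∀ x ∈ U, FormSmoothAt I η x) : OneForm.SmoothOn η U := by
  rintro x₀ e ⟨he, heU⟩
  have := h _ heU x₀ ((extChartAt I x₀).map_target he)
  rw [(extChartAt I x₀).right_inv he] at this
  exact this.contDiffWithinAt

theorem pull_comp {g : N → P} {f : M → N} {x : M} (hg : MDifferentiableAt I' I'' g (f x))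
    (hf : MDifferentiableAt I I' f x) (η : P → E'' →L[ℝ] V) :
    pull I I'' (fun y => g (f y)) η x = pull I I' f (pull I' I'' g η) x := by
  simp only [pull, tder_comp hg hf]
  rfl

theorem pull_congr {f g : M → N} {x : M} (h : f =ᶠ[𝓝 x] g) (η : N → E' →L[ℝ] V) :
    pull I I' f η x = pull I I' g η x := by
  simp only [pull, tder_congr h, h.self_of_nhds]

theorem contDiffAt_extChartAt_comp [IsManifold I' ∞ N] {h : E → N} {e₀ : E} {y : N}
    (hh : ContMDiffAt 𝓘(ℝ, E) I' ∞ h e₀) (hy : h e₀ ∈ (extChartAt I' y).source) :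
    ContDiffAt ℝ ∞ (fun e => extChartAt I' y (h e)) e₀ :=
  ((contMDiffAt_extChartAt_of_mem hy).comp e₀ hh).contDiffAt

theorem FormSmoothAt.add {η η' : M → E →L[ℝ] V} {x : M} (hη : FormSmoothAt I η x)
    (hη' : FormSmoothAt I η' x) : FormSmoothAt I (fun y => η y + η' y) x := fun x₀ hx => by
  have : chartForm I (fun y => η y + η' y) x₀ =
      fun e => chartForm I η x₀ e + chartForm I η' x₀ e := by
    funext e; simp [chartForm]
  rw [this]; exact (hη x₀ hx).add (hη' x₀ hx)

theorem FormSmoothAt.sub {η η' : M → E →L[ℝ] V} {x : M} (hη : FormSmoothAt I η x)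
    (hη' : FormSmoothAt I η' x) : FormSmoothAt I (fun y => η y - η' y) x := fun x₀ hx => by
  have : chartForm I (fun y => η y - η' y) x₀ =
      fun e => chartForm I η x₀ e - chartForm I η' x₀ e := by
    funext e; simp [chartForm]
  rw [this]; exact (hη x₀ hx).sub (hη' x₀ hx)

theorem extD_add {η η' : M → E →L[ℝ] V} {x : M} (hη : FormSmoothAt I η x)
    (hη' : FormSmoothAt I η' x) (v w : E) :
    extD I (fun y => η y + η' y) x v w = extD I η x v w + extD I η' x v w := by
  have : chartForm I (fun y => η y + η' y) x =
      fun e => chartForm I η x e + chartForm I η' x e := by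
    funext e; simp [chartForm]
  have hx := mem_extChartAt_source (I := I) x
  rw [extD, this, fderiv_fun_add ((hη x hx).differentiableAt (by simp))
    ((hη' x hx).differentiableAt (by simp))]
  simp only [add_apply, extD]
  abel

theorem chartForm_congr {η η' : M → E →L[ℝ] V} {x x₀ : M} (h : η =ᶠ[𝓝 x] η')
    (hx : x ∈ (extChartAt I x₀).source) :
    chartForm I η x₀ =ᶠ[𝓝 (extChartAt I x₀ x)] chartForm I η' x₀ := by
  have h1 : ∀ᶠ e in 𝓝 (extChartAt I x₀ x),
      η ((extChartAt I x₀).symm e) = η' ((extChartAt I x₀).symm e) := by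
    refine (continuousAt_extChartAt_symm' hx).eventually (p := fun y => η y = η' y) ?_
    rwa [(extChartAt I x₀).left_inv hx]
  filter_upwards [h1] with e he
  simp only [chartForm, he]

theorem FormSmoothAt.congr {η η' : M → E →L[ℝ] V} {x : M} (hη : FormSmoothAt I η x)
    (h : η' =ᶠ[𝓝 x] η) : FormSmoothAt I η' x :=
  fun x₀ hx => (hη x₀ hx).congr_of_eventuallyEq (chartForm_congr h hx)

theorem extD_congr {η η' : M → E →L[ℝ] V} {x : M} (h : η =ᶠ[𝓝 x] η') (v w : E) :
    extD I η x v w = extD I η' x v w := by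
  simp only [extD, (chartForm_congr h (mem_extChartAt_source x)).fderiv_eq]

variable [I.Boundaryless]

theorem extChartAt_target_mem_nhds_of_mem {x₀ x : M} (hx : x ∈ (extChartAt I x₀).source) :
    (extChartAt I x₀).target ∈ 𝓝 (extChartAt I x₀ x) :=
  (isOpen_extChartAt_target x₀).mem_nhds ((extChartAt I x₀).map_source hx)

theorem contMDiffAt_extChartAt_symm [IsManifold I ∞ M] {x₀ : M} {e : E}
    (he : e ∈ (extChartAt I x₀).target) :
    ContMDiffAt 𝓘(ℝ, E) I ∞ (extChartAt I x₀).symm e :=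
  (contMDiffOn_extChartAt_symm x₀).contMDiffAt ((isOpen_extChartAt_target x₀).mem_nhds he)

theorem tder_extChartAt_symm_self [IsManifold I ∞ M] (x : M) :
    tder 𝓘(ℝ, E) I (extChartAt I x).symm (extChartAt I x x) = ContinuousLinearMap.id ℝ E := by
  have hx := mem_extChartAt_source (I := I) x
  have h1 : (fun e => extChartAt I x ((extChartAt I x).symm e)) =ᶠ[𝓝 (extChartAt I x x)]
      fun e => e := by
    filter_upwards [extChartAt_target_mem_nhds_of_mem hx] with e he
    exact (extChartAt I x).right_inv he
  have h2 := tder_congr (I := 𝓘(ℝ, E)) (I' := 𝓘(ℝ, E)) h1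
  rw [tder_id, tder_comp (I' := I) (g := extChartAt I x)
    (by
      rw [(extChartAt I x).left_inv hx]
      exact (contMDiffAt_extChartAt_of_mem hx).mdifferentiableAt (by simp))
    ((contMDiffAt_extChartAt_symm ((extChartAt I x).map_source hx)).mdifferentiableAt (by simp)),
    (extChartAt I x).left_inv hx, tder_extChartAt_self] at h2
  simpa using h2

theorem OneForm.SmoothOn.formSmoothAt {η : OneForm I M V} {U : Set M} (h : OneForm.SmoothOn η U)
    (hU : IsOpen U) {x : M} (hx : x ∈ U) : FormSmoothAt I η x := by
  intro x₀ hx₀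
  refine (h x₀).contDiffAt (Filter.inter_mem (extChartAt_target_mem_nhds_of_mem hx₀) ?_)
  refine (continuousAt_extChartAt_symm' hx₀).preimage_mem_nhds (hU.mem_nhds ?_)
  rwa [(extChartAt I x₀).left_inv hx₀]

/-- In a chart, a pull-back is the pull-back under a map from a vector space. -/
theorem chartForm_pull_eventuallyEq [IsManifold I ∞ M] [IsManifold I' ∞ N] {f : M → N} {x x₀ : M}
    (hf : ContMDiffAt I I' ∞ f x) (hx : x ∈ (extChartAt I x₀).source) (η : N → E' →L[ℝ] V) :
    chartForm I (pull I I' f η) x₀ =ᶠ[𝓝 (extChartAt I x₀ x)]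
      pull 𝓘(ℝ, E) I' (fun e => f ((extChartAt I x₀).symm e)) η := by
  have h1 : ∀ᶠ e in 𝓝 (extChartAt I x₀ x),
      MDifferentiableAt I I' f ((extChartAt I x₀).symm e) := by
    refine (continuousAt_extChartAt_symm' hx).eventually ?_
    rw [(extChartAt I x₀).left_inv hx]
    exact hf.eventually_mdifferentiableAt
  filter_upwards [h1, extChartAt_target_mem_nhds_of_mem hx] with e he he'
  exact (pull_comp he
    ((contMDiffAt_extChartAt_symm he').mdifferentiableAt (by simp)) η).symm

variable [I'.Boundaryless]

/-- Near `e₀`, the pull-back of a form under a map `h` from a vector space is the pull-back of its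
expression in a chart under the expression of `h`. -/
theorem pull_eventuallyEq_chartForm [IsManifold I' ∞ N] {h : E → N} {e₀ : E} {y : N}
    (hh : ContMDiffAt 𝓘(ℝ, E) I' ∞ h e₀) (hy : h e₀ ∈ (extChartAt I' y).source)
    (η : N → E' →L[ℝ] V) :
    pull 𝓘(ℝ, E) I' h η =ᶠ[𝓝 e₀] fun e => (chartForm I' η y (extChartAt I' y (h e))).comp
      (fderiv ℝ (fun e => extChartAt I' y (h e)) e) := by
  have h1 : ∀ᶠ e in 𝓝 e₀, h e ∈ (extChartAt I' y).source :=
    hh.continuousAt.preimage_mem_nhds ((isOpen_extChartAt_source y).mem_nhds hy)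
  filter_upwards [h1.eventually_nhds, hh.eventually_mdifferentiableAt] with e he hhe
  have he0 := he.self_of_nhds
  have h2 : h =ᶠ[𝓝 e] fun e => (extChartAt I' y).symm (extChartAt I' y (h e)) := by
    filter_upwards [he] with e he
    exact ((extChartAt I' y).left_inv he).symm
  have h3 : MDifferentiableAt 𝓘(ℝ, E) 𝓘(ℝ, E') (fun e => extChartAt I' y (h e)) e :=
    ((contMDiffAt_extChartAt_of_mem he0).mdifferentiableAt (by simp)).comp e hhe
  have h4 := tder_comp (I := 𝓘(ℝ, E)) (I'' := I') (g := (extChartAt I' y).symm)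
    (f := fun e => extChartAt I' y (h e))
    ((contMDiffAt_extChartAt_symm ((extChartAt I' y).map_source he0)).mdifferentiableAt
      (by simp)) h3
  rw [pull, chartForm, tder_congr h2, h4, (extChartAt I' y).left_inv he0, tder_eq_fderiv]
  rfl

theorem contDiffAt_pull_of_chart [IsManifold I' ∞ N] {h : E → N} {e₀ : E} {y : N}
    {η : N → E' →L[ℝ] V} (hh : ContMDiffAt 𝓘(ℝ, E) I' ∞ h e₀)
    (hy : h e₀ ∈ (extChartAt I' y).source)
    (hη : ContDiffAt ℝ ∞ (chartForm I' η y) (extChartAt I' y (h e₀))) :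
    ContDiffAt ℝ ∞ (pull 𝓘(ℝ, E) I' h η) e₀ := by
  refine ContDiffAt.congr_of_eventuallyEq ?_ (pull_eventuallyEq_chartForm hh hy η)
  have hk := contDiffAt_extChartAt_comp hh hy
  exact (hη.comp e₀ hk).clm_comp (hk.fderiv_right (by simp))

/-- Smoothness of a one-form need only be checked in one chart. -/
theorem formSmoothAt_of_chart [IsManifold I ∞ M] {η : M → E →L[ℝ] V} {x y : M}
    (hy : x ∈ (extChartAt I y).source)
    (hη : ContDiffAt ℝ ∞ (chartForm I η y) (extChartAt I y x)) : FormSmoothAt I η x := by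
  intro x₀ hx₀
  refine contDiffAt_pull_of_chart (y := y)
    (contMDiffAt_extChartAt_symm ((extChartAt I x₀).map_source hx₀)) ?_ ?_ <;>
  rwa [(extChartAt I x₀).left_inv hx₀]

/-- The exterior derivative commutes with pull-back under maps from a vector space: the second
derivative of the map drops out since it is symmetric. -/
theorem fderiv_pull_sub [IsManifold I' ∞ N] {h : E → N} {e₀ : E}
    {η : N → E' →L[ℝ] V} (hh : ContMDiffAt 𝓘(ℝ, E) I' ∞ h e₀) (hη : FormSmoothAt I' η (h e₀))
    (v w : E) :
    fderiv ℝ (pull 𝓘(ℝ, E) I' h η) e₀ v w - fderiv ℝ (pull 𝓘(ℝ, E) I' h η) e₀ w v =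
      extD I' η (h e₀) (tder 𝓘(ℝ, E) I' h e₀ v) (tder 𝓘(ℝ, E) I' h e₀ w) := by
  have hy := mem_extChartAt_source (I := I') (h e₀)
  have hk := contDiffAt_extChartAt_comp hh hy
  have hη' := hη (h e₀) hy
  set k : E → E' := fun e => extChartAt I' (h e₀) (h e) with hkdef
  have h1 : fderiv ℝ k e₀ = tder 𝓘(ℝ, E) I' h e₀ := by
    rw [← tder_eq_fderiv, hkdef, tder_comp
      ((contMDiffAt_extChartAt_of_mem hy).mdifferentiableAt (by simp))
      (hh.mdifferentiableAt (by simp)), tder_extChartAt_self]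
    rfl
  have hk2 : ContDiffAt ℝ ∞ (fderiv ℝ k) e₀ := hk.fderiv_right (by simp)
  have hc : HasFDerivAt (fun e => chartForm I' η (h e₀) (k e))
      ((fderiv ℝ (chartForm I' η (h e₀)) (k e₀)).comp (fderiv ℝ k e₀)) e₀ :=
    HasFDerivAt.comp (g := chartForm I' η (h e₀)) e₀
      (hη'.differentiableAt (by simp)).hasFDerivAt (hk.differentiableAt (by simp)).hasFDerivAt
  have hd := hc.clm_comp (hk2.differentiableAt (by simp)).hasFDerivAt
  rw [(pull_eventuallyEq_chartForm hh hy η).fderiv_eq, hd.fderiv]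
  have hs := hk.isSymmSndFDerivAt (by
    simp only [minSmoothness_of_isRCLikeNormedField]; exact WithTop.coe_le_coe.2 le_top) v w
  simp only [add_apply, ContinuousLinearMap.comp_apply,
    ContinuousLinearMap.compL_apply, ContinuousLinearMap.flip_apply, extD]
  rw [hs, h1]
  simp only [hkdef]
  abel

theorem FormSmoothAt.pull [IsManifold I ∞ M] [IsManifold I' ∞ N] {f : M → N} {x : M}
    {η : N → E' →L[ℝ] V} (hη : FormSmoothAt I' η (f x)) (hf : ContMDiffAt I I' ∞ f x) :
    FormSmoothAt I (pull I I' f η) x := by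
  have hx := mem_extChartAt_source (I := I) x
  refine formSmoothAt_of_chart hx ?_
  refine ContDiffAt.congr_of_eventuallyEq ?_ (chartForm_pull_eventuallyEq hf hx η)
  have hl := (extChartAt I x).left_inv hx
  refine contDiffAt_pull_of_chart (y := f x) ?_ ?_ ?_
  · refine ContMDiffAt.comp _ (by rwa [hl])
      (contMDiffAt_extChartAt_symm ((extChartAt I x).map_source hx))
  · rw [hl]; exact mem_extChartAt_source _
  · rw [hl]; exact hη _ (mem_extChartAt_source _)

theorem extD_pull [IsManifold I ∞ M] [IsManifold I' ∞ N] {f : M → N} {x : M}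
    {η : N → E' →L[ℝ] V} (hη : FormSmoothAt I' η (f x)) (hf : ContMDiffAt I I' ∞ f x) (v w : E) :
    extD I (pull I I' f η) x v w = extD I' η (f x) (tder I I' f x v) (tder I I' f x w) := by
  have hx := mem_extChartAt_source (I := I) x
  have hl := (extChartAt I x).left_inv hx
  have hsymm := contMDiffAt_extChartAt_symm ((extChartAt I x).map_source hx)
  have hh : ContMDiffAt 𝓘(ℝ, E) I' ∞ (fun e => f ((extChartAt I x).symm e)) (extChartAt I x x) :=
    ContMDiffAt.comp _ (by rwa [hl]) hsymm
  have h1 : tder 𝓘(ℝ, E) I' (fun e => f ((extChartAt I x).symm e)) (extChartAt I x x) =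
      tder I I' f x := by
    rw [tder_comp (I' := I) (g := f) (by rw [hl]; exact hf.mdifferentiableAt (by simp))
      (hsymm.mdifferentiableAt (by simp)), hl, tder_extChartAt_symm_self]
    rfl
  rw [extD, (chartForm_pull_eventuallyEq hf hx η).fderiv_eq, fderiv_pull_sub hh (by rwa [hl]), h1,
    hl]

theorem FormSmoothAt.clm_comp {η : M → E →L[ℝ] V} {T : M → V →L[ℝ] W} {x : M}
    (hη : FormSmoothAt I η x) (hT : ContMDiffAt I 𝓘(ℝ, V →L[ℝ] W) ∞ T x) [IsManifold I ∞ M] :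
    FormSmoothAt I (fun y => (T y).comp (η y)) x := by
  have hx := mem_extChartAt_source (I := I) x
  refine formSmoothAt_of_chart hx ?_
  have hT' : ContDiffAt ℝ ∞ (fun e => T ((extChartAt I x).symm e)) (extChartAt I x x) := by
    refine (ContMDiffAt.comp (I' := I) _ ?_
      (contMDiffAt_extChartAt_symm ((extChartAt I x).map_source hx))).contDiffAt
    rwa [(extChartAt I x).left_inv hx]
  exact hT'.clm_comp (hη x hx)

/-- The Leibniz rule `d(T η) = T dη + dT ∧ η` for a function `T` with values in linear maps. -/
theorem extD_clm_comp {η : M → E →L[ℝ] V} {T : M → V →L[ℝ] W} {x : M}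
    (hη : FormSmoothAt I η x) (hT : ContMDiffAt I 𝓘(ℝ, V →L[ℝ] W) ∞ T x) [IsManifold I ∞ M]
    (v w : E) :
    extD I (fun y => (T y).comp (η y)) x v w = T x (extD I η x v w) +
      (tder I 𝓘(ℝ, V →L[ℝ] W) T x v (η x w) - tder I 𝓘(ℝ, V →L[ℝ] W) T x w (η x v)) := by
  have hx := mem_extChartAt_source (I := I) x
  have hl := (extChartAt I x).left_inv hx
  have hs := contMDiffAt_extChartAt_symm ((extChartAt I x).map_source hx)
  have hTs : ContMDiffAt I 𝓘(ℝ, V →L[ℝ] W) ∞ T ((extChartAt I x).symm (extChartAt I x x)) := by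
    rwa [hl]
  have hT' : ContDiffAt ℝ ∞ (fun e => T ((extChartAt I x).symm e)) (extChartAt I x x) :=
    (ContMDiffAt.comp (I' := I) _ hTs hs).contDiffAt
  have h1 : fderiv ℝ (fun e => T ((extChartAt I x).symm e)) (extChartAt I x x) =
      tder I 𝓘(ℝ, V →L[ℝ] W) T x := by
    rw [← tder_eq_fderiv, tder_comp (I' := I) (g := T) (hTs.mdifferentiableAt (by simp))
      (hs.mdifferentiableAt (by simp)), hl, tder_extChartAt_symm_self]
    rfl
  have hd := (hT'.differentiableAt (by simp)).hasFDerivAt.clm_comp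
    ((hη x hx).differentiableAt (by simp)).hasFDerivAt
  have h2 : chartForm I (fun y => (T y).comp (η y)) x =
      fun e => (T ((extChartAt I x).symm e)).comp (chartForm I η x e) := rfl
  have h3 : chartForm I η x (extChartAt I x x) = η x := by
    rw [chartForm, hl, tder_extChartAt_symm_self]; rfl
  rw [extD, h2, hd.fderiv, h1, h3, hl]
  simp only [add_apply, ContinuousLinearMap.comp_apply,
    ContinuousLinearMap.compL_apply, ContinuousLinearMap.flip_apply, extD, map_sub]
  abel

theorem FormSmoothAt.const_clm_comp [IsManifold I ∞ M] {η : M → E →L[ℝ] V} {x : M}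
    (hη : FormSmoothAt I η x) (T : V →L[ℝ] W) : FormSmoothAt I (fun y => T.comp (η y)) x :=
  hη.clm_comp (T := fun _ => T) contMDiffAt_const

theorem extD_const_clm_comp [IsManifold I ∞ M] {η : M → E →L[ℝ] V} {x : M}
    (hη : FormSmoothAt I η x) (T : V →L[ℝ] W) (v w : E) :
    extD I (fun y => T.comp (η y)) x v w = T (extD I η x v w) := by
  rw [extD_clm_comp (T := fun _ => T) hη contMDiffAt_const]
  simp

/-- The exterior derivative may be computed in any chart. -/
theorem extD_chart [IsManifold I ∞ M] {η : M → E →L[ℝ] V} {x₀ : M} {e : E}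
    (he : e ∈ (extChartAt I x₀).target) (hη : FormSmoothAt I η ((extChartAt I x₀).symm e))
    (v w : E) :
    extD I η ((extChartAt I x₀).symm e) (tder 𝓘(ℝ, E) I (extChartAt I x₀).symm e v)
      (tder 𝓘(ℝ, E) I (extChartAt I x₀).symm e w) =
    fderiv ℝ (chartForm I η x₀) e v w - fderiv ℝ (chartForm I η x₀) e w v :=
  (fderiv_pull_sub (contMDiffAt_extChartAt_symm he) hη v w).symm

end Calculus

/-! ### The Maurer-Cartan form and the adjoint action -/

section LieGroupCalculus

variable {EG : Type*} [NormedAddCommGroup EG] [NormedSpace ℝ EG]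
  {G : Type*} [Group G] [TopologicalSpace G] [ChartedSpace EG G] [LieGroup 𝓘(ℝ, EG) ∞ G]
  {E : Type*} [NormedAddCommGroup E] [NormedSpace ℝ E]
  {H : Type*} [TopologicalSpace H] {I : ModelWithCorners ℝ E H}
  {M : Type*} [TopologicalSpace M] [ChartedSpace H M]

variable (G) in
/-- The Maurer-Cartan form, with values in maps between model spaces. -/
def mcForm (g : G) : EG →L[ℝ] EG := tder 𝓘(ℝ, EG) 𝓘(ℝ, EG) (fun x : G => g⁻¹ * x) g

/-- The pull-back `f^* μ = f⁻¹ df` of the Maurer-Cartan form. -/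
def pullMC (I : ModelWithCorners ℝ E H) (f : M → G) : M → E →L[ℝ] EG :=
  pull I 𝓘(ℝ, EG) f (mcForm G)

theorem mdifferentiable_mul_left (g : G) :
    MDifferentiable 𝓘(ℝ, EG) 𝓘(ℝ, EG) (fun x : G => g * x) :=
  (contMDiff_mul_left (I := 𝓘(ℝ, EG)) (n := ∞)).mdifferentiable (by simp)

theorem mdifferentiable_mul_right (g : G) :
    MDifferentiable 𝓘(ℝ, EG) 𝓘(ℝ, EG) (fun x : G => x * g) :=
  (contMDiff_mul_right (I := 𝓘(ℝ, EG)) (n := ∞)).mdifferentiable (by simp)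

theorem mdifferentiable_mul :
    MDifferentiable (𝓘(ℝ, EG).prod 𝓘(ℝ, EG)) 𝓘(ℝ, EG) (uncurry fun x y : G => x * y) :=
  (contMDiff_mul 𝓘(ℝ, EG) ∞).mdifferentiable (by simp)

theorem mdifferentiable_conj (g : G) :
    MDifferentiable 𝓘(ℝ, EG) 𝓘(ℝ, EG) (fun x : G => g * x * g⁻¹) :=
  (mdifferentiable_mul_right g⁻¹).comp (mdifferentiable_mul_left g)

theorem _root_.MDifferentiableAt.lieGroup_mul {f g : M → G} {x : M}
    (hf : MDifferentiableAt I 𝓘(ℝ, EG) f x) (hg : MDifferentiableAt I 𝓘(ℝ, EG) g x) :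
    MDifferentiableAt I 𝓘(ℝ, EG) (fun y => f y * g y) x :=
  (mdifferentiable_mul (f x, g x)).comp x (hf.prodMk hg)

theorem _root_.MDifferentiableAt.lieGroup_inv {f : M → G} {x : M}
    (hf : MDifferentiableAt I 𝓘(ℝ, EG) f x) :
    MDifferentiableAt I 𝓘(ℝ, EG) (fun y => (f y)⁻¹) x :=
  ((contMDiff_inv 𝓘(ℝ, EG) ∞).mdifferentiable (by simp) (f x)).comp x hf

/-- `f^* μ` at `x` is the derivative of `f(x)⁻¹ f`. -/
theorem pullMC_eq {f : M → G} {x : M} (hf : MDifferentiableAt I 𝓘(ℝ, EG) f x) :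
    pullMC I f x = tder I 𝓘(ℝ, EG) (fun y => (f x)⁻¹ * f y) x :=
  (tder_comp (mdifferentiable_mul_left (f x)⁻¹ (f x)) hf).symm

theorem pullMC_eq_of_eq_one {f : M → G} {x : M} (hf : MDifferentiableAt I 𝓘(ℝ, EG) f x)
    (hx : f x = 1) : pullMC I f x = tder I 𝓘(ℝ, EG) f x := by
  simp [pullMC_eq hf, hx]

/-- Left invariance of the Maurer-Cartan form. -/
theorem pullMC_const_mul {f : M → G} {x : M} (hf : MDifferentiableAt I 𝓘(ℝ, EG) f x) (g : G) :
    (pullMC I (fun y => g * f y) x : E →L[ℝ] EG) = pullMC I f x := by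
  rw [pullMC_eq hf, pullMC_eq ((mdifferentiableAt_const (c := g)).lieGroup_mul hf)]
  congr 1
  funext y
  group

theorem tder_mul_of_eq_one {u v : M → G} {x : M} (hu : MDifferentiableAt I 𝓘(ℝ, EG) u x)
    (hv : MDifferentiableAt I 𝓘(ℝ, EG) v x) (hux : u x = 1) (hvx : v x = 1) :
    tder I 𝓘(ℝ, EG) (fun y => u y * v y) x = tder I 𝓘(ℝ, EG) u x + tder I 𝓘(ℝ, EG) v x := by
  rw [tder_two (mdifferentiable_mul (u x, v x)) hu hv]
  simp [hux, hvx]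

theorem Ad_eq_tder (g : G) :
    (Ad g : EG →L[ℝ] EG) = tder 𝓘(ℝ, EG) 𝓘(ℝ, EG) (fun x : G => g * x * g⁻¹) 1 := rfl

theorem tder_conj_of_eq_one {u : M → G} {x : M} (hu : MDifferentiableAt I 𝓘(ℝ, EG) u x)
    (hux : u x = 1) (g : G) :
    tder I 𝓘(ℝ, EG) (fun y => g * u y * g⁻¹) x = (Ad g).comp (tder I 𝓘(ℝ, EG) u x) := by
  rw [tder_comp (g := fun z : G => g * z * g⁻¹) (mdifferentiable_conj g (u x)) hu, hux, Ad_eq_tder]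

theorem Ad_mul (g h : G) : (Ad (g * h) : EG →L[ℝ] EG) = (Ad g).comp (Ad h) := by
  rw [Ad_eq_tder h, ← tder_conj_of_eq_one (mdifferentiable_conj h 1) (by simp), Ad_eq_tder]
  congr 1
  funext x
  group

@[simp] theorem Ad_one : (Ad (1 : G) : EG →L[ℝ] EG) = ContinuousLinearMap.id ℝ EG := by
  simp [Ad_eq_tder]

/-- The product rule `(f g)^* μ = Ad_{g⁻¹} f^* μ + g^* μ`. -/
theorem pullMC_mul {f g : M → G} {x : M} (hf : MDifferentiableAt I 𝓘(ℝ, EG) f x)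
    (hg : MDifferentiableAt I 𝓘(ℝ, EG) g x) :
    (pullMC I (fun y => f y * g y) x : E →L[ℝ] EG) =
      (Ad (g x)⁻¹).comp (pullMC I f x) + pullMC I g x := by
  rw [pullMC_eq hf, pullMC_eq hg, pullMC_eq (hf.lieGroup_mul hg)]
  have hf' := (mdifferentiableAt_const (c := (f x)⁻¹)).lieGroup_mul hf
  have hg' := (mdifferentiableAt_const (c := (g x)⁻¹)).lieGroup_mul hg
  rw [← tder_conj_of_eq_one hf' (by simp), ← tder_mul_of_eq_one ?_ hg' (by simp) (by simp)]
  · congr 1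
    funext y
    group
  · exact (mdifferentiable_conj (g x)⁻¹ _).comp x hf'

@[simp] theorem pullMC_const (g : G) (x : M) : (pullMC I (fun _ : M => g) x : E →L[ℝ] EG) = 0 := by
  simp [pullMC, pull]

theorem pullMC_inv {f : M → G} {x : M} (hf : MDifferentiableAt I 𝓘(ℝ, EG) f x) :
    (pullMC I (fun y => (f y)⁻¹) x : E →L[ℝ] EG) = -(Ad (f x)).comp (pullMC I f x) := by
  have h := pullMC_mul hf hf.lieGroup_inv
  simp only [mul_inv_cancel, pullMC_const, inv_inv] at h
  exact (neg_eq_of_add_eq_zero_right h.symm).symm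

/-! ### Smoothness of the Maurer-Cartan form and of the adjoint action -/

theorem formSmoothAt_mcForm (g : G) : FormSmoothAt 𝓘(ℝ, EG) (mcForm G) g := by
  have hg := mem_extChartAt_source (I := 𝓘(ℝ, EG)) g
  have hl := (extChartAt 𝓘(ℝ, EG) g).left_inv hg
  refine formSmoothAt_of_chart hg ?_
  set φ := extChartAt 𝓘(ℝ, EG) g
  set ψ := (extChartAt 𝓘(ℝ, EG) g).symm
  set κ := extChartAt 𝓘(ℝ, EG) (1 : G)
  have hψ : ContMDiffAt 𝓘(ℝ, EG) 𝓘(ℝ, EG) ∞ ψ (φ g) :=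
    contMDiffAt_extChartAt_symm (φ.map_source hg)
  have hF : ContDiffAt ℝ ∞ (uncurry fun e e' : EG => κ ((ψ e)⁻¹ * ψ e')) (φ g, φ g) := by
    have h1 : ContMDiffAt 𝓘(ℝ, EG × EG) 𝓘(ℝ, EG) ∞ (fun p : EG × EG => ψ p.1) (φ g, φ g) :=
      ContMDiffAt.comp (g := ψ) (φ g, φ g) hψ contDiffAt_fst.contMDiffAt
    have h2 : ContMDiffAt 𝓘(ℝ, EG × EG) 𝓘(ℝ, EG) ∞ (fun p : EG × EG => ψ p.2) (φ g, φ g) :=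
      ContMDiffAt.comp (g := ψ) (φ g, φ g) hψ contDiffAt_snd.contMDiffAt
    refine (ContMDiffAt.comp (g := κ) (φ g, φ g) (contMDiffAt_extChartAt_of_mem ?_)
      (h1.inv.mul h2)).contDiffAt
    simp
  refine ContDiffAt.congr_of_eventuallyEq (hF.fderiv (g := fun e => e) contDiffAt_id (by simp)) ?_
  filter_upwards [extChartAt_target_mem_nhds_of_mem hg] with e he
  have h1 : MDifferentiableAt 𝓘(ℝ, EG) 𝓘(ℝ, EG) ψ e :=
    (contMDiffAt_extChartAt_symm he).mdifferentiableAt (by simp)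
  have h2 := (mdifferentiableAt_const (c := (ψ e)⁻¹)).lieGroup_mul h1
  have h3 : (ψ e)⁻¹ * ψ e = 1 := by simp
  rw [← tder_eq_fderiv, tder_comp (I' := 𝓘(ℝ, EG)) (g := κ) (by
    rw [h3]
    exact (contMDiffAt_extChartAt_of_mem (mem_extChartAt_source _)).mdifferentiableAt (n := ∞)
      (by simp)) h2, h3, tder_extChartAt_self]
  exact (tder_comp (mdifferentiable_mul_left (ψ e)⁻¹ (ψ e)) h1).symm

theorem formSmoothAt_pullMC [IsManifold I ∞ M] [I.Boundaryless] {f : M → G} {x : M}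
    (hf : ContMDiffAt I 𝓘(ℝ, EG) ∞ f x) : FormSmoothAt I (pullMC I f : M → E →L[ℝ] EG) x :=
  (formSmoothAt_mcForm (f x)).pull hf

/-- Maps from a manifold to a normed space are smooth if they are so in the charts `chartAt x`. -/
theorem contMDiffAt_of_comp_symm [IsManifold I ∞ M] {V : Type*} [NormedAddCommGroup V]
    [NormedSpace ℝ V] {f : M → V} {x : M}
    (hf : ContDiffAt ℝ ∞ (fun e => f ((extChartAt I x).symm e)) (extChartAt I x x)) :
    ContMDiffAt I 𝓘(ℝ, V) ∞ f x := by
  have h := ContMDiffAt.comp x hf.contMDiffAt (contMDiffAt_extChartAt (I := I) (n := ∞))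
  refine h.congr_of_eventuallyEq ?_
  filter_upwards [extChartAt_source_mem_nhds (I := I) x] with y hy
  simp only [comp_apply, (extChartAt I x).left_inv hy]

theorem contDiffAt_Ad_comp {f : E → G} {e₀ : E} (hf : ContMDiffAt 𝓘(ℝ, E) 𝓘(ℝ, EG) ∞ f e₀) :
    ContDiffAt ℝ ∞ (fun e => (Ad (f e) : EG →L[ℝ] EG)) e₀ := by
  have h1 := mem_extChartAt_source (I := 𝓘(ℝ, EG)) (1 : G)
  set κ := extChartAt 𝓘(ℝ, EG) (1 : G) with hκ
  have hl : κ.symm (κ 1) = 1 := κ.left_inv h1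
  have hψ : ContMDiffAt 𝓘(ℝ, EG) 𝓘(ℝ, EG) ∞ κ.symm (κ 1) :=
    contMDiffAt_extChartAt_symm (κ.map_source h1)
  have hF : ContDiffAt ℝ ∞ (uncurry fun (e : E) (y : EG) => κ (f e * κ.symm y * (f e)⁻¹))
      (e₀, κ 1) := by
    have h2 : ContMDiffAt 𝓘(ℝ, E × EG) 𝓘(ℝ, EG) ∞ (fun p : E × EG => f p.1) (e₀, κ 1) :=
      ContMDiffAt.comp (g := f) (e₀, κ 1) hf contDiffAt_fst.contMDiffAt
    have h3 : ContMDiffAt 𝓘(ℝ, E × EG) 𝓘(ℝ, EG) ∞ (fun p : E × EG => κ.symm p.2) (e₀, κ 1) :=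
      ContMDiffAt.comp (g := κ.symm) (e₀, κ 1) hψ contDiffAt_snd.contMDiffAt
    refine (ContMDiffAt.comp (g := κ) (e₀, κ 1) (contMDiffAt_extChartAt_of_mem ?_)
      ((h2.mul h3).mul h2.inv)).contDiffAt
    simp [hl]
  refine ContDiffAt.congr_of_eventuallyEq
    (hF.fderiv (g := fun _ => κ 1) contDiffAt_const (by simp)) (Filter.Eventually.of_forall ?_)
  intro e
  change Ad (f e) = fderiv ℝ (fun y => κ (f e * κ.symm y * (f e)⁻¹)) (κ 1)
  have h4 := hψ.mdifferentiableAt (by simp)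
  have h5 : MDifferentiableAt 𝓘(ℝ, EG) 𝓘(ℝ, EG) (fun y => f e * κ.symm y * (f e)⁻¹) (κ 1) :=
    (mdifferentiable_conj (f e) _).comp _ h4
  have h6 : f e * κ.symm (κ 1) * (f e)⁻¹ = 1 := by simp [hl]
  rw [← tder_eq_fderiv, tder_comp (I' := 𝓘(ℝ, EG)) (g := κ) (by
    rw [h6]
    exact (contMDiffAt_extChartAt_of_mem h1).mdifferentiableAt (by simp)) h5, h6,
    tder_extChartAt_self, tder_conj_of_eq_one h4 hl, tder_extChartAt_symm_self]
  rfl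

/-- The adjoint action is smooth for the norm topology on linear maps. -/
theorem contMDiff_Ad : ContMDiff 𝓘(ℝ, EG) 𝓘(ℝ, EG →L[ℝ] EG) ∞ (Ad : G → EG →L[ℝ] EG) :=
  fun g => contMDiffAt_of_comp_symm (contDiffAt_Ad_comp
    (contMDiffAt_extChartAt_symm ((extChartAt 𝓘(ℝ, EG) g).map_source (mem_extChartAt_source g))))

/-! ### The Lie bracket -/

variable (G) in
/-- The Lie group product in the chart around the identity. -/
def chartMul (x y : EG) : EG :=
  extChartAt 𝓘(ℝ, EG) (1 : G)
    ((extChartAt 𝓘(ℝ, EG) (1 : G)).symm x * (extChartAt 𝓘(ℝ, EG) (1 : G)).symm y)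

variable (G) in
/-- The coordinates of the identity in the chart around it. -/
def chartOne : EG := extChartAt 𝓘(ℝ, EG) (1 : G) 1

variable (G) in
/-- The left invariant vector fields in the chart around the identity: `leftFrame G x v` is the
value at `x` of the field through `v`. -/
def leftFrame (x : EG) : EG →L[ℝ] EG := fderiv ℝ (fun y => chartMul G x y) (chartOne G)

variable (G) in
/-- The right invariant vector fields in the chart around the identity. -/
def rightFrame (x : EG) : EG →L[ℝ] EG := fderiv ℝ (fun y => chartMul G y x) (chartOne G)

variable (G) in
theorem chartOne_symm : (extChartAt 𝓘(ℝ, EG) (1 : G)).symm (chartOne G) = 1 :=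
  (extChartAt 𝓘(ℝ, EG) (1 : G)).left_inv (mem_extChartAt_source 1)

variable (G) in
theorem chartOne_mem : (chartOne G : EG) ∈ (extChartAt 𝓘(ℝ, EG) (1 : G)).target :=
  (extChartAt 𝓘(ℝ, EG) (1 : G)).map_source (mem_extChartAt_source 1)

variable (G) in
theorem contMDiffAt_symm_chartOne :
    ContMDiffAt 𝓘(ℝ, EG) 𝓘(ℝ, EG) ∞ (extChartAt 𝓘(ℝ, EG) (1 : G)).symm (chartOne G) :=
  contMDiffAt_extChartAt_symm (chartOne_mem G)

variable (G) in
theorem contDiffAt_chartMul :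
    ContDiffAt ℝ ∞ (uncurry (chartMul G)) ((chartOne G : EG), (chartOne G : EG)) := by
  have hψ := contMDiffAt_symm_chartOne (EG := EG) G
  have h1 : ContMDiffAt 𝓘(ℝ, EG × EG) 𝓘(ℝ, EG) ∞
      (fun p : EG × EG => (extChartAt 𝓘(ℝ, EG) (1 : G)).symm p.1) (chartOne G, chartOne G) :=
    ContMDiffAt.comp (g := (extChartAt 𝓘(ℝ, EG) (1 : G)).symm) (chartOne G, chartOne G) hψ
      contDiffAt_fst.contMDiffAt
  have h2 : ContMDiffAt 𝓘(ℝ, EG × EG) 𝓘(ℝ, EG) ∞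
      (fun p : EG × EG => (extChartAt 𝓘(ℝ, EG) (1 : G)).symm p.2) (chartOne G, chartOne G) :=
    ContMDiffAt.comp (g := (extChartAt 𝓘(ℝ, EG) (1 : G)).symm) (chartOne G, chartOne G) hψ
      contDiffAt_snd.contMDiffAt
  refine (ContMDiffAt.comp (g := extChartAt 𝓘(ℝ, EG) (1 : G)) (chartOne G, chartOne G)
    (contMDiffAt_extChartAt_of_mem ?_) (h1.mul h2)).contDiffAt
  simp only [Pi.mul_apply, chartOne_symm, one_mul]
  exact mem_extChartAt_source _

variable (G) in
theorem contDiffAt_leftFrame : ContDiffAt ℝ ∞ (leftFrame G) (chartOne G : EG) :=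
  (contDiffAt_chartMul G).fderiv (g := fun _ => chartOne G) contDiffAt_const (by simp)

variable (G) in
theorem contDiffAt_rightFrame : ContDiffAt ℝ ∞ (rightFrame G) (chartOne G : EG) := by
  have h : ContDiffAt ℝ ∞ (uncurry fun x y : EG => chartMul G y x) (chartOne G, chartOne G) :=
    ContDiffAt.comp (g := uncurry (chartMul G)) ((chartOne G : EG), (chartOne G : EG))
      (contDiffAt_chartMul G) (contDiffAt_snd.prodMk contDiffAt_fst)
  exact h.fderiv (g := fun _ => chartOne G) contDiffAt_const (by simp)

theorem tder_extChartAt_comp_symm [IsManifold I ∞ M] [I.Boundaryless] {x₀ : M} {e : E}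
    (he : e ∈ (extChartAt I x₀).target) :
    (tder I 𝓘(ℝ, E) (extChartAt I x₀) ((extChartAt I x₀).symm e)).comp
      (tder 𝓘(ℝ, E) I (extChartAt I x₀).symm e) = ContinuousLinearMap.id ℝ E := by
  rw [← tder_comp ((contMDiffAt_extChartAt_of_mem
    ((extChartAt I x₀).map_target he)).mdifferentiableAt (by simp))
    ((contMDiffAt_extChartAt_symm he).mdifferentiableAt (by simp)), ← tder_id (I := 𝓘(ℝ, E)) e]
  refine tder_congr ?_
  filter_upwards [(isOpen_extChartAt_target x₀).mem_nhds he] with y hy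
  exact (extChartAt I x₀).right_inv hy

theorem tder_extChartAt_symm_comp [IsManifold I ∞ M] [I.Boundaryless] {x₀ : M} {e : E}
    (he : e ∈ (extChartAt I x₀).target) :
    (tder 𝓘(ℝ, E) I (extChartAt I x₀).symm e).comp
      (tder I 𝓘(ℝ, E) (extChartAt I x₀) ((extChartAt I x₀).symm e)) =
        ContinuousLinearMap.id ℝ E := by
  have hm := (extChartAt I x₀).map_target he
  have hr := (extChartAt I x₀).right_inv he
  have h := tder_comp (I := I) (I'' := I) (g := (extChartAt I x₀).symm)
    (f := extChartAt I x₀) (x := (extChartAt I x₀).symm e)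
    (by rw [hr]; exact (contMDiffAt_extChartAt_symm he).mdifferentiableAt (by simp))
    ((contMDiffAt_extChartAt_of_mem hm).mdifferentiableAt (by simp))
  rw [hr] at h
  rw [← h, ← tder_id (I := I) ((extChartAt I x₀).symm e)]
  refine tder_congr ?_
  filter_upwards [(isOpen_extChartAt_source x₀).mem_nhds hm] with y hy
  exact (extChartAt I x₀).left_inv hy

theorem leftFrame_eq {x : EG} (hx : x ∈ (extChartAt 𝓘(ℝ, EG) (1 : G)).target) :
    leftFrame G x = (tder 𝓘(ℝ, EG) 𝓘(ℝ, EG) (extChartAt 𝓘(ℝ, EG) (1 : G))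
      ((extChartAt 𝓘(ℝ, EG) (1 : G)).symm x)).comp
      (tder 𝓘(ℝ, EG) 𝓘(ℝ, EG) (fun y => (extChartAt 𝓘(ℝ, EG) (1 : G)).symm x * y) 1) := by
  set κ := extChartAt 𝓘(ℝ, EG) (1 : G) with hκ
  have h1 := (contMDiffAt_symm_chartOne (EG := EG) G).mdifferentiableAt (by simp)
  have h2 : κ.symm (chartOne G) = 1 := chartOne_symm G
  have h3 := (mdifferentiable_mul_left (κ.symm x) (κ.symm (chartOne G))).comp _ h1
  have h4 : κ.symm x * κ.symm (chartOne G) = κ.symm x := by rw [h2, mul_one]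
  have h5 := tder_comp (g := fun z : G => κ.symm x * z)
    (mdifferentiable_mul_left (κ.symm x) (κ.symm (chartOne G))) h1
  have h6 : tder 𝓘(ℝ, EG) 𝓘(ℝ, EG) κ.symm (chartOne G) = ContinuousLinearMap.id ℝ EG :=
    tder_extChartAt_symm_self 1
  have h7 := tder_comp (I' := 𝓘(ℝ, EG)) (g := κ) (f := fun y => κ.symm x * κ.symm y)
    (x := (chartOne G : EG)) (by
      rw [h4]
      exact (contMDiffAt_extChartAt_of_mem (κ.map_target hx)).mdifferentiableAt (by simp)) h3
  rw [h4, h5, h6, h2, ContinuousLinearMap.comp_id, tder_eq_fderiv] at h7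
  exact h7

theorem rightFrame_eq {x : EG} (hx : x ∈ (extChartAt 𝓘(ℝ, EG) (1 : G)).target) :
    rightFrame G x = (tder 𝓘(ℝ, EG) 𝓘(ℝ, EG) (extChartAt 𝓘(ℝ, EG) (1 : G))
      ((extChartAt 𝓘(ℝ, EG) (1 : G)).symm x)).comp
      (tder 𝓘(ℝ, EG) 𝓘(ℝ, EG) (fun y => y * (extChartAt 𝓘(ℝ, EG) (1 : G)).symm x) 1) := by
  set κ := extChartAt 𝓘(ℝ, EG) (1 : G) with hκ
  have h1 := (contMDiffAt_symm_chartOne (EG := EG) G).mdifferentiableAt (by simp)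
  have h2 : κ.symm (chartOne G) = 1 := chartOne_symm G
  have h3 := (mdifferentiable_mul_right (κ.symm x) (κ.symm (chartOne G))).comp _ h1
  have h4 : κ.symm (chartOne G) * κ.symm x = κ.symm x := by rw [h2, one_mul]
  have h5 := tder_comp (g := fun z : G => z * κ.symm x)
    (mdifferentiable_mul_right (κ.symm x) (κ.symm (chartOne G))) h1
  have h6 : tder 𝓘(ℝ, EG) 𝓘(ℝ, EG) κ.symm (chartOne G) = ContinuousLinearMap.id ℝ EG :=
    tder_extChartAt_symm_self 1
  have h7 := tder_comp (I' := 𝓘(ℝ, EG)) (g := κ) (f := fun y => κ.symm y * κ.symm x)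
    (x := (chartOne G : EG)) (by
      rw [h4]
      exact (contMDiffAt_extChartAt_of_mem (κ.map_target hx)).mdifferentiableAt (by simp)) h3
  rw [h4, h5, h6, h2, ContinuousLinearMap.comp_id, tder_eq_fderiv] at h7
  exact h7

variable (G) in
theorem leftFrame_one : leftFrame G (chartOne G : EG) = ContinuousLinearMap.id ℝ EG := by
  rw [leftFrame_eq (chartOne_mem G), chartOne_symm, tder_extChartAt_self]
  simp

variable (G) in
theorem rightFrame_one : rightFrame G (chartOne G : EG) = ContinuousLinearMap.id ℝ EG := by
  rw [rightFrame_eq (chartOne_mem G), chartOne_symm, tder_extChartAt_self]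
  simp

/-- Left translation by `x` is right translation by `x` after conjugation by `x`. -/
theorem leftFrame_eq_rightFrame_comp_Ad {x : EG}
    (hx : x ∈ (extChartAt 𝓘(ℝ, EG) (1 : G)).target) :
    leftFrame G x =
      (rightFrame G x).comp (Ad ((extChartAt 𝓘(ℝ, EG) (1 : G)).symm x)) := by
  rw [leftFrame_eq hx, rightFrame_eq hx, ContinuousLinearMap.comp_assoc]
  congr 1
  set g := (extChartAt 𝓘(ℝ, EG) (1 : G)).symm x
  have h := tder_comp (I := 𝓘(ℝ, EG)) (g := fun z : G => z * g) (f := fun y : G => g * y * g⁻¹)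
    (x := 1) (mdifferentiable_mul_right g _) (mdifferentiable_conj g 1)
  simp only [inv_mul_cancel_right, mul_one, mul_inv_cancel] at h
  exact h

theorem chartForm_mcForm_comp_leftFrame {x : EG}
    (hx : x ∈ (extChartAt 𝓘(ℝ, EG) (1 : G)).target) :
    (chartForm 𝓘(ℝ, EG) (mcForm G) (1 : G) x).comp (leftFrame G x) =
      ContinuousLinearMap.id ℝ EG := by
  have h := tder_extChartAt_symm_comp hx
  rw [leftFrame_eq hx, chartForm, ContinuousLinearMap.comp_assoc,
    ← ContinuousLinearMap.comp_assoc (tder _ _ _ x), h, ContinuousLinearMap.id_comp]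
  set g := (extChartAt 𝓘(ℝ, EG) (1 : G)).symm x
  have h := tder_comp (I := 𝓘(ℝ, EG)) (g := fun z : G => g⁻¹ * z) (f := fun y : G => g * y)
    (x := 1) (mdifferentiable_mul_left g⁻¹ _) (mdifferentiable_mul_left g 1)
  simp only [inv_mul_cancel_left, mul_one, tder_id] at h
  exact h.symm

variable (G) in
/-- The symmetry of the second derivative of the product exchanges the derivatives of the left and
the right invariant fields. -/
theorem fderiv_leftFrame_swap (v w : EG) :
    fderiv ℝ (leftFrame G) (chartOne G) v w = fderiv ℝ (rightFrame G) (chartOne G) w v := by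
  set o : EG := chartOne G
  set m : EG × EG → EG := uncurry (chartMul G)
  have hm : ContDiffAt ℝ ∞ m (o, o) := contDiffAt_chartMul G
  have hm' : ∀ᶠ p in 𝓝 (o, o), DifferentiableAt ℝ m p := by
    filter_upwards [(hm.of_le (m := 1) (by simp)).eventually (by simp)] with p hp
    exact hp.differentiableAt (by simp)
  have hd : HasFDerivAt (fderiv ℝ m) (fderiv ℝ (fderiv ℝ m) (o, o)) (o, o) :=
    ((hm.fderiv_right (m := ∞) (by simp)).differentiableAt (by simp)).hasFDerivAt
  have hl : leftFrame G =ᶠ[𝓝 o] fun x => (fderiv ℝ m (x, o)).comp (.inr ℝ EG EG) := by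
    have : Filter.Tendsto (fun x : EG => (x, o)) (𝓝 o) (𝓝 (o, o)) :=
      (Continuous.prodMk_left o).tendsto o
    filter_upwards [this.eventually hm'] with x hx
    exact (hx.hasFDerivAt.comp o (hasFDerivAt_prodMk_right x o)).fderiv
  have hr : rightFrame G =ᶠ[𝓝 o] fun x => (fderiv ℝ m (o, x)).comp (.inl ℝ EG EG) := by
    have : Filter.Tendsto (fun x : EG => (o, x)) (𝓝 o) (𝓝 (o, o)) :=
      (Continuous.prodMk_right o).tendsto o
    filter_upwards [this.eventually hm'] with x hx
    exact (hx.hasFDerivAt.comp (f := fun y => (y, x)) o (hasFDerivAt_prodMk_left o x)).fderiv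
  have hl' : HasFDerivAt (fun x => fderiv ℝ m (x, o)) _ o :=
    hd.comp (f := fun x => (x, o)) o (hasFDerivAt_prodMk_left o o)
  have hr' : HasFDerivAt (fun x => fderiv ℝ m (o, x)) _ o :=
    hd.comp (f := fun x => (o, x)) o (hasFDerivAt_prodMk_right o o)
  rw [hl.fderiv_eq, hr.fderiv_eq, (hl'.clm_comp (hasFDerivAt_const _ o)).fderiv,
    (hr'.clm_comp (hasFDerivAt_const _ o)).fderiv]
  have hs := hm.isSymmSndFDerivAt (by
    simp only [minSmoothness_of_isRCLikeNormedField]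
    exact WithTop.coe_le_coe.2 le_top) (v, 0) (0, w)
  simpa using hs

/-- The Lie bracket in the chart around the identity. -/
theorem lieBracket_eq_fderiv_leftFrame (v w : EG) :
    lieBracket G v w = fderiv ℝ (leftFrame G) (chartOne G) v w -
      fderiv ℝ (leftFrame G) (chartOne G) w v := by
  have hfield : ∀ v : EG, (VectorField.mpullbackWithin 𝓘(ℝ, EG) 𝓘(ℝ, EG)
      (extChartAt 𝓘(ℝ, EG) (1 : G)).symm
      (mulInvariantVectorField (v : GroupLieAlgebra 𝓘(ℝ, EG) G)) (range 𝓘(ℝ, EG)) : EG → EG)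
      =ᶠ[𝓝 (chartOne G)] fun x => leftFrame G x v := by
    intro v
    filter_upwards [(isOpen_extChartAt_target (1 : G)).mem_nhds (chartOne_mem G)] with x hx
    have hinv := ContinuousLinearMap.inverse_eq (tder_extChartAt_symm_comp hx)
      (tder_extChartAt_comp_symm hx)
    have h1 : mfderivWithin 𝓘(ℝ, EG) 𝓘(ℝ, EG) (extChartAt 𝓘(ℝ, EG) (1 : G)).symm
        (range 𝓘(ℝ, EG)) x = tder 𝓘(ℝ, EG) 𝓘(ℝ, EG) (extChartAt 𝓘(ℝ, EG) (1 : G)).symm x := by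
      rw [ModelWithCorners.range_eq_univ, mfderivWithin_univ]; rfl
    rw [VectorField.mpullbackWithin_apply, h1, leftFrame_eq hx]
    exact congrArg (fun A : EG →L[ℝ] EG => A _) hinv
  have hd := fun v : EG => ((contDiffAt_leftFrame (EG := EG) G).differentiableAt
    (by simp)).hasFDerivAt.clm_apply (hasFDerivAt_const v _)
  have hone : ∀ A : EG →L[ℝ] EG, A = ContinuousLinearMap.id ℝ EG →
      ∀ u, A.inverse u = u := by
    rintro A rfl u
    simp
  have key : lieBracket G v w = (tder 𝓘(ℝ, EG) 𝓘(ℝ, EG) (extChartAt 𝓘(ℝ, EG) (1 : G)) 1).inverse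
      (VectorField.lieBracketWithin ℝ
        (VectorField.mpullbackWithin 𝓘(ℝ, EG) 𝓘(ℝ, EG) (extChartAt 𝓘(ℝ, EG) (1 : G)).symm
          (mulInvariantVectorField (v : GroupLieAlgebra 𝓘(ℝ, EG) G)) (range 𝓘(ℝ, EG)) : EG → EG)
        (VectorField.mpullbackWithin 𝓘(ℝ, EG) 𝓘(ℝ, EG) (extChartAt 𝓘(ℝ, EG) (1 : G)).symm
          (mulInvariantVectorField (w : GroupLieAlgebra 𝓘(ℝ, EG) G)) (range 𝓘(ℝ, EG)) : EG → EG)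
        univ (chartOne G)) := by
    have hs : (extChartAt 𝓘(ℝ, EG) (1 : G)).symm ⁻¹' univ ∩ range 𝓘(ℝ, EG) = univ := by simp
    rw [← hs]
    rfl
  have hbr : ∀ V W V' W' : EG → EG, V =ᶠ[𝓝 (chartOne G)] V' → W =ᶠ[𝓝 (chartOne G)] W' →
      VectorField.lieBracketWithin ℝ V W univ (chartOne G) =
        fderiv ℝ W' (chartOne G) (V' (chartOne G)) -
          fderiv ℝ V' (chartOne G) (W' (chartOne G)) := by
    intro V W V' W' hV hW
    rw [VectorField.lieBracketWithin_univ, VectorField.lieBracket, hV.fderiv_eq, hW.fderiv_eq,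
      hV.self_of_nhds, hW.self_of_nhds]
  refine key.trans ((hone _ (tder_extChartAt_self 1) _).trans
    ((hbr _ _ _ _ (hfield v) (hfield w)).trans ?_))
  rw [(hd v).fderiv, (hd w).fderiv, leftFrame_one]
  simp

variable (G) in
/-- The Lie bracket as a continuous bilinear map. -/
def bracketL : EG →L[ℝ] EG →L[ℝ] EG :=
  let D : EG →L[ℝ] EG →L[ℝ] EG := fderiv ℝ (leftFrame G) (chartOne G)
  D - D.flip

theorem bracketL_apply (v w : EG) : bracketL G v w = lieBracket G v w := by
  rw [lieBracket_eq_fderiv_leftFrame]; simp [bracketL]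

theorem bracketL_self (v : EG) : bracketL G v v = 0 := by simp [bracketL]

theorem bracketL_swap (v w : EG) : bracketL G v w = -bracketL G w v := by simp [bracketL]

/-- The Maurer-Cartan equation `dμ = -[μ, μ]/2` at the identity. -/
theorem extD_mcForm_one (v w : EG) : extD 𝓘(ℝ, EG) (mcForm G) (1 : G) v w = -bracketL G v w := by
  set o : EG := chartOne G
  have h1 : ContDiffAt ℝ ∞ (chartForm 𝓘(ℝ, EG) (mcForm G) (1 : G)) o :=
    formSmoothAt_mcForm (1 : G) 1 (mem_extChartAt_source _)
  have hd := (h1.differentiableAt (by simp)).hasFDerivAt.clm_comp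
    ((contDiffAt_leftFrame (EG := EG) G).differentiableAt (by simp)).hasFDerivAt
  -- the Maurer-Cartan form is constant on left invariant fields; differentiate this identity
  have hc : (fun x => (chartForm 𝓘(ℝ, EG) (mcForm G) (1 : G) x).comp (leftFrame G x)) =ᶠ[𝓝 o]
      fun _ => ContinuousLinearMap.id ℝ EG := by
    filter_upwards [(isOpen_extChartAt_target (1 : G)).mem_nhds (chartOne_mem G)] with x hx
    exact chartForm_mcForm_comp_leftFrame hx
  have h0 := hc.self_of_nhds
  have h2 := (hd.congr_of_eventuallyEq hc.symm).unique (hasFDerivAt_const _ o)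
  simp only [o, leftFrame_one, ContinuousLinearMap.comp_id] at h0
  rw [leftFrame_one, h0] at h2
  have h3 : ∀ v w, fderiv ℝ (chartForm 𝓘(ℝ, EG) (mcForm G) (1 : G)) o v w =
      -fderiv ℝ (leftFrame G) o v w := by
    intro v w
    have := congrArg (fun A : EG →L[ℝ] EG →L[ℝ] EG => A v w) h2
    simp only [add_apply, ContinuousLinearMap.comp_apply, ContinuousLinearMap.compL_apply,
      ContinuousLinearMap.flip_apply, zero_apply,
      ContinuousLinearMap.id_comp, ContinuousLinearMap.comp_id] at this
    exact eq_neg_of_add_eq_zero_right this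
  change fderiv ℝ (chartForm 𝓘(ℝ, EG) (mcForm G) (1 : G)) o v w -
    fderiv ℝ (chartForm 𝓘(ℝ, EG) (mcForm G) (1 : G)) o w v = _
  rw [h3, h3]
  simp [bracketL]
  abel

/-- The derivative of the adjoint action at the identity is the bracket. -/
theorem fderiv_Ad_symm (v w : EG) :
    fderiv ℝ (fun x => (Ad ((extChartAt 𝓘(ℝ, EG) (1 : G)).symm x) : EG →L[ℝ] EG))
      (chartOne G) v w = bracketL G v w := by
  set o : EG := chartOne G
  have h1 := (contDiffAt_Ad_comp (contMDiffAt_symm_chartOne (EG := EG) G)).differentiableAt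
    (by simp)
  have hd := ((contDiffAt_rightFrame (EG := EG) G).differentiableAt
    (by simp)).hasFDerivAt.clm_comp h1.hasFDerivAt
  have hc : leftFrame G =ᶠ[𝓝 o] fun x =>
      (rightFrame G x).comp (Ad ((extChartAt 𝓘(ℝ, EG) (1 : G)).symm x)) := by
    filter_upwards [(isOpen_extChartAt_target (1 : G)).mem_nhds (chartOne_mem G)] with x hx
    exact leftFrame_eq_rightFrame_comp_Ad hx
  have h2 := hd.fderiv
  rw [← hc.fderiv_eq, rightFrame_one, chartOne_symm, Ad_one] at h2
  have h3 := congrArg (fun A : EG →L[ℝ] EG →L[ℝ] EG => A v w) h2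
  have h4 := fderiv_leftFrame_swap G w v
  simp only [add_apply, ContinuousLinearMap.comp_apply, ContinuousLinearMap.compL_apply,
    ContinuousLinearMap.flip_apply,
    ContinuousLinearMap.id_comp, ContinuousLinearMap.comp_id] at h3
  simp only [bracketL, sub_apply, ContinuousLinearMap.flip_apply]
  rw [h4, h3]
  abel

/-- The derivative of `Ad ∘ f` at a point where `f = 1`. -/
theorem tder_Ad_comp_of_eq_one {f : M → G} {x : M} (hf : MDifferentiableAt I 𝓘(ℝ, EG) f x)
    (hx : f x = 1) (v : E) (c : EG) :
    tder I 𝓘(ℝ, EG →L[ℝ] EG) (fun y => (Ad (f y) : EG →L[ℝ] EG)) x v c =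
      bracketL G (tder I 𝓘(ℝ, EG) f x v) c := by
  have h1 := contMDiffAt_symm_chartOne (EG := EG) G
  have h2 := (contMDiff_Ad (EG := EG) (G := G) 1).mdifferentiableAt (by simp)
  have h3 := tder_comp (I := 𝓘(ℝ, EG)) (g := (Ad : G → EG →L[ℝ] EG))
    (f := (extChartAt 𝓘(ℝ, EG) (1 : G)).symm) (x := (chartOne G : EG))
    (by rwa [chartOne_symm]) (h1.mdifferentiableAt (by simp))
  have h4 : tder 𝓘(ℝ, EG) 𝓘(ℝ, EG) (extChartAt 𝓘(ℝ, EG) (1 : G)).symm (chartOne G) =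
    ContinuousLinearMap.id ℝ EG := tder_extChartAt_symm_self 1
  rw [chartOne_symm, h4, ContinuousLinearMap.comp_id, tder_eq_fderiv] at h3
  rw [tder_comp (g := (Ad : G → EG →L[ℝ] EG)) (by rwa [hx]) hf, hx, ← h3,
    ContinuousLinearMap.comp_apply, fderiv_Ad_symm]

/-- The Maurer-Cartan equation for a pull-back. -/
theorem extD_pullMC [IsManifold I ∞ M] [I.Boundaryless] {f : M → G} {x : M}
    (hf : ContMDiffAt I 𝓘(ℝ, EG) ∞ f x) (v w : E) :
    extD I (pullMC I f : M → E →L[ℝ] EG) x v w =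
      -bracketL G (pullMC I f x v) (pullMC I f x w) := by
  have hfd := hf.mdifferentiableAt (by simp)
  have h1 : ∀ᶠ y in 𝓝 x, (pullMC I f y : E →L[ℝ] EG) = pullMC I (fun y => (f x)⁻¹ * f y) y := by
    filter_upwards [hf.eventually_mdifferentiableAt] with y hy
    rw [pullMC_const_mul hy]
  have h2 : ContMDiffAt I 𝓘(ℝ, EG) ∞ (fun y => (f x)⁻¹ * f y) x := contMDiffAt_const.mul hf
  have h3 : (f x)⁻¹ * f x = 1 := by simp
  rw [extD_congr h1, pullMC_eq hfd]
  unfold pullMC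
  rw [extD_pull (formSmoothAt_mcForm _) h2, h3, extD_mcForm_one]

/-- The derivative of `Ad_{f⁻¹}`. -/
theorem tder_Ad_inv_comp {f : M → G} {x : M} (hf : MDifferentiableAt I 𝓘(ℝ, EG) f x)
    (v : E) (c : EG) :
    tder I 𝓘(ℝ, EG →L[ℝ] EG) (fun y => (Ad (f y)⁻¹ : EG →L[ℝ] EG)) x v c =
      -bracketL G (pullMC I f x v) (Ad (f x)⁻¹ c) := by
  have h1 : MDifferentiableAt I 𝓘(ℝ, EG) (fun y => (f y)⁻¹ * f x) x :=
    hf.lieGroup_inv.lieGroup_mul mdifferentiableAt_const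
  have h2 : (fun y => (Ad (f y)⁻¹ : EG →L[ℝ] EG)) =
      fun y => ((ContinuousLinearMap.compL ℝ EG EG EG).flip (Ad (f x)⁻¹))
        (Ad ((f y)⁻¹ * f x)) := by
    funext y
    simp [← Ad_mul]
  have h3 : MDifferentiableAt I 𝓘(ℝ, EG →L[ℝ] EG)
      (fun y => (Ad ((f y)⁻¹ * f x) : EG →L[ℝ] EG)) x :=
    ((contMDiff_Ad (EG := EG) (G := G) _).mdifferentiableAt (by simp)).comp x h1
  have h4 : (tder I 𝓘(ℝ, EG) (fun y => (f y)⁻¹ * f x) x : E →L[ℝ] EG) = -pullMC I f x := by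
    rw [← pullMC_eq_of_eq_one h1 (by simp), pullMC_mul hf.lieGroup_inv mdifferentiableAt_const,
      pullMC_inv hf, pullMC_const, ContinuousLinearMap.comp_neg, ← ContinuousLinearMap.comp_assoc,
      ← Ad_mul]
    simp
  rw [h2, tder_comp (g := (ContinuousLinearMap.compL ℝ EG EG EG).flip (Ad (f x)⁻¹))
    (ContinuousLinearMap.mdifferentiableAt _) h3, tder_eq_fderiv, ContinuousLinearMap.fderiv]
  change tder I 𝓘(ℝ, EG →L[ℝ] EG) (fun y => (Ad ((f y)⁻¹ * f x) : EG →L[ℝ] EG)) x v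
    (Ad (f x)⁻¹ c) = _
  rw [tder_Ad_comp_of_eq_one h1 (by simp), h4]
  simp

section Hom

variable {EK : Type*} [NormedAddCommGroup EK] [NormedSpace ℝ EK]
  {K : Type*} [Group K] [TopologicalSpace K] [ChartedSpace EK K] [LieGroup 𝓘(ℝ, EK) ∞ K]

theorem tder_hom_Ad (f : G →* K) (hf : MDifferentiableAt 𝓘(ℝ, EG) 𝓘(ℝ, EK) f 1) (g : G) :
    (tder 𝓘(ℝ, EG) 𝓘(ℝ, EK) f 1).comp (Ad g) = (Ad (f g)).comp (tder 𝓘(ℝ, EG) 𝓘(ℝ, EK) f 1) := by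
  have h1 := tder_comp (I' := 𝓘(ℝ, EG)) (g := f) (f := fun x : G => g * x * g⁻¹) (x := 1)
    (by simpa using hf) (mdifferentiable_conj g 1)
  rw [← tder_conj_of_eq_one hf (map_one f)]
  simp only [mul_one, mul_inv_cancel, map_mul, map_inv] at h1
  exact h1.symm

/-- The derivative of a homomorphism preserves the bracket. -/
theorem tder_hom_bracketL (f : G →* K) (hf : MDifferentiableAt 𝓘(ℝ, EG) 𝓘(ℝ, EK) f 1) (v w : EG) :
    tder 𝓘(ℝ, EG) 𝓘(ℝ, EK) f 1 (bracketL G v w) =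
      bracketL K (tder 𝓘(ℝ, EG) 𝓘(ℝ, EK) f 1 v) (tder 𝓘(ℝ, EG) 𝓘(ℝ, EK) f 1 w) := by
  set A := tder 𝓘(ℝ, EG) 𝓘(ℝ, EK) f 1 with hA
  set ψ := (extChartAt 𝓘(ℝ, EG) (1 : G)).symm with hψ
  have h1 := (contMDiffAt_symm_chartOne (EG := EG) G).mdifferentiableAt (by simp)
  have h2 : MDifferentiableAt 𝓘(ℝ, EG) 𝓘(ℝ, EK) (fun x => f (ψ x)) (chartOne G) :=
    MDifferentiableAt.comp (g := f) _ (by rwa [chartOne_symm]) h1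
  have h3 : f (ψ (chartOne G)) = 1 := by rw [chartOne_symm, map_one]
  have h4 : tder 𝓘(ℝ, EG) 𝓘(ℝ, EK) (fun x => f (ψ x)) (chartOne G) = A := by
    rw [tder_comp (g := f) (by rwa [chartOne_symm]) h1, chartOne_symm,
      show tder 𝓘(ℝ, EG) 𝓘(ℝ, EG) ψ (chartOne G) = _ from tder_extChartAt_symm_self (1 : G)]
    rfl
  have h5 := tder_Ad_comp_of_eq_one h2 h3 v (A w)
  rw [h4, tder_eq_fderiv] at h5
  have hAdf : DifferentiableAt ℝ (fun x => (Ad (f (ψ x)) : EK →L[ℝ] EK)) (chartOne G) :=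
    MDifferentiableAt.differentiableAt (MDifferentiableAt.comp (g := (Ad : K → EK →L[ℝ] EK)) _
      ((contMDiff_Ad (EG := EK) (G := K) _).mdifferentiableAt (by simp)) h2)
  have hAd : DifferentiableAt ℝ (fun x => (Ad (ψ x) : EG →L[ℝ] EG)) (chartOne G) :=
    (contDiffAt_Ad_comp (contMDiffAt_symm_chartOne (EG := EG) G)).differentiableAt (by simp)
  -- the bracket is the derivative of `Ad`, so it suffices to differentiate the equivariance of `A`
  have h6 : (fun x => Ad (f (ψ x)) (A w)) = fun x => A (Ad (ψ x) w) := by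
    funext x
    exact congrArg (fun T : EG →L[ℝ] EK => T w) (tder_hom_Ad f hf (ψ x)).symm
  have h7 := (hAdf.hasFDerivAt.clm_apply (hasFDerivAt_const (A w) _)).fderiv
  have h8 := (A.hasFDerivAt.comp (chartOne G)
    (hAd.hasFDerivAt.clm_apply (hasFDerivAt_const w _))).fderiv
  have h9 := h7.symm.trans ((congrArg (fun F => fderiv ℝ F (chartOne G)) h6).trans h8)
  have h10 := congrArg (fun T : EG →L[ℝ] EK => T v) h9
  have h11 := fderiv_Ad_symm (G := G) v w
  simp only [ContinuousLinearMap.comp_zero, zero_add, ContinuousLinearMap.flip_apply,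
    ContinuousLinearMap.comp_apply] at h10
  rw [← h11, ← h5]
  exact h10.symm

end Hom

/-- The adjoint action preserves the bracket. -/
theorem Ad_bracketL (g : G) (v w : EG) :
    Ad g (bracketL G v w) = bracketL G (Ad g v) (Ad g w) :=
  tder_hom_bracketL (MulAut.conj g).toMonoidHom (mdifferentiable_conj g 1) v w

/-- Vectors fixed by the adjoint action are central in the Lie algebra. -/
theorem bracketL_eq_zero_of_Ad {c : EG} (hc : ∀ g : G, Ad g c = c) (v : EG) :
    bracketL G v c = 0 := by
  have hAd : DifferentiableAt ℝ
      (fun x => (Ad ((extChartAt 𝓘(ℝ, EG) (1 : G)).symm x) : EG →L[ℝ] EG)) (chartOne G) :=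
    (contDiffAt_Ad_comp (contMDiffAt_symm_chartOne (EG := EG) G)).differentiableAt (by simp)
  have h1 := (hAd.hasFDerivAt.clm_apply (hasFDerivAt_const c _)).fderiv
  simp only [hc, fderiv_fun_const] at h1
  have h2 := congrArg (fun T : EG →L[ℝ] EG => T v) h1
  rw [← fderiv_Ad_symm]
  simpa using h2.symm

/-! ### Gauge transformations -/

/-- The gauge transform `θ · g = Ad_{g⁻¹} θ + g^* μ` of a Lie algebra valued one-form. -/
def gauge (I : ModelWithCorners ℝ E H) (θ : M → E →L[ℝ] EG) (g : M → G) (x : M) : E →L[ℝ] EG :=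
  (Ad (g x)⁻¹).comp (θ x) + pullMC I g x

/-- Gauge transformation is a right action. -/
theorem gauge_mul {θ : M → E →L[ℝ] EG} {g h : M → G} {x : M}
    (hg : MDifferentiableAt I 𝓘(ℝ, EG) g x) (hh : MDifferentiableAt I 𝓘(ℝ, EG) h x) :
    gauge I θ (fun y => g y * h y) x = (Ad (h x)⁻¹).comp (gauge I θ g x) + pullMC I h x := by
  simp only [gauge, pullMC_mul hg hh, mul_inv_rev, Ad_mul, ContinuousLinearMap.comp_add,
    ContinuousLinearMap.comp_assoc, add_assoc]

theorem contMDiffAt_Ad_inv {g : M → G} {x : M} (hg : ContMDiffAt I 𝓘(ℝ, EG) ∞ g x) :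
    ContMDiffAt I 𝓘(ℝ, EG →L[ℝ] EG) ∞ (fun y => (Ad (g y)⁻¹ : EG →L[ℝ] EG)) x :=
  (contMDiff_Ad (EG := EG) (G := G) _).comp x hg.inv

theorem formSmoothAt_gauge [IsManifold I ∞ M] [I.Boundaryless] {θ : M → E →L[ℝ] EG} {g : M → G}
    {x : M} (hθ : FormSmoothAt I θ x) (hg : ContMDiffAt I 𝓘(ℝ, EG) ∞ g x) :
    FormSmoothAt I (gauge I θ g) x :=
  (hθ.clm_comp (contMDiffAt_Ad_inv hg)).add (formSmoothAt_pullMC hg)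

variable (G) in
/-- The curvature `dθ + [θ, θ]/2`. -/
def curv (I : ModelWithCorners ℝ E H) (θ : M → E →L[ℝ] EG) (x : M) (v w : E) : EG :=
  extD I θ x v w + bracketL G (θ x v) (θ x w)

/-- The curvature of a gauge transform. -/
theorem curv_gauge [IsManifold I ∞ M] [I.Boundaryless] {θ : M → E →L[ℝ] EG} {g : M → G}
    {x : M} (hθ : FormSmoothAt I θ x) (hg : ContMDiffAt I 𝓘(ℝ, EG) ∞ g x) (v w : E) :
    curv G I (gauge I θ g) x v w = Ad (g x)⁻¹ (curv G I θ x v w) := by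
  have hgd := hg.mdifferentiableAt (by simp)
  have hAd := contMDiffAt_Ad_inv hg
  have h1 : extD I (gauge I θ g) x v w = extD I (fun y => (Ad (g y)⁻¹).comp (θ y)) x v w +
      extD I (pullMC I g : M → E →L[ℝ] EG) x v w :=
    extD_add (hθ.clm_comp hAd) (formSmoothAt_pullMC hg) v w
  rw [curv, h1, extD_clm_comp hθ hAd, extD_pullMC hg, tder_Ad_inv_comp hgd, tder_Ad_inv_comp hgd]
  simp only [gauge, add_apply, ContinuousLinearMap.comp_apply, map_add, curv, Ad_bracketL]
  rw [bracketL_swap (pullMC I g x w) (Ad (g x)⁻¹ (θ x v))]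
  abel

end LieGroupCalculus

/-! ### Circle-valued functions -/

section CircleValued

variable {E : Type*} [NormedAddCommGroup E] [NormedSpace ℝ E]
  {H : Type*} [TopologicalSpace H] {I : ModelWithCorners ℝ E H}
  {M : Type*} [TopologicalSpace M] [ChartedSpace H M]

theorem contMDiff_circle_coe : ContMDiff (𝓡 1) 𝓘(ℝ, ℂ) ∞ (fun z : Circle => (z : ℂ)) :=
  have : Fact (Module.finrank ℝ ℂ = 1 + 1) := ⟨Complex.finrank_real_complex⟩
  contMDiff_coe_sphere

/-- A circle-valued function smooth at `x` is `z(x) exp(i a)` for a real function `a` smooth at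
`x`. -/
theorem exists_real_log {z : M → Circle} {x : M} (hz : ContMDiffAt I (𝓡 1) ∞ z x) :
    ∃ a : M → ℝ, ContMDiffAt I 𝓘(ℝ, ℝ) ∞ a x ∧ a x = 0 ∧ ∀ y, z y = z x * Circle.exp (a y) := by
  refine ⟨fun y => Complex.arg (((z x)⁻¹ * z y : Circle) : ℂ), ?_, by simp, fun y => ?_⟩
  · have h1 : ContMDiffAt I (𝓡 1) ∞ (fun y => (z x)⁻¹ * z y) x := contMDiffAt_const.mul hz
    have h2 : ContMDiffAt I 𝓘(ℝ, ℂ) ∞ (fun y => (((z x)⁻¹ * z y : Circle) : ℂ)) x :=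
      (contMDiff_circle_coe _).comp x h1
    have h3 : ContDiffAt ℝ ∞ (fun w : ℂ => Complex.imCLM (Complex.log w)) 1 :=
      Complex.imCLM.contDiff.contDiffAt.comp (1 : ℂ)
        ((Complex.contDiffAt_log Complex.one_mem_slitPlane).restrict_scalars ℝ)
    have h4 := ContMDiffAt.comp (g := fun w : ℂ => Complex.imCLM (Complex.log w)) x
      (by simpa using h3.contMDiffAt) h2
    simpa [comp_def, Complex.log_im] using h4
  · rw [Circle.exp_arg]; simp

/-- The logarithmic derivative, with values in maps of model spaces. -/
def dlogForm (I : ModelWithCorners ℝ E H) (z : M → Circle) (x : M) : E →L[ℝ] ℝ := dlog (I := I) z x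

theorem dlogForm_eq_tder {z : M → Circle} {x : M} {a : M → ℝ} (ha : ContMDiffAt I 𝓘(ℝ, ℝ) ∞ a x)
    (ha0 : a x = 0) (hz : ∀ y, z y = z x * Circle.exp (a y)) :
    dlogForm I z x = tder I 𝓘(ℝ, ℝ) a x := by
  have h1 : (fun y => (z y : ℂ)) = fun y => (z x : ℂ) * Complex.exp (a y * Complex.I) := by
    funext y
    rw [hz y]
    simp
  have hd : HasFDerivAt (fun r : ℝ => (z x : ℂ) * Complex.exp (r * Complex.I))
      (ContinuousLinearMap.toSpanSingleton ℝ ((z x : ℂ) * Complex.I)) (a x) := by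
    have h : HasDerivAt (fun r : ℝ => Complex.exp (r * Complex.I)) Complex.I (a x) := by
      have := ((Complex.ofRealCLM.hasDerivAt (x := a x)).mul_const Complex.I).cexp
      simpa [ha0] using this
    simpa using (h.const_mul (z x : ℂ)).hasFDerivAt
  have h2 : tder I 𝓘(ℝ, ℂ) (fun y => (z y : ℂ)) x =
      (ContinuousLinearMap.toSpanSingleton ℝ ((z x : ℂ) * Complex.I)).comp
        (tder I 𝓘(ℝ, ℝ) a x) := by
    rw [h1, tder_comp (I' := 𝓘(ℝ, ℝ))
      (g := fun r : ℝ => (z x : ℂ) * Complex.exp (r * Complex.I))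
      hd.differentiableAt.mdifferentiableAt (ha.mdifferentiableAt (by simp)), tder_eq_fderiv,
      hd.fderiv]
  have h3 : dlogForm I z x = Complex.imCLM.comp ((ContinuousLinearMap.mul ℝ ℂ
    (starRingEnd ℂ (z x : ℂ))).comp (tder I 𝓘(ℝ, ℂ) (fun y => (z y : ℂ)) x)) := rfl
  rw [h3, h2]
  ext v
  have h4 : (starRingEnd ℂ) (z x : ℂ) * (z x : ℂ) = 1 := by
    rw [← Complex.normSq_eq_conj_mul_self]; simp
  set r : ℝ := tder I 𝓘(ℝ, ℝ) a x v
  change ((starRingEnd ℂ) (z x : ℂ) * (r • ((z x : ℂ) * Complex.I))).im = r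
  rw [mul_smul_comm, ← mul_assoc, h4]
  simp

end CircleValued

/-! ### Homomorphisms of Lie groups and central extensions -/

section HomCompat

variable {EG : Type*} [NormedAddCommGroup EG] [NormedSpace ℝ EG]
  {G : Type*} [Group G] [TopologicalSpace G] [ChartedSpace EG G] [LieGroup 𝓘(ℝ, EG) ∞ G]
  {EK : Type*} [NormedAddCommGroup EK] [NormedSpace ℝ EK]
  {K : Type*} [Group K] [TopologicalSpace K] [ChartedSpace EK K] [LieGroup 𝓘(ℝ, EK) ∞ K]
  {E : Type*} [NormedAddCommGroup E] [NormedSpace ℝ E]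
  {H : Type*} [TopologicalSpace H] {I : ModelWithCorners ℝ E H}
  {M : Type*} [TopologicalSpace M] [ChartedSpace H M]

theorem pullMC_hom (f : G →* K) (hf : MDifferentiable 𝓘(ℝ, EG) 𝓘(ℝ, EK) f) {g : M → G} {x : M}
    (hg : MDifferentiableAt I 𝓘(ℝ, EG) g x) :
    (pullMC I (fun y => f (g y)) x : E →L[ℝ] EK) =
      (tder 𝓘(ℝ, EG) 𝓘(ℝ, EK) f 1).comp (pullMC I g x) := by
  have hg' := (mdifferentiableAt_const (c := (g x)⁻¹)).lieGroup_mul hg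
  have hfg : MDifferentiableAt I 𝓘(ℝ, EK) (fun y => f (g y)) x := (hf (g x)).comp x hg
  rw [pullMC_eq hg, pullMC_eq hfg]
  have h := tder_comp (g := f) (f := fun y => (g x)⁻¹ * g y) (hf ((g x)⁻¹ * g x)) hg'
  simp only [inv_mul_cancel, map_mul, map_inv] at h
  exact h

theorem tder_hom_comp_gauge (f : G →* K) (hf : MDifferentiable 𝓘(ℝ, EG) 𝓘(ℝ, EK) f)
    {θ : M → E →L[ℝ] EG} {g : M → G} {x : M} (hg : MDifferentiableAt I 𝓘(ℝ, EG) g x) :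
    (tder 𝓘(ℝ, EG) 𝓘(ℝ, EK) f 1).comp (gauge I θ g x) =
      gauge I (fun y => (tder 𝓘(ℝ, EG) 𝓘(ℝ, EK) f 1).comp (θ y)) (fun y => f (g y)) x := by
  simp only [gauge, ContinuousLinearMap.comp_add, pullMC_hom f hf hg, ← map_inv,
    ← ContinuousLinearMap.comp_assoc, tder_hom_Ad f (hf 1)]

end HomCompat

namespace CentralExtension

variable {Fh : Type*} [NormedAddCommGroup Fh] [NormedSpace ℝ Fh]
  {Γh : Type*} [Group Γh] [TopologicalSpace Γh] [ChartedSpace Fh Γh] [LieGroup 𝓘(ℝ, Fh) ∞ Γh]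
  {F : Type*} [NormedAddCommGroup F] [NormedSpace ℝ F]
  {Γ : Type*} [Group Γ] [TopologicalSpace Γ] [ChartedSpace F Γ] [LieGroup 𝓘(ℝ, F) ∞ Γ]
  (𝔼 : CentralExtension Fh Γh F Γ)
  {E : Type*} [NormedAddCommGroup E] [NormedSpace ℝ E]
  {H : Type*} [TopologicalSpace H] {I : ModelWithCorners ℝ E H}
  {M : Type*} [TopologicalSpace M] [ChartedSpace H M]

theorem mdifferentiable_q : MDifferentiable 𝓘(ℝ, Fh) 𝓘(ℝ, F) 𝔼.q :=
  𝔼.isPrincipal.smooth_proj.mdifferentiable (by simp)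

theorem contMDiff_incl_exp : ContMDiff 𝓘(ℝ, ℝ) 𝓘(ℝ, Fh) ∞ (fun t : ℝ => 𝔼.incl (Circle.exp t)) :=
  𝔼.contMDiff_incl.comp contMDiff_circleExp

theorem scalarPart_dincl (t : ℝ) : 𝔼.scalarPart (𝔼.dincl t) = t :=
  𝔼.exists_scalarPart.choose_spec t

theorem Ad_incl (z : Circle) : (Ad (𝔼.incl z) : Fh →L[ℝ] Fh) = ContinuousLinearMap.id ℝ Fh := by
  have h : (fun x : Γh => 𝔼.incl z * x * (𝔼.incl z)⁻¹) = fun x => x := by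
    funext x
    rw [𝔼.central, mul_inv_cancel_right]
  rw [Ad_eq_tder, h, tder_id]

theorem Ad_dincl (g : Γh) (t : ℝ) : Ad g (𝔼.dincl t) = 𝔼.dincl t := by
  have h1 := (𝔼.contMDiff_incl_exp 0).mdifferentiableAt (by simp)
  have h2 := tder_conj_of_eq_one h1 (by simp) g
  have h3 : (fun t : ℝ => g * 𝔼.incl (Circle.exp t) * g⁻¹) = fun t => 𝔼.incl (Circle.exp t) := by
    funext t
    rw [← 𝔼.central, mul_inv_cancel_right]
  rw [h3] at h2
  exact (congrArg (fun T : ℝ →L[ℝ] Fh => T t) h2).symm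

theorem bracketL_dincl (v : Fh) (t : ℝ) : bracketL Γh v (𝔼.dincl t) = 0 :=
  bracketL_eq_zero_of_Ad (fun g => 𝔼.Ad_dincl g t) v

/-- A smooth function `t` near the kernel of `q` that restricts on the kernel to the identification
with the circle, up to a constant. -/
theorem exists_circleCoordinate : ∃ (U : Set Γ) (s : Γ → Γh) (t : Γh → Circle), IsOpen U ∧
    (1 : Γ) ∈ U ∧ ContMDiffOn 𝓘(ℝ, F) 𝓘(ℝ, Fh) ∞ s U ∧
    ContMDiffOn 𝓘(ℝ, Fh) (𝓡 1) ∞ t (𝔼.q ⁻¹' U) ∧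
    (∀ g, 𝔼.q g ∈ U → s (𝔼.q g) * 𝔼.incl (t g) = g) ∧ ∀ z, t (𝔼.incl z) = t 1 * z := by
  obtain ⟨U, s, t, hU, h1U, hs, ht, -, h2, h3⟩ := 𝔼.isPrincipal.locally_trivial 1
  refine ⟨U, s, t, hU, h1U, hs, ht, h2, fun z => ?_⟩
  have h4 : s 1 * 𝔼.incl (t 1) = 1 := by simpa using h2 1 (by simpa using h1U)
  have h5 : 𝔼.incl z = s 1 * 𝔼.incl (t 1 * z) := by rw [map_mul, ← mul_assoc, h4, one_mul]
  rw [h5]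
  exact h3 1 h1U _

theorem incl_injective : Injective 𝔼.incl := by
  obtain ⟨-, -, t, -, -, -, -, -, ht⟩ := 𝔼.exists_circleCoordinate
  intro z z' h
  have := congrArg t h
  rw [ht, ht] at this
  exact mul_left_cancel this

theorem circlePart_incl (z : Circle) : 𝔼.circlePart (𝔼.incl z) = z :=
  leftInverse_invFun 𝔼.incl_injective z

theorem exists_incl_of_q_eq {g h : Γh} (hgh : 𝔼.q g = 𝔼.q h) : ∃ z, h = g * 𝔼.incl z := by
  obtain ⟨U, s, t, hU, h1U, -, -, -, h2, -⟩ := 𝔼.isPrincipal.locally_trivial (𝔼.q g)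
  refine ⟨(t g)⁻¹ * t h, ?_⟩
  have e1 := h2 g h1U
  have e2 := h2 h (hgh ▸ h1U)
  rw [← hgh] at e2
  calc h = s (𝔼.q g) * 𝔼.incl (t g) * ((𝔼.incl (t g))⁻¹ * 𝔼.incl (t h)) := by
        rw [mul_assoc, mul_inv_cancel_left, e2]
    _ = g * 𝔼.incl ((t g)⁻¹ * t h) := by rw [e1, map_mul, map_inv]

theorem incl_circlePart {h : Γh} (hh : 𝔼.q h = 1) : 𝔼.incl (𝔼.circlePart h) = h := by
  obtain ⟨z, rfl⟩ := 𝔼.exists_incl_of_q_eq (g := 1) (h := h) (by simpa using hh.symm)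
  rw [one_mul, circlePart_incl]

theorem Ad_eq_of_q_eq {g h : Γh} (hgh : 𝔼.q g = 𝔼.q h) : (Ad g : Fh →L[ℝ] Fh) = Ad h := by
  obtain ⟨z, rfl⟩ := 𝔼.exists_incl_of_q_eq hgh
  rw [Ad_mul, Ad_incl, ContinuousLinearMap.comp_id]

theorem adLift_q (g : Γh) : 𝔼.adLift (𝔼.q g) = Ad g :=
  𝔼.Ad_eq_of_q_eq (surjInv_eq 𝔼.q_surjective (𝔼.q g))

/-- The kernel of `Lie Γh → Lie Γ` is the image of `iℝ`. -/
theorem dincl_scalarPart {v : Fh} (hv : 𝔼.dq v = 0) : 𝔼.dincl (𝔼.scalarPart v) = v := by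
  suffices h : ∃ r, v = 𝔼.dincl r by
    obtain ⟨r, rfl⟩ := h
    rw [scalarPart_dincl]
  obtain ⟨U, s, t, hU, h1U, hs, ht, h2, -⟩ := 𝔼.exists_circleCoordinate
  have hopen : IsOpen (𝔼.q ⁻¹' U) := hU.preimage 𝔼.isPrincipal.smooth_proj.continuous
  have hmem : (1 : Γh) ∈ 𝔼.q ⁻¹' U := by simpa using h1U
  -- near `1`, the identity of `Γh` is the product of a function of `q g` and a map to the circle;
  -- differentiating, a vector killed by `dq` comes from the second factor
  obtain ⟨a, ha, ha0, hta⟩ := exists_real_log (ht.contMDiffAt (hopen.mem_nhds hmem))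
  have had := ha.mdifferentiableAt (by simp)
  have hsd : MDifferentiableAt 𝓘(ℝ, F) 𝓘(ℝ, Fh) (fun γ => s γ * 𝔼.incl (t 1)) (𝔼.q 1) := by
    rw [map_one]
    exact ((hs.contMDiffAt (hU.mem_nhds h1U)).mdifferentiableAt (by simp)).lieGroup_mul
      mdifferentiableAt_const
  have hsq : MDifferentiableAt 𝓘(ℝ, Fh) 𝓘(ℝ, Fh) (fun g => s (𝔼.q g) * 𝔼.incl (t 1)) 1 :=
    hsd.comp 1 (𝔼.mdifferentiable_q 1)
  have hexp : MDifferentiableAt 𝓘(ℝ, ℝ) 𝓘(ℝ, Fh) (fun r : ℝ => 𝔼.incl (Circle.exp r)) (a 1) :=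
    (𝔼.contMDiff_incl_exp _).mdifferentiableAt (by simp)
  have hea : MDifferentiableAt 𝓘(ℝ, Fh) 𝓘(ℝ, Fh) (fun g => 𝔼.incl (Circle.exp (a g))) 1 :=
    hexp.comp 1 had
  have h3 : (fun g : Γh => g) =ᶠ[𝓝 1]
      fun g => (s (𝔼.q g) * 𝔼.incl (t 1)) * 𝔼.incl (Circle.exp (a g)) := by
    filter_upwards [hopen.mem_nhds hmem] with g hg
    rw [mul_assoc, ← map_mul, ← hta, h2 g hg]
  have h4 := tder_congr (I := 𝓘(ℝ, Fh)) (I' := 𝓘(ℝ, Fh)) h3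
  have e1 : s (𝔼.q 1) * 𝔼.incl (t 1) = 1 := h2 1 hmem
  rw [tder_id, tder_mul_of_eq_one hsq hea e1 (by simp [ha0]),
    tder_comp (g := fun γ => s γ * 𝔼.incl (t 1)) hsd (𝔼.mdifferentiable_q 1),
    tder_comp (g := fun r : ℝ => 𝔼.incl (Circle.exp r)) hexp had, ha0] at h4
  have h5 := congrArg (fun T : Fh →L[ℝ] Fh => T v) h4
  refine ⟨tder 𝓘(ℝ, Fh) 𝓘(ℝ, ℝ) a 1 v, ?_⟩
  have h6 : tder 𝓘(ℝ, Fh) 𝓘(ℝ, F) 𝔼.q 1 v = 0 := hv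
  simp only [add_apply, ContinuousLinearMap.comp_apply, h6, map_zero, zero_add] at h5
  exact h5

/-- The pull-back of the Maurer-Cartan form under a map to the central circle. -/
theorem pullMC_incl {z : M → Circle} {x : M} (hz : ContMDiffAt I (𝓡 1) ∞ z x) :
    (pullMC I (fun y => 𝔼.incl (z y)) x : E →L[ℝ] Fh) =
      𝔼.dincl.comp (dlogForm I z x) := by
  obtain ⟨a, ha, ha0, hza⟩ := exists_real_log hz
  have had := ha.mdifferentiableAt (by simp)
  have hexp : MDifferentiableAt 𝓘(ℝ, ℝ) 𝓘(ℝ, Fh) (fun r : ℝ => 𝔼.incl (Circle.exp r)) (a x) :=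
    (𝔼.contMDiff_incl_exp _).mdifferentiableAt (by simp)
  have h1 : (fun y => 𝔼.incl (z y)) =
      fun y => 𝔼.incl (z x) * 𝔼.incl (Circle.exp (a y)) := by
    funext y
    rw [hza y, map_mul]
  have hea : MDifferentiableAt I 𝓘(ℝ, Fh) (fun y => 𝔼.incl (Circle.exp (a y))) x :=
    hexp.comp x had
  rw [dlogForm_eq_tder ha ha0 hza, h1, pullMC_const_mul hea,
    pullMC_eq_of_eq_one hea (by simp [ha0]),
    tder_comp (g := fun r : ℝ => 𝔼.incl (Circle.exp r)) hexp had, ha0]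
  rfl

theorem contMDiffOn_circlePart {f : M → Γh} {U : Set M} (hf : ContMDiffOn I 𝓘(ℝ, Fh) ∞ f U)
    (hU : ∀ x ∈ U, 𝔼.q (f x) = 1) : ContMDiffOn I (𝓡 1) ∞ (fun x => 𝔼.circlePart (f x)) U := by
  obtain ⟨W, s, t, hW, h1W, -, ht, -, h3⟩ := 𝔼.exists_circleCoordinate
  have h4 : ContMDiffOn I (𝓡 1) ∞ (fun x => (t 1)⁻¹ * t (f x)) U :=
    contMDiffOn_const.mul (ht.comp hf fun x hx => by
      rw [mem_preimage, mem_preimage, hU x hx]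
      exact h1W)
  refine h4.congr fun x hx => ?_
  nth_rw 2 [← 𝔼.incl_circlePart (hU x hx)]
  rw [h3, inv_mul_cancel_left]

/-- Smooth maps to `Γ` lift locally to `Γh`. -/
theorem exists_local_lift {f : M → Γ} {U : Set M} (hU : IsOpen U)
    (hf : ContMDiffOn I 𝓘(ℝ, F) ∞ f U) {x : M} (hx : x ∈ U) :
    ∃ (V : Set M) (r : M → Γh), IsOpen V ∧ x ∈ V ∧ V ⊆ U ∧ ContMDiffOn I 𝓘(ℝ, Fh) ∞ r V ∧
      ∀ y ∈ V, 𝔼.q (r y) = f y := by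
  obtain ⟨W, s, t, hW, hxW, hs, -, h1, -⟩ := 𝔼.isPrincipal.locally_trivial (f x)
  refine ⟨U ∩ f ⁻¹' W, fun y => s (f y), hf.continuousOn.isOpen_inter_preimage hU hW, ⟨hx, hxW⟩,
    inter_subset_left, hs.comp (hf.mono inter_subset_left) fun y hy => hy.2, fun y hy => h1 _ hy.2⟩

theorem dq_comp_gauge {θ : M → E →L[ℝ] Fh} {g : M → Γh} {x : M}
    (hg : MDifferentiableAt I 𝓘(ℝ, Fh) g x) :
    𝔼.dq.comp (gauge I θ g x) = gauge I (fun y => 𝔼.dq.comp (θ y)) (fun y => 𝔼.q (g y)) x :=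
  tder_hom_comp_gauge 𝔼.q 𝔼.mdifferentiable_q hg

theorem dq_bracketL (v w : Fh) : 𝔼.dq (bracketL Γh v w) = bracketL Γ (𝔼.dq v) (𝔼.dq w) :=
  tder_hom_bracketL 𝔼.q (𝔼.mdifferentiable_q 1) v w

end CentralExtension

/-! ### Principal bundles: transition functions and connections -/

section Bundles

variable {F : Type*} [NormedAddCommGroup F] [NormedSpace ℝ F]
  {Γ : Type*} [Group Γ] [TopologicalSpace Γ] [ChartedSpace F Γ] [LieGroup 𝓘(ℝ, F) ∞ Γ]
  {EB : Type*} [NormedAddCommGroup EB] [NormedSpace ℝ EB]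
  {B : Type*} [TopologicalSpace B] [ChartedSpace EB B]
  {EX : Type*} [NormedAddCommGroup EX] [NormedSpace ℝ EX]
  {X : Type*} [TopologicalSpace X] [ChartedSpace EX X]
  {proj : B → X} {act : B → Γ → B}
  {E : Type*} [NormedAddCommGroup E] [NormedSpace ℝ E]
  {H : Type*} [TopologicalSpace H] {I : ModelWithCorners ℝ E H}
  {M : Type*} [TopologicalSpace M] [ChartedSpace H M]

theorem IsPrincipalBundle.act_injective
    (hB : IsPrincipalBundle 𝓘(ℝ, F) 𝓘(ℝ, EB) 𝓘(ℝ, EX) proj act) {b : B} {γ γ' : Γ}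
    (h : act b γ = act b γ') : γ = γ' := by
  obtain ⟨U, s, t, -, hx, -, -, -, h1, h2⟩ := hB.locally_trivial (proj b)
  rw [← h1 b hx, ← hB.act_mul, ← hB.act_mul] at h
  have := congrArg t h
  rw [h2 _ hx, h2 _ hx] at this
  exact mul_left_cancel this

/-- Two sections of a principal bundle differ locally by a smooth function to the group. -/
theorem IsPrincipalBundle.exists_local_transition
    (hB : IsPrincipalBundle 𝓘(ℝ, F) 𝓘(ℝ, EB) 𝓘(ℝ, EX) proj act) {U : Set X} (hU : IsOpen U)
    {s s' : X → B} (hs : ContMDiffOn 𝓘(ℝ, EX) 𝓘(ℝ, EB) ∞ s U)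
    (hs' : ContMDiffOn 𝓘(ℝ, EX) 𝓘(ℝ, EB) ∞ s' U) (hps : ∀ x ∈ U, proj (s x) = x)
    (hps' : ∀ x ∈ U, proj (s' x) = x) {x : X} (hx : x ∈ U) :
    ∃ (V : Set X) (γ : X → Γ), IsOpen V ∧ x ∈ V ∧ V ⊆ U ∧ ContMDiffOn 𝓘(ℝ, EX) 𝓘(ℝ, F) ∞ γ V ∧
      ∀ y ∈ V, act (s y) (γ y) = s' y := by
  obtain ⟨W, σ, t, hW, hxW, hσ, ht, -, h1, -⟩ := hB.locally_trivial x
  refine ⟨U ∩ W, fun y => (t (s y))⁻¹ * t (s' y), hU.inter hW, ⟨hx, hxW⟩, inter_subset_left,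
    (ht.comp (hs.mono inter_subset_left) ?_).inv.mul (ht.comp (hs'.mono inter_subset_left) ?_),
    ?_⟩
  · intro y hy
    change proj (s y) ∈ W
    rw [hps y hy.1]; exact hy.2
  · intro y hy
    change proj (s' y) ∈ W
    rw [hps' y hy.1]; exact hy.2
  · intro y hy
    have e1 := h1 (s y) (by rw [hps y hy.1]; exact hy.2)
    have e2 := h1 (s' y) (by rw [hps' y hy.1]; exact hy.2)
    rw [hps y hy.1] at e1
    rw [hps' y hy.1] at e2
    calc act (s y) ((t (s y))⁻¹ * t (s' y))
        = act (act (σ y) (t (s y))) ((t (s y))⁻¹ * t (s' y)) := by rw [e1]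
      _ = s' y := by rw [← hB.act_mul, mul_inv_cancel_left, e2]

/-- The pull-back of a connection form under `b · γ` is the gauge transform of that under `b`. -/
theorem IsPrincipalConnection.pull_act
    (hB : IsPrincipalBundle 𝓘(ℝ, F) 𝓘(ℝ, EB) 𝓘(ℝ, EX) proj act)
    {θ : B → EB →L[ℝ] F} (hθ : IsPrincipalConnection (IM := 𝓘(ℝ, EB)) act θ)
    {b : M → B} {γ : M → Γ} {x : M}
    (hb : MDifferentiableAt I 𝓘(ℝ, EB) b x) (hγ : MDifferentiableAt I 𝓘(ℝ, F) γ x) :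
    pull I 𝓘(ℝ, EB) (fun y => act (b y) (γ y)) θ x = gauge I (pull I 𝓘(ℝ, EB) b θ) γ x := by
  have hact : MDifferentiable (𝓘(ℝ, EB).prod 𝓘(ℝ, F)) 𝓘(ℝ, EB) (uncurry act) :=
    hB.smooth_act.mdifferentiable (by simp)
  have hact₂ : ∀ b, MDifferentiable 𝓘(ℝ, F) 𝓘(ℝ, EB) (act b) := fun b γ =>
    (hact (b, γ)).comp γ (mdifferentiableAt_const.prodMk mdifferentiableAt_id)
  have h1 := tder_two (hact (b x, γ x)) hb hγ
  have hγ' := (mdifferentiableAt_const (c := (γ x)⁻¹)).lieGroup_mul hγ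
  -- the derivative in the group direction is a fundamental vector field at `b · γ`, because
  -- `b · γ(y) = (b · γ(x)) · γ(x)⁻¹ γ(y)`
  have h2 : (tder 𝓘(ℝ, F) 𝓘(ℝ, EB) (fun z => act (b x) z) (γ x)).comp (tder I 𝓘(ℝ, F) γ x) =
      (tder 𝓘(ℝ, F) 𝓘(ℝ, EB) (fun z => act (act (b x) (γ x)) z) 1).comp (pullMC I γ x) := by
    rw [pullMC_eq hγ, ← tder_comp (g := fun z => act (b x) z) (hact₂ _ _) hγ]
    have h3 := tder_comp (g := fun z => act (act (b x) (γ x)) z) (f := fun y => (γ x)⁻¹ * γ y)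
      (x := x) (hact₂ _ _) hγ'
    simp only [← hB.act_mul, mul_inv_cancel_left, inv_mul_cancel] at h3
    simp only [← hB.act_mul]
    exact h3
  ext v
  have hv : ∀ u : F, θ (act (b x) (γ x))
      (tder 𝓘(ℝ, F) 𝓘(ℝ, EB) (fun z => act (act (b x) (γ x)) z) 1 u) = u := by
    intro u
    have := hθ.vertical (act (b x) (γ x)) u
    rw [hB.act_one] at this
    exact this
  have he : θ (act (b x) (γ x)) (tder 𝓘(ℝ, EB) 𝓘(ℝ, EB) (fun z => act z (γ x)) (b x)
      (tder I 𝓘(ℝ, EB) b x v)) = Ad (γ x)⁻¹ (θ (b x) (tder I 𝓘(ℝ, EB) b x v)) :=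
    hθ.equivariant (γ x) (b x) _
  have h4 : pull I 𝓘(ℝ, EB) (fun y => act (b y) (γ y)) θ x v =
      θ (act (b x) (γ x)) (tder I 𝓘(ℝ, EB) (fun y => act (b y) (γ y)) x v) := rfl
  have h5 := congrArg (fun T : E →L[ℝ] EB => T v) (h1.trans (congrArg _ h2))
  refine h4.trans ((congrArg (θ (act (b x) (γ x))) h5).trans ?_)
  exact (map_add (θ (act (b x) (γ x))) _ _).trans (congrArg₂ (· + ·) he (hv _))

end Bundles

/-! ### Gauge transformations and lifts of connections -/

section Lifts

variable {Fh : Type*} [NormedAddCommGroup Fh] [NormedSpace ℝ Fh]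
  {Γh : Type*} [Group Γh] [TopologicalSpace Γh] [ChartedSpace Fh Γh] [LieGroup 𝓘(ℝ, Fh) ∞ Γh]
  {F : Type*} [NormedAddCommGroup F] [NormedSpace ℝ F]
  {Γ : Type*} [Group Γ] [TopologicalSpace Γ] [ChartedSpace F Γ] [LieGroup 𝓘(ℝ, F) ∞ Γ]
  (𝔼 : CentralExtension Fh Γh F Γ)
  {EB : Type*} [NormedAddCommGroup EB] [NormedSpace ℝ EB]
  {B : Type*} [TopologicalSpace B] [ChartedSpace EB B]
  {EX : Type*} [NormedAddCommGroup EX] [NormedSpace ℝ EX]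
  {X : Type*} [TopologicalSpace X] [ChartedSpace EX X]
  {proj : B → X} {act : B → Γ → B}
  {E : Type*} [NormedAddCommGroup E] [NormedSpace ℝ E]
  {H : Type*} [TopologicalSpace H] {I : ModelWithCorners ℝ E H}
  {M : Type*} [TopologicalSpace M] [ChartedSpace H M]

theorem gauge_congr {EG G : Type*} [NormedAddCommGroup EG] [NormedSpace ℝ EG]
    [Group G] [TopologicalSpace G] [ChartedSpace EG G]
    {θ θ' : M → E →L[ℝ] EG} {g g' : M → G} {x : M} (hθ : θ x = θ' x) (hg : g =ᶠ[𝓝 x] g') :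
    gauge I θ g x = gauge I θ' g' x := by
  simp only [gauge, hθ, hg.self_of_nhds, pullMC, pull_congr hg]

namespace CentralExtension

/-- The difference `θ' - θ · g` of a one-form and a gauge transform, when it has values in the
centre `iℝ`. -/
def defect (I : ModelWithCorners ℝ E H) (θ θ' : M → E →L[ℝ] Fh) (g : M → Γh) (x : M) :
    E →L[ℝ] ℝ := 𝔼.scalarPart.comp (θ' x - gauge I θ g x)

variable {𝔼} in
theorem dincl_comp_scalarPart_comp {A : E →L[ℝ] Fh} (hA : 𝔼.dq.comp A = 0) :
    𝔼.dincl.comp (𝔼.scalarPart.comp A) = A := by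
  ext v
  exact 𝔼.dincl_scalarPart (congrArg (fun T : E →L[ℝ] F => T v) hA)

variable {𝔼} in
theorem dincl_comp_defect {θ θ' : M → E →L[ℝ] Fh} {g : M → Γh} {x : M}
    (h : 𝔼.dq.comp (θ' x) = 𝔼.dq.comp (gauge I θ g x)) :
    𝔼.dincl.comp (𝔼.defect I θ θ' g x) = θ' x - gauge I θ g x :=
  dincl_comp_scalarPart_comp (by rw [ContinuousLinearMap.comp_sub, h, sub_self])

theorem scalarPart_comp_dincl_comp (A : E →L[ℝ] ℝ) :
    𝔼.scalarPart.comp (𝔼.dincl.comp A) = A := by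
  ext v
  exact 𝔼.scalarPart_dincl _

theorem Ad_comp_dincl_comp (g : Γh) (A : E →L[ℝ] ℝ) :
    (Ad g).comp (𝔼.dincl.comp A) = 𝔼.dincl.comp A := by
  ext v
  exact 𝔼.Ad_dincl g _

variable {𝔼} in
theorem defect_mul {θ₁ θ₂ θ₃ : M → E →L[ℝ] Fh} {g h : M → Γh} {x : M}
    (hg : MDifferentiableAt I 𝓘(ℝ, Fh) g x) (hh : MDifferentiableAt I 𝓘(ℝ, Fh) h x)
    (h₁₂ : 𝔼.dq.comp (θ₂ x) = 𝔼.dq.comp (gauge I θ₁ g x)) :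
    𝔼.defect I θ₁ θ₃ (fun y => g y * h y) x =
      𝔼.defect I θ₂ θ₃ h x + 𝔼.defect I θ₁ θ₂ g x := by
  have h1 : gauge I θ₁ g x = θ₂ x - 𝔼.dincl.comp (𝔼.defect I θ₁ θ₂ g x) := by
    rw [dincl_comp_defect h₁₂]; abel
  have h2 : gauge I θ₁ (fun y => g y * h y) x =
      gauge I θ₂ h x - 𝔼.dincl.comp (𝔼.defect I θ₁ θ₂ g x) := by
    rw [gauge_mul hg hh, h1, ContinuousLinearMap.comp_sub, Ad_comp_dincl_comp, gauge]
    abel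
  have h3 : θ₃ x - (gauge I θ₂ h x - 𝔼.dincl.comp (𝔼.defect I θ₁ θ₂ g x)) =
      (θ₃ x - gauge I θ₂ h x) + 𝔼.dincl.comp (𝔼.defect I θ₁ θ₂ g x) := by abel
  rw [defect, h2, h3, ContinuousLinearMap.comp_add, 𝔼.scalarPart_comp_dincl_comp]
  rfl

theorem gauge_mul_incl {θ : M → E →L[ℝ] Fh} {g : M → Γh} {z : M → Circle} {x : M}
    (hg : MDifferentiableAt I 𝓘(ℝ, Fh) g x) (hz : ContMDiffAt I (𝓡 1) ∞ z x) :
    gauge I θ (fun y => g y * 𝔼.incl (z y)) x =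
      gauge I θ g x + 𝔼.dincl.comp (dlogForm I z x) := by
  have h : MDifferentiableAt I 𝓘(ℝ, Fh) (fun y => 𝔼.incl (z y)) x :=
    ((𝔼.contMDiff_incl _).comp x hz).mdifferentiableAt (by simp)
  rw [gauge_mul hg h, ← map_inv, Ad_incl, ContinuousLinearMap.id_comp, pullMC_incl 𝔼 hz]

theorem defect_mul_incl {θ θ' : M → E →L[ℝ] Fh} {g : M → Γh} {z : M → Circle} {x : M}
    (hg : MDifferentiableAt I 𝓘(ℝ, Fh) g x) (hz : ContMDiffAt I (𝓡 1) ∞ z x) :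
    𝔼.defect I θ θ' (fun y => g y * 𝔼.incl (z y)) x =
      𝔼.defect I θ θ' g x - dlogForm I z x := by
  rw [defect, gauge_mul_incl 𝔼 hg hz, defect, ← sub_sub, ContinuousLinearMap.comp_sub,
    scalarPart_comp_dincl_comp]

theorem defect_congr {θ θ' : M → E →L[ℝ] Fh} {g g' : M → Γh} {x : M} (hg : g =ᶠ[𝓝 x] g') :
    𝔼.defect I θ θ' g x = 𝔼.defect I θ θ' g' x := by
  rw [defect, gauge_congr rfl hg, defect]

theorem formSmoothAt_defect [IsManifold I ∞ M] [I.Boundaryless] {θ θ' : M → E →L[ℝ] Fh}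
    {g : M → Γh} {x : M} (hθ : FormSmoothAt I θ x) (hθ' : FormSmoothAt I θ' x)
    (hg : ContMDiffAt I 𝓘(ℝ, Fh) ∞ g x) : FormSmoothAt I (𝔼.defect I θ θ' g) x :=
  (hθ'.sub (formSmoothAt_gauge hθ hg)).const_clm_comp _

/-- If `θ` and `θ'` lift the connection forms along two sections which differ by `q g`, then
`θ' - θ · g` has values in the centre. -/
theorem dq_comp_eq_dq_comp_gauge (hB : IsPrincipalBundle 𝓘(ℝ, F) 𝓘(ℝ, EB) 𝓘(ℝ, EX) proj act)
    {Θ : B → EB →L[ℝ] F} (hΘ : IsPrincipalConnection (IM := 𝓘(ℝ, EB)) act Θ) {θ θ' : M → E →L[ℝ] Fh}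
    {g : M → Γh} {s s' : M → B} {x : M} (hg : MDifferentiableAt I 𝓘(ℝ, Fh) g x)
    (hs : MDifferentiableAt I 𝓘(ℝ, EB) s x)
    (hθ : 𝔼.dq.comp (θ x) = pull I 𝓘(ℝ, EB) s Θ x)
    (hθ' : 𝔼.dq.comp (θ' x) = pull I 𝓘(ℝ, EB) s' Θ x)
    (hss' : s' =ᶠ[𝓝 x] fun y => act (s y) (𝔼.q (g y))) :
    𝔼.dq.comp (θ' x) = 𝔼.dq.comp (gauge I θ g x) := by
  have hqg : MDifferentiableAt I 𝓘(ℝ, F) (fun y => 𝔼.q (g y)) x := (𝔼.mdifferentiable_q _).comp x hg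
  rw [hθ', pull_congr hss', hΘ.pull_act hB hs hqg, 𝔼.dq_comp_gauge hg]
  exact gauge_congr hθ.symm (Filter.EventuallyEq.refl _ _)

end CentralExtension

variable {𝔼}

theorem Splitting.L_act (𝓛 : Splitting EB 𝔼 act) (b : B) (g : Γh) (v : Fh) :
    𝓛.L (act b (𝔼.q g)) (Ad g⁻¹ v) = 𝓛.L b v := by
  rw [← 𝔼.adLift_q, map_inv]
  exact 𝓛.equivariant b (𝔼.q g) v

theorem Splitting.L_eq_scalarPart (𝓛 : Splitting EB 𝔼 act) (b : B) {v : Fh} (hv : 𝔼.dq v = 0) :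
    𝓛.L b v = 𝔼.scalarPart v := by
  conv_lhs => rw [← 𝔼.dincl_scalarPart hv]
  exact 𝓛.on_center b _

/-- The change of the split curvature `L(s, dθ + [θ, θ]/2)` under a gauge transformation followed by
the addition of a central form `k = θ' - θ · g`: it is `dk`. -/
theorem Splitting.L_curv_sub [IsManifold I ∞ M] [I.Boundaryless] (𝓛 : Splitting EB 𝔼 act)
    {θ θ' : M → E →L[ℝ] Fh} {g : M → Γh} {x : M} (hθ : FormSmoothAt I θ x)
    (hθ' : FormSmoothAt I θ' x) (hg : ContMDiffAt I 𝓘(ℝ, Fh) ∞ g x)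
    (h : ∀ᶠ y in 𝓝 x, 𝔼.dq.comp (θ' y) = 𝔼.dq.comp (gauge I θ g y)) (b : B) (v w : E) :
    𝓛.L (act b (𝔼.q (g x))) (curv Γh I θ' x v w) - 𝓛.L b (curv Γh I θ x v w) =
      extD I (𝔼.defect I θ θ' g) x v w := by
  have hk := 𝔼.formSmoothAt_defect hθ hθ' hg
  have hG := formSmoothAt_gauge hθ hg
  have h1 : ∀ᶠ y in 𝓝 x,
      θ' y = gauge I θ g y + 𝔼.dincl.comp (𝔼.defect I θ θ' g y) := by
    filter_upwards [h] with y hy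
    rw [CentralExtension.dincl_comp_defect hy]; abel
  have h2 : curv Γh I θ' x v w = curv Γh I (gauge I θ g) x v w +
      𝔼.dincl (extD I (𝔼.defect I θ θ' g) x v w) := by
    have h3 : ∀ t u, bracketL Γh (𝔼.dincl t) u = 0 := fun t u => by
      rw [bracketL_swap, 𝔼.bracketL_dincl, neg_zero]
    rw [curv, extD_congr h1, extD_add hG (hk.const_clm_comp _), extD_const_clm_comp hk,
      h1.self_of_nhds, curv]
    simp only [add_apply, map_add, ContinuousLinearMap.comp_apply, 𝔼.bracketL_dincl, h3]
    abel
  rw [h2, map_add, curv_gauge hθ hg, 𝓛.L_act, 𝓛.on_center]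
  abel

theorem curvature_eq_curv [IsManifold I ∞ M] {EG G : Type*} [NormedAddCommGroup EG]
    [NormedSpace ℝ EG] [Group G] [TopologicalSpace G] [ChartedSpace EG G] [LieGroup 𝓘(ℝ, EG) ∞ G]
    (θ : OneForm I M EG) (x : M) (v w : E) : curvature G θ x v w = curv G I θ x v w := by
  exact congrArg₂ (· + ·) (OneForm.d_eq_extD θ x v w)
    (bracketL_apply (G := G) (θ x v) (θ x w)).symm

/-- The split curvature is a smooth two-form. -/
theorem Splitting.smoothOn_L_curv [IsManifold I ∞ M] [I.Boundaryless] (𝓛 : Splitting EB 𝔼 act)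
    {θ : M → E →L[ℝ] Fh} {s : M → B} {U : Set M} (hs : ContMDiffOn I 𝓘(ℝ, EB) ∞ s U)
    (hU : IsOpen U) (hθ : ∀ x ∈ U, FormSmoothAt I θ x) :
    TwoForm.SmoothOn (I := I) (fun x v w => 𝓛.L (s x) (curv Γh I θ x v w)) U := by
  constructor
  · intro x _ v
    have h1 : ∀ v : E, curv Γh I θ x v v = 0 := fun v => by
      rw [curv, bracketL_self, extD, sub_self, add_zero]
    exact (congrArg (𝓛.L (s x)) (h1 v)).trans (map_zero _)
  · intro x₀
    set ψ := (extChartAt I x₀).symm with hψ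
    -- `A e v w = D e v w - D e w v + [θ v, θ w]` is the curvature in the chart
    let D : E → E →L[ℝ] E →L[ℝ] Fh := fderiv ℝ (chartForm I θ x₀)
    let A : E → E →L[ℝ] E →L[ℝ] Fh := fun e =>
      D e - (D e).flip +
        (((ContinuousLinearMap.compL ℝ E Fh Fh).flip (chartForm I θ x₀ e)).comp
          ((bracketL Γh).comp (chartForm I θ x₀ e)))
    refine ⟨fun e => (ContinuousLinearMap.compL ℝ E Fh ℝ (𝓛.L (s (ψ e)))).comp (A e), ?_, ?_⟩
    · rintro e ⟨he, heU⟩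
      have hsm := hθ _ heU x₀ ((extChartAt I x₀).map_target he)
      rw [(extChartAt I x₀).right_inv he] at hsm
      have hD : ContDiffAt ℝ ∞ D e := hsm.fderiv_right (by simp)
      have hs' : ContMDiffAt 𝓘(ℝ, E) 𝓘(ℝ, EB) ∞ (fun e => s (ψ e)) e :=
        ContMDiffAt.comp (g := s) e (hs.contMDiffAt (hU.mem_nhds heU))
          (contMDiffAt_extChartAt_symm he)
      have hL : ContDiffAt ℝ ∞ (fun e => 𝓛.L (s (ψ e))) e :=
        ((𝓛.smooth _).comp e hs').contDiffAt
      have hA : ContDiffAt ℝ ∞ A e := by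
        refine (hD.sub ?_).add ?_
        · have hflip : IsBoundedLinearMap ℝ
              (fun T : E →L[ℝ] E →L[ℝ] Fh => (T.flip : E →L[ℝ] E →L[ℝ] Fh)) :=
            ⟨⟨fun _ _ => rfl, fun _ _ => rfl⟩, 1, one_pos, fun T => by
              rw [one_mul]; exact T.opNorm_flip.le⟩
          exact (IsBoundedLinearMap.contDiff (E := E →L[ℝ] E →L[ℝ] Fh) (F := E →L[ℝ] E →L[ℝ] Fh)
            hflip).contDiffAt.comp e hD
        · exact (((ContinuousLinearMap.compL ℝ E Fh Fh).flip.contDiff.contDiffAt.comp e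
            hsm)).clm_comp (contDiffAt_const.clm_comp hsm)
      exact (((ContinuousLinearMap.compL ℝ E Fh ℝ).contDiff.contDiffAt.comp e hL).clm_comp
        hA).contDiffWithinAt
    · rintro e ⟨he, heU⟩ v w
      have h1 := extD_chart he (hθ _ heU) v w
      change 𝓛.L (s (ψ e)) (curv Γh I θ (ψ e) (tder 𝓘(ℝ, E) I ψ e v) (tder 𝓘(ℝ, E) I ψ e w)) = _
      rw [curv, h1]
      rfl

end Lifts

/-! ### The Deligne class of lifted transition functions and connection forms -/

section Class

universe u

variable {E : Type*} [NormedAddCommGroup E] [NormedSpace ℝ E]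
  {X : Type u} [TopologicalSpace X] [ChartedSpace E X]
  {EB : Type*} [NormedAddCommGroup EB] [NormedSpace ℝ EB]
  {B : Type*} [TopologicalSpace B] [ChartedSpace EB B]
  {Fh : Type*} [NormedAddCommGroup Fh] [NormedSpace ℝ Fh]
  {Γh : Type*} [Group Γh] [TopologicalSpace Γh] [ChartedSpace Fh Γh]
  {F : Type*} [NormedAddCommGroup F] [NormedSpace ℝ F]
  {Γ : Type*} [Group Γ] [TopologicalSpace Γ] [ChartedSpace F Γ]
  {𝔼 : CentralExtension Fh Γh F Γ} {proj : B → X} {act : B → Γ → B}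
  {Θ : B → EB →L[ℝ] F} {𝔘 𝔙 : Cover X}

variable (E 𝔼 proj act Θ) in
/-- Local sections of `B`, lifts to `Γh` of the transition functions, and lifts to `Lie Γh` of the
local connection forms.  In contrast to `ObstructionData`, no relation between `g α β` and `g β α`
is required, so that the choices defining the class of the lifting gerbe are of this kind too. -/
structure LiftData (𝔘 : Cover X) where
  /-- The local sections. -/
  s : 𝔘.ι → X → B
  smooth_s : ∀ α, ContMDiffOn 𝓘(ℝ, E) 𝓘(ℝ, EB) ∞ (s α) (𝔘.U α : Set X)
  proj_s : ∀ α, ∀ x ∈ 𝔘.U α, proj (s α x) = x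
  /-- The lifted transition functions. -/
  g : 𝔘.ι → 𝔘.ι → X → Γh
  smooth_g : ∀ α β, ContMDiffOn 𝓘(ℝ, E) 𝓘(ℝ, Fh) ∞ (g α β) (𝔘.U α ∩ 𝔘.U β : Set X)
  act_g : ∀ α β, ∀ x, x ∈ 𝔘.U α → x ∈ 𝔘.U β → act (s α x) (𝔼.q (g α β x)) = s β x
  /-- The lifted connection forms. -/
  θh : 𝔘.ι → X → E →L[ℝ] Fh
  smooth_θh : ∀ α, ∀ x ∈ 𝔘.U α, FormSmoothAt 𝓘(ℝ, E) (θh α) x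
  dq_θh : ∀ α, ∀ x ∈ 𝔘.U α, 𝔼.dq.comp (θh α x) = pull 𝓘(ℝ, E) 𝓘(ℝ, EB) (s α) Θ x

namespace LiftData

variable [LieGroup 𝓘(ℝ, F) ∞ Γ] [LieGroup 𝓘(ℝ, Fh) ∞ Γh]

/-- The cochain of lifted data, with `g_αβ g_βγ = g_αγ z_αβγ` and `u_αβ = θh_β - θh_α · g_αβ`. -/
def cochain (D : LiftData E 𝔼 proj act Θ 𝔘) (𝓛 : Splitting EB 𝔼 act) :
    Cochain 𝓘(ℝ, E) (X := X) 𝔘.ι where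
  z α β γ x := 𝔼.circlePart ((D.g α γ x)⁻¹ * (D.g α β x * D.g β γ x))
  u α β := 𝔼.defect 𝓘(ℝ, E) (D.θh α) (D.θh β) (D.g α β)
  K α x v w := 𝓛.L (D.s α x) (curv Γh 𝓘(ℝ, E) (D.θh α) x v w)

/-- The restriction of lifted data to a refinement of the cover. -/
def restrict (D : LiftData E 𝔼 proj act Θ 𝔘) (τ : 𝔙.ι → 𝔘.ι) (h : ∀ α, 𝔙.U α ≤ 𝔘.U (τ α)) :
    LiftData E 𝔼 proj act Θ 𝔙 where
  s α := D.s (τ α)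
  smooth_s α := (D.smooth_s (τ α)).mono (h α)
  proj_s α x hx := D.proj_s (τ α) x (h α hx)
  g α β := D.g (τ α) (τ β)
  smooth_g α β := (D.smooth_g (τ α) (τ β)).mono (inter_subset_inter (h α) (h β))
  act_g α β x hα hβ := D.act_g (τ α) (τ β) x (h α hα) (h β hβ)
  θh α := D.θh (τ α)
  smooth_θh α x hx := D.smooth_θh (τ α) x (h α hx)
  dq_θh α x hx := D.dq_θh (τ α) x (h α hx)

theorem mem_nhds_inter {α β : 𝔘.ι} {x : X} (hα : x ∈ 𝔘.U α) (hβ : x ∈ 𝔘.U β) :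
    (𝔘.U α ∩ 𝔘.U β : Set X) ∈ 𝓝 x :=
  ((𝔘.U α).isOpen.inter (𝔘.U β).isOpen).mem_nhds ⟨hα, hβ⟩

section
variable (D : LiftData E 𝔼 proj act Θ 𝔘) {α β γ : 𝔘.ι} {x : X}

theorem contMDiffAt_g (hα : x ∈ 𝔘.U α) (hβ : x ∈ 𝔘.U β) :
    ContMDiffAt 𝓘(ℝ, E) 𝓘(ℝ, Fh) ∞ (D.g α β) x :=
  (D.smooth_g α β).contMDiffAt (mem_nhds_inter hα hβ)

theorem mdifferentiableAt_g (hα : x ∈ 𝔘.U α) (hβ : x ∈ 𝔘.U β) :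
    MDifferentiableAt 𝓘(ℝ, E) 𝓘(ℝ, Fh) (D.g α β) x :=
  (D.contMDiffAt_g hα hβ).mdifferentiableAt (by simp)

theorem contMDiffAt_s (hα : x ∈ 𝔘.U α) : ContMDiffAt 𝓘(ℝ, E) 𝓘(ℝ, EB) ∞ (D.s α) x :=
  (D.smooth_s α).contMDiffAt ((𝔘.U α).isOpen.mem_nhds hα)

theorem mdifferentiableAt_s (hα : x ∈ 𝔘.U α) :
    MDifferentiableAt 𝓘(ℝ, E) 𝓘(ℝ, EB) (D.s α) x :=
  (D.contMDiffAt_s hα).mdifferentiableAt (by simp)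

variable (hB : IsPrincipalBundle 𝓘(ℝ, F) 𝓘(ℝ, EB) 𝓘(ℝ, E) proj act)
include hB

theorem q_g_mul (hα : x ∈ 𝔘.U α) (hβ : x ∈ 𝔘.U β) (hγ : x ∈ 𝔘.U γ) :
    𝔼.q ((D.g α γ x)⁻¹ * (D.g α β x * D.g β γ x)) = 1 := by
  have : 𝔼.q (D.g α γ x) = 𝔼.q (D.g α β x) * 𝔼.q (D.g β γ x) := by
    apply hB.act_injective (b := D.s α x)
    rw [hB.act_mul, D.act_g α γ x hα hγ, D.act_g α β x hα hβ, D.act_g β γ x hβ hγ]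
  rw [map_mul, map_inv, map_mul, this, inv_mul_cancel]

theorem g_mul (𝓛 : Splitting EB 𝔼 act) (hα : x ∈ 𝔘.U α) (hβ : x ∈ 𝔘.U β) (hγ : x ∈ 𝔘.U γ) :
    D.g α β x * D.g β γ x = D.g α γ x * 𝔼.incl ((D.cochain 𝓛).z α β γ x) := by
  have h : 𝔼.incl ((D.cochain 𝓛).z α β γ x) = _ := 𝔼.incl_circlePart (D.q_g_mul hB hα hβ hγ)
  rw [h, mul_inv_cancel_left]

theorem smooth_z (𝓛 : Splitting EB 𝔼 act) (α β γ : 𝔘.ι) :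
    ContMDiffOn 𝓘(ℝ, E) (𝓡 1) ∞ ((D.cochain 𝓛).z α β γ) (𝔘.U α ∩ 𝔘.U β ∩ 𝔘.U γ : Set X) := by
  refine 𝔼.contMDiffOn_circlePart ?_ fun x hx => D.q_g_mul hB hx.1.1 hx.1.2 hx.2
  exact ((D.smooth_g α γ).mono fun x hx => ⟨hx.1.1, hx.2⟩).inv.mul
    (((D.smooth_g α β).mono fun x hx => hx.1).mul
      ((D.smooth_g β γ).mono fun x hx => ⟨hx.1.2, hx.2⟩))

variable (hΘ : IsPrincipalConnection (IM := 𝓘(ℝ, EB)) act Θ)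
include hΘ

theorem dq_θh_eq (hα : x ∈ 𝔘.U α) (hβ : x ∈ 𝔘.U β) :
    𝔼.dq.comp (D.θh β x) = 𝔼.dq.comp (gauge 𝓘(ℝ, E) (D.θh α) (D.g α β) x) := by
  refine 𝔼.dq_comp_eq_dq_comp_gauge hB hΘ (D.mdifferentiableAt_g hα hβ) (D.mdifferentiableAt_s hα)
    (D.dq_θh α x hα) (D.dq_θh β x hβ) ?_
  filter_upwards [mem_nhds_inter hα hβ] with y hy
  exact (D.act_g α β y hy.1 hy.2).symm

theorem isCocycle [IsManifold 𝓘(ℝ, E) ∞ X] (𝓛 : Splitting EB 𝔼 act) :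
    (D.cochain 𝓛).IsCocycle 𝓘(ℝ, E) 𝔘 where
  smooth_z := D.smooth_z hB 𝓛
  smooth_u α β := FormSmoothAt.oneForm_smoothOn fun x hx =>
    𝔼.formSmoothAt_defect (D.smooth_θh α x hx.1) (D.smooth_θh β x hx.2) (D.contMDiffAt_g hx.1 hx.2)
  smooth_K α := 𝓛.smoothOn_L_curv (D.smooth_s α) (𝔘.U α).isOpen (D.smooth_θh α)
  cocycle_z α β γ δ x hα hβ hγ hδ := by
    set z := (D.cochain 𝓛).z
    -- evaluate `g_αβ g_βγ g_γδ` in two ways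
    have h1 : D.g α β x * D.g β γ x * D.g γ δ x =
        D.g α δ x * 𝔼.incl (z α γ δ x * z α β γ x) := by
      rw [D.g_mul hB 𝓛 hα hβ hγ, mul_assoc, 𝔼.central, ← mul_assoc, D.g_mul hB 𝓛 hα hγ hδ,
        mul_assoc, map_mul]
    have h2 : D.g α β x * (D.g β γ x * D.g γ δ x) =
        D.g α δ x * 𝔼.incl (z α β δ x * z β γ δ x) := by
      rw [D.g_mul hB 𝓛 hβ hγ hδ, ← mul_assoc, D.g_mul hB 𝓛 hα hβ hδ, mul_assoc, map_mul]
    have h3 := 𝔼.incl_injective (mul_left_cancel (h1.symm.trans ((mul_assoc _ _ _).trans h2)))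
    rw [mul_inv_eq_one, mul_right_comm, mul_comm (z β γ δ x), ← h3, mul_inv_cancel_comm]
  cocycle_u α β γ x hα hβ hγ := by
    have hz : ContMDiffAt 𝓘(ℝ, E) (𝓡 1) ∞ ((D.cochain 𝓛).z α β γ) x :=
      (D.smooth_z hB 𝓛 α β γ).contMDiffAt
        (Filter.inter_mem (mem_nhds_inter hα hβ) ((𝔘.U γ).isOpen.mem_nhds hγ))
    -- compute the defect of `g_αβ g_βγ = g_αγ z_αβγ` in two ways
    have h1 := CentralExtension.defect_mul (θ₃ := D.θh γ) (D.mdifferentiableAt_g hα hβ)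
      (D.mdifferentiableAt_g hβ hγ) (D.dq_θh_eq hB hΘ hα hβ)
    have h2 := 𝔼.defect_mul_incl (θ := D.θh α) (θ' := D.θh γ) (D.mdifferentiableAt_g hα hγ) hz
    rw [← 𝔼.defect_congr (g := fun y => D.g α β y * D.g β γ y), h1] at h2
    · have h3 : (D.cochain 𝓛).u β γ x - (D.cochain 𝓛).u α γ x + (D.cochain 𝓛).u α β x =
          (𝔼.defect 𝓘(ℝ, E) (D.θh β) (D.θh γ) (D.g β γ) x +
            𝔼.defect 𝓘(ℝ, E) (D.θh α) (D.θh β) (D.g α β) x) -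
            𝔼.defect 𝓘(ℝ, E) (D.θh α) (D.θh γ) (D.g α γ) x := sub_add_eq_add_sub _ _ _
      rw [h3, h2]
      exact (congrArg (· + dlogForm 𝓘(ℝ, E) _ x) (sub_sub_cancel_left _ _)).trans
        (neg_add_cancel _)
    · filter_upwards [mem_nhds_inter hα hβ, (𝔘.U γ).isOpen.mem_nhds hγ] with y hy hy'
      exact D.g_mul hB 𝓛 hy.1 hy.2 hy'
  cocycle_K α β x hα hβ v w := by
    have h := 𝓛.L_curv_sub (D.smooth_θh α x hα) (D.smooth_θh β x hβ) (D.contMDiffAt_g hα hβ)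
      (by filter_upwards [mem_nhds_inter hα hβ] with y hy using D.dq_θh_eq hB hΘ hy.1 hy.2)
      (D.s α x) v w
    rw [D.act_g α β x hα hβ] at h
    exact sub_eq_zero.2 (h.trans (OneForm.d_eq_extD (I := 𝓘(ℝ, E)) _ x v w).symm)

/-- The cocycle of lifted data. -/
def cocycle [IsManifold 𝓘(ℝ, E) ∞ X] (𝓛 : Splitting EB 𝔼 act) : Cocycle 𝓘(ℝ, E) X :=
  ⟨𝔘, D.cochain 𝓛, D.isCocycle hB hΘ 𝓛⟩

end

/-- Lifted data whose sections differ by liftable functions `q r_α` from those of data on a coarser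
cover define a cohomologous cocycle. -/
theorem refinesTo [IsManifold 𝓘(ℝ, E) ∞ X]
    (hB : IsPrincipalBundle 𝓘(ℝ, F) 𝓘(ℝ, EB) 𝓘(ℝ, E) proj act)
    (hΘ : IsPrincipalConnection (IM := 𝓘(ℝ, EB)) act Θ) (𝓛 : Splitting EB 𝔼 act)
    (D : LiftData E 𝔼 proj act Θ 𝔘) (D' : LiftData E 𝔼 proj act Θ 𝔙) (τ : 𝔙.ι → 𝔘.ι)
    (hτ : ∀ α, 𝔙.U α ≤ 𝔘.U (τ α)) (r : 𝔙.ι → X → Γh)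
    (hr : ∀ α, ContMDiffOn 𝓘(ℝ, E) 𝓘(ℝ, Fh) ∞ (r α) (𝔙.U α : Set X))
    (hrs : ∀ α, ∀ x ∈ 𝔙.U α, act (D.s (τ α) x) (𝔼.q (r α x)) = D'.s α x) :
    Cocycle.RefinesTo 𝓘(ℝ, E) (D.cocycle hB hΘ 𝓛) (D'.cocycle hB hΘ 𝓛) := by
  have hrAt : ∀ {α x}, x ∈ 𝔙.U α → ContMDiffAt 𝓘(ℝ, E) 𝓘(ℝ, Fh) ∞ (r α) x := fun {α x} hx =>
    (hr α).contMDiffAt ((𝔙.U α).isOpen.mem_nhds hx)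
  have hrd : ∀ {α x}, x ∈ 𝔙.U α → MDifferentiableAt 𝓘(ℝ, E) 𝓘(ℝ, Fh) (r α) x := fun hx =>
    (hrAt hx).mdifferentiableAt (by simp)
  -- the Čech one-cochain `h` with `r_α g'_αβ = g_αβ r_β h_αβ`
  let h : 𝔙.ι → 𝔙.ι → X → Circle := fun α β x =>
    𝔼.circlePart ((D.g (τ α) (τ β) x * r β x)⁻¹ * (r α x * D'.g α β x))
  have hq : ∀ {α β x}, x ∈ 𝔙.U α → x ∈ 𝔙.U β →
      𝔼.q ((D.g (τ α) (τ β) x * r β x)⁻¹ * (r α x * D'.g α β x)) = 1 := by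
    intro α β x hα hβ
    have : 𝔼.q (D.g (τ α) (τ β) x) * 𝔼.q (r β x) = 𝔼.q (r α x) * 𝔼.q (D'.g α β x) := by
      apply hB.act_injective (b := D.s (τ α) x)
      rw [hB.act_mul, hB.act_mul, hrs α x hα, D'.act_g α β x hα hβ,
        D.act_g _ _ x (hτ α hα) (hτ β hβ), hrs β x hβ]
    rw [map_mul, map_inv, map_mul, map_mul, this, inv_mul_cancel]
  have hh : ∀ {α β x}, x ∈ 𝔙.U α → x ∈ 𝔙.U β →
      r α x * D'.g α β x = D.g (τ α) (τ β) x * r β x * 𝔼.incl (h α β x) := by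
    intro α β x hα hβ
    rw [𝔼.incl_circlePart (hq hα hβ), mul_inv_cancel_left]
  have hsm : ∀ α β, ContMDiffOn 𝓘(ℝ, E) (𝓡 1) ∞ (h α β) (𝔙.U α ∩ 𝔙.U β : Set X) := by
    intro α β
    refine 𝔼.contMDiffOn_circlePart ?_ fun x hx => hq hx.1 hx.2
    exact ((((D.smooth_g (τ α) (τ β)).mono (inter_subset_inter (hτ α) (hτ β))).mul
      ((hr β).mono inter_subset_right)).inv).mul
      (((hr α).mono inter_subset_left).mul (D'.smooth_g α β))
  have hdq : ∀ {α x}, x ∈ 𝔙.U α → 𝔼.dq.comp (D'.θh α x) =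
      𝔼.dq.comp (gauge 𝓘(ℝ, E) (D.θh (τ α)) (r α) x) := by
    intro α x hα
    refine 𝔼.dq_comp_eq_dq_comp_gauge hB hΘ (hrd hα) (D.mdifferentiableAt_s (hτ α hα))
      (D.dq_θh _ x (hτ α hα)) (D'.dq_θh α x hα) ?_
    filter_upwards [(𝔙.U α).isOpen.mem_nhds hα] with y hy
    exact (hrs α y hy).symm
  refine ⟨τ, hτ, h, fun α => 𝔼.defect 𝓘(ℝ, E) (D.θh (τ α)) (D'.θh α) (r α), hsm, ?_, ?_, ?_, ?_⟩
  · exact fun α => FormSmoothAt.oneForm_smoothOn fun x hx =>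
      𝔼.formSmoothAt_defect (D.smooth_θh _ x (hτ α hx)) (D'.smooth_θh α x hx) (hrAt hx)
  · intro α β γ x hα hβ hγ
    change (D'.cochain 𝓛).z α β γ x = (D.cochain 𝓛).z (τ α) (τ β) (τ γ) x * _
    set z' := (D'.cochain 𝓛).z
    set z := (D.cochain 𝓛).z
    -- evaluate `r_α g'_αβ g'_βγ` in two ways
    have h1 : r α x * (D'.g α β x * D'.g β γ x) =
        D.g (τ α) (τ γ) x * r γ x * 𝔼.incl (h α γ x * z' α β γ x) := by
      rw [D'.g_mul hB 𝓛 hα hβ hγ, ← mul_assoc, hh hα hγ, map_mul, mul_assoc]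
    have h2 : r α x * D'.g α β x * D'.g β γ x =
        D.g (τ α) (τ γ) x * r γ x *
          𝔼.incl (z (τ α) (τ β) (τ γ) x * h β γ x * h α β x) := by
      calc r α x * D'.g α β x * D'.g β γ x
          = D.g (τ α) (τ β) x * (r β x * D'.g β γ x) * 𝔼.incl (h α β x) := by
            rw [hh hα hβ, mul_assoc, 𝔼.central]
            simp only [mul_assoc]
        _ = D.g (τ α) (τ γ) x * (𝔼.incl (z (τ α) (τ β) (τ γ) x) * r γ x) *
              𝔼.incl (h β γ x) * 𝔼.incl (h α β x) := by
            rw [hh hβ hγ, ← mul_assoc (D.g _ _ x) (D.g _ _ x * r γ x),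
              ← mul_assoc (D.g _ _ x) (D.g _ _ x), D.g_mul hB 𝓛 (hτ α hα) (hτ β hβ) (hτ γ hγ)]
            simp only [mul_assoc, z]
        _ = _ := by
            rw [𝔼.central]
            simp only [mul_assoc, map_mul]
    have h3 := 𝔼.incl_injective (mul_left_cancel (h1.symm.trans ((mul_assoc _ _ _).symm.trans h2)))
    rw [← mul_right_inj (h α γ x), h3, mul_comm (h β γ x), ← mul_assoc, ← mul_assoc,
      ← mul_assoc, mul_comm _ (h α γ x)⁻¹]
    simp only [mul_assoc, inv_mul_cancel_left]
  · intro α β x hα hβ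
    have hz : ContMDiffAt 𝓘(ℝ, E) (𝓡 1) ∞ (h α β) x :=
      (hsm α β).contMDiffAt (mem_nhds_inter hα hβ)
    have hg := D.mdifferentiableAt_g (hτ α hα) (hτ β hβ)
    -- compute the defect of `r_α g'_αβ = g_αβ r_β h_αβ` in two ways
    have h1 := CentralExtension.defect_mul (θ₃ := D'.θh β) (hrd hα)
      (D'.mdifferentiableAt_g hα hβ) (hdq hα)
    have h2 := 𝔼.defect_mul_incl (θ := D.θh (τ α)) (θ' := D'.θh β) (hg.lieGroup_mul (hrd hβ)) hz
    rw [CentralExtension.defect_mul hg (hrd hβ) (D.dq_θh_eq hB hΘ (hτ α hα) (hτ β hβ)),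
      ← 𝔼.defect_congr (g := fun y => r α y * D'.g α β y), h1] at h2
    · have h3 := eq_sub_of_add_eq h2
      refine h3.trans ?_
      change _ = 𝔼.defect 𝓘(ℝ, E) (D.θh (τ α)) (D.θh (τ β)) (D.g (τ α) (τ β)) x +
        (𝔼.defect 𝓘(ℝ, E) (D.θh (τ β)) (D'.θh β) (r β) x -
          𝔼.defect 𝓘(ℝ, E) (D.θh (τ α)) (D'.θh α) (r α) x - dlogForm 𝓘(ℝ, E) (h α β) x)
      abel
    · filter_upwards [mem_nhds_inter hα hβ] with y hy
      exact hh hy.1 hy.2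
  · intro α x hα v w
    have h := 𝓛.L_curv_sub (D.smooth_θh _ x (hτ α hα)) (D'.smooth_θh α x hα) (hrAt hα)
      (by filter_upwards [(𝔙.U α).isOpen.mem_nhds hα] with y hy using hdq hy)
      (D.s (τ α) x) v w
    rw [hrs α x hα] at h
    exact (sub_eq_iff_eq_add'.1 h).trans
      (congrArg (_ + ·) (OneForm.d_eq_extD (I := 𝓘(ℝ, E)) _ x v w).symm)

/-- The class of lifted data is independent of all choices. -/
theorem class_eq [IsManifold 𝓘(ℝ, E) ∞ X]
    (hB : IsPrincipalBundle 𝓘(ℝ, F) 𝓘(ℝ, EB) 𝓘(ℝ, E) proj act)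
    (hΘ : IsPrincipalConnection (IM := 𝓘(ℝ, EB)) act Θ) (𝓛 : Splitting EB 𝔼 act)
    (D : LiftData E 𝔼 proj act Θ 𝔘) (D' : LiftData E 𝔼 proj act Θ 𝔙) :
    deligneClass 𝓘(ℝ, E) 𝔘 (D.cochain 𝓛) (D.isCocycle hB hΘ 𝓛) =
      deligneClass 𝓘(ℝ, E) 𝔙 (D'.cochain 𝓛) (D'.isCocycle hB hΘ 𝓛) := by
  have key : ∀ x : X, ∃ (a : 𝔘.ι) (b : 𝔙.ι) (W : Set X) (r : X → Γh), IsOpen W ∧ x ∈ W ∧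
      W ⊆ 𝔘.U a ∧ W ⊆ 𝔙.U b ∧ ContMDiffOn 𝓘(ℝ, E) 𝓘(ℝ, Fh) ∞ r W ∧
      ∀ y ∈ W, act (D.s a y) (𝔼.q (r y)) = D'.s b y := by
    intro x
    obtain ⟨a, ha⟩ := 𝔘.covers x
    obtain ⟨b, hb⟩ := 𝔙.covers x
    obtain ⟨V, γ, hV, hxV, hVs, hγ, hact⟩ := hB.exists_local_transition
      ((𝔘.U a).isOpen.inter (𝔙.U b).isOpen) ((D.smooth_s a).mono inter_subset_left)
      ((D'.smooth_s b).mono inter_subset_right) (fun y hy => D.proj_s a y hy.1)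
      (fun y hy => D'.proj_s b y hy.2) (x := x) ⟨ha, hb⟩
    obtain ⟨W, r, hW, hxW, hWV, hr, hq⟩ := 𝔼.exists_local_lift hV hγ hxV
    exact ⟨a, b, W, r, hW, hxW, fun y hy => (hVs (hWV hy)).1, fun y hy => (hVs (hWV hy)).2, hr,
      fun y hy => by rw [hq y hy, hact y (hWV hy)]⟩
  choose a b W r hW hxW hWa hWb hr hact using key
  -- the common refinement of the two covers is indexed by the points of `X`
  let 𝔚 : Cover X := ⟨X, fun x => ⟨W x, hW x⟩, fun x => ⟨x, hxW x⟩⟩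
  let D'' : LiftData E 𝔼 proj act Θ 𝔚 := D'.restrict (𝔙 := 𝔚) b hWb
  have h1 : Cocycle.RefinesTo 𝓘(ℝ, E) (D.cocycle hB hΘ 𝓛) (D''.cocycle hB hΘ 𝓛) :=
    refinesTo hB hΘ 𝓛 D D'' a hWa r hr hact
  have h2 : Cocycle.RefinesTo 𝓘(ℝ, E) (D'.cocycle hB hΘ 𝓛) (D''.cocycle hB hΘ 𝓛) :=
    refinesTo hB hΘ 𝓛 D' D'' b hWb (fun _ _ => 1) (fun _ => contMDiffOn_const)
      fun α x hx => by rw [map_one, hB.act_one]; rfl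
  exact (Quot.sound h1).trans (Quot.sound h2).symm

end LiftData

end Class

/-! ### Agreeing cochains -/

section Agree

universe u

variable {E : Type*} [NormedAddCommGroup E] [NormedSpace ℝ E]
  {H : Type*} [TopologicalSpace H] {I : ModelWithCorners ℝ E H} [I.Boundaryless]
  {X : Type u} [TopologicalSpace X] [ChartedSpace H X] [IsManifold I ∞ X]
  {𝔘 : Cover X} {c c' c'' : Cochain I (X := X) 𝔘.ι}

theorem Cochain.Agree.symm (h : c.Agree I 𝔘 c') : c'.Agree I 𝔘 c where
  z_eq α β γ x hα hβ hγ := (h.z_eq α β γ x hα hβ hγ).symm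
  u_eq α β x hα hβ := (h.u_eq α β x hα hβ).symm
  K_eq α x hα v w := (h.K_eq α x hα v w).symm

theorem Cochain.Agree.trans (h : c.Agree I 𝔘 c') (h' : c'.Agree I 𝔘 c'') : c.Agree I 𝔘 c'' where
  z_eq α β γ x hα hβ hγ := (h.z_eq α β γ x hα hβ hγ).trans (h'.z_eq α β γ x hα hβ hγ)
  u_eq α β x hα hβ := (h.u_eq α β x hα hβ).trans (h'.u_eq α β x hα hβ)
  K_eq α x hα v w := (h.K_eq α x hα v w).trans (h'.K_eq α x hα v w)

theorem dlogForm_congr {z z' : X → Circle} {x : X} (h : z =ᶠ[𝓝 x] z') :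
    dlogForm I z x = dlogForm I z' x := by
  have h1 : (fun y => (z y : ℂ)) =ᶠ[𝓝 x] fun y => (z' y : ℂ) := h.fun_comp _
  have h2 := tder_congr (I := I) (I' := 𝓘(ℝ, ℂ)) h1
  change Complex.imCLM.comp ((ContinuousLinearMap.mul ℝ ℂ (starRingEnd ℂ (z x : ℂ))).comp
    (tder I 𝓘(ℝ, ℂ) (fun y => (z y : ℂ)) x)) = _
  rw [h2, h.self_of_nhds]
  rfl

theorem dlogForm_const (z : Circle) (x : X) : dlogForm I (fun _ : X => z) x = 0 := by
  change Complex.imCLM.comp ((ContinuousLinearMap.mul ℝ ℂ _).comp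
    (tder I 𝓘(ℝ, ℂ) (fun _ : X => (z : ℂ)) x)) = 0
  rw [tder_const, ContinuousLinearMap.comp_zero, ContinuousLinearMap.comp_zero]

theorem formSmoothAt_zero {V : Type*} [NormedAddCommGroup V] [NormedSpace ℝ V] (x : X) :
    FormSmoothAt I (fun _ : X => (0 : E →L[ℝ] V)) x := fun x₀ _ => by
  have : chartForm I (fun _ : X => (0 : E →L[ℝ] V)) x₀ = fun _ => 0 := by
    funext e; exact ContinuousLinearMap.zero_comp _
  rw [this]
  exact contDiffAt_const

theorem extD_zero {V : Type*} [NormedAddCommGroup V] [NormedSpace ℝ V] (x : X) (v w : E) :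
    extD I (fun _ : X => (0 : E →L[ℝ] V)) x v w = 0 := by
  have : chartForm I (fun _ : X => (0 : E →L[ℝ] V)) x = fun _ => 0 := by
    funext e; exact ContinuousLinearMap.zero_comp _
  simp [extD, this]

theorem Cochain.IsCocycle.of_agree (hc : c.IsCocycle I 𝔘) (h : c'.Agree I 𝔘 c) :
    c'.IsCocycle I 𝔘 where
  smooth_z α β γ := (hc.smooth_z α β γ).congr fun x hx => h.z_eq α β γ x hx.1.1 hx.1.2 hx.2
  smooth_u α β := by
    refine FormSmoothAt.oneForm_smoothOn fun x hx => ?_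
    have hU : IsOpen (𝔘.U α ∩ 𝔘.U β : Set X) := (𝔘.U α).isOpen.inter (𝔘.U β).isOpen
    refine ((hc.smooth_u α β).formSmoothAt hU hx).congr ?_
    filter_upwards [hU.mem_nhds hx] with y hy
    exact h.u_eq α β y hy.1 hy.2
  smooth_K α := by
    refine ⟨fun x hx v => (h.K_eq α x hx v v).trans ((hc.smooth_K α).1 x hx v), fun x₀ => ?_⟩
    obtain ⟨G, hG, hGe⟩ := (hc.smooth_K α).2 x₀
    exact ⟨G, hG, fun e he v w => (h.K_eq α _ he.2 _ _).trans (hGe e he v w)⟩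
  cocycle_z α β γ δ x hα hβ hγ hδ := by
    rw [h.z_eq _ _ _ x hβ hγ hδ, h.z_eq _ _ _ x hα hγ hδ, h.z_eq _ _ _ x hα hβ hδ,
      h.z_eq _ _ _ x hα hβ hγ]
    exact hc.cocycle_z α β γ δ x hα hβ hγ hδ
  cocycle_u α β γ x hα hβ hγ := by
    have h1 : dlog (I := I) (c'.z α β γ) x = dlog (I := I) (c.z α β γ) x := by
      refine dlogForm_congr ?_
      filter_upwards [(𝔘.U α).isOpen.mem_nhds hα, (𝔘.U β).isOpen.mem_nhds hβ,
        (𝔘.U γ).isOpen.mem_nhds hγ] with y h1 h2 h3 using h.z_eq α β γ y h1 h2 h3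
    rw [h.u_eq _ _ x hβ hγ, h.u_eq _ _ x hα hγ, h.u_eq _ _ x hα hβ, h1]
    exact hc.cocycle_u α β γ x hα hβ hγ
  cocycle_K α β x hα hβ v w := by
    have h1 : OneForm.d (c'.u α β) x v w = OneForm.d (c.u α β) x v w := by
      refine (OneForm.d_eq_extD (E := E) (I := I) _ x v w).trans
        (Eq.trans (extD_congr (E := E) ?_ v w) (OneForm.d_eq_extD (E := E) (I := I) _ x v w).symm)
      filter_upwards [(𝔘.U α).isOpen.mem_nhds hα, (𝔘.U β).isOpen.mem_nhds hβ] with y h1 h2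
        using h.u_eq α β y h1 h2
    rw [h.K_eq _ x hα, h.K_eq _ x hβ, h1]
    exact hc.cocycle_K α β x hα hβ v w

theorem deligneClass_eq_of_agree (hc : c.IsCocycle I 𝔘) (hc' : c'.IsCocycle I 𝔘)
    (h : c'.Agree I 𝔘 c) : deligneClass I 𝔘 c' hc' = deligneClass I 𝔘 c hc := by
  refine Quot.sound ⟨id, fun _ => le_rfl, fun _ _ _ => 1, fun _ _ => (0 : E →L[ℝ] ℝ),
    fun _ _ => contMDiffOn_const,
    fun _ => FormSmoothAt.oneForm_smoothOn fun x _ => formSmoothAt_zero x, ?_, ?_, ?_⟩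
  · intro α β γ x hα hβ hγ
    simpa using (h.z_eq α β γ x hα hβ hγ).symm
  · intro α β x hα hβ
    refine (h.u_eq α β x hα hβ).symm.trans ?_
    have h1 : (dlog (I := I) (fun _ : X => (1 : Circle)) x : E →L[ℝ] ℝ) = 0 := dlogForm_const 1 x
    rw [h1]
    exact (((congrArg (c'.u α β x + ·) ((sub_zero _).trans (sub_zero _)))).trans
      (add_zero (c'.u α β x))).symm
  · intro α x hα v w
    have h1 : OneForm.d (I := I) (M := X) (fun _ => (0 : E →L[ℝ] ℝ)) x v w = 0 :=
      (OneForm.d_eq_extD (E := E) (I := I) _ x v w).trans (extD_zero (E := E) x v w)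
    exact (h.K_eq α x hα v w).symm.trans ((congrArg (c'.K α x v w + ·) h1).trans
      (add_zero _)).symm

end Agree

/-! ### The connection and the curving of the lifting gerbe -/

section GerbeConnection

universe u

variable {EX : Type*} [NormedAddCommGroup EX] [NormedSpace ℝ EX]
  {X : Type u} [TopologicalSpace X] [ChartedSpace EX X]
  {EB : Type*} [NormedAddCommGroup EB] [NormedSpace ℝ EB]
  {B : Type*} [TopologicalSpace B] [ChartedSpace EB B]
  {Fh : Type*} [NormedAddCommGroup Fh] [NormedSpace ℝ Fh]
  {Γh : Type*} [Group Γh] [TopologicalSpace Γh] [ChartedSpace Fh Γh]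
  {F : Type*} [NormedAddCommGroup F] [NormedSpace ℝ F]
  {Γ : Type*} [Group Γ] [TopologicalSpace Γ] [ChartedSpace F Γ]
  [LieGroup 𝓘(ℝ, F) ∞ Γ] [LieGroup 𝓘(ℝ, Fh) ∞ Γh]
  {𝔼 : CentralExtension Fh Γh F Γ} {proj : B → X} {act : B → Γ → B}
  {θ : B → EB →L[ℝ] F} {σ : F →L[ℝ] Fh}
  {E : Type*} [NormedAddCommGroup E] [NormedSpace ℝ E]
  {H : Type*} [TopologicalSpace H] {I : ModelWithCorners ℝ E H}
  {M : Type*} [TopologicalSpace M] [ChartedSpace H M]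
  {E' : Type*} [NormedAddCommGroup E'] [NormedSpace ℝ E']
  {H' : Type*} [TopologicalSpace H'] {I' : ModelWithCorners ℝ E' H'}
  {N : Type*} [TopologicalSpace N] [ChartedSpace H' N]

theorem curv_pull [IsManifold I ∞ M] [IsManifold I' ∞ N] [I.Boundaryless] [I'.Boundaryless]
    {θ : N → E' →L[ℝ] Fh} {f : M → N} {x : M}
    (hθ : FormSmoothAt I' θ (f x)) (hf : ContMDiffAt I I' ∞ f x) (v w : E) :
    curv Γh I (pull I I' f θ) x v w =
      curv Γh I' θ (f x) (tder I I' f x v) (tder I I' f x w) := by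
  rw [curv, extD_pull hθ hf, curv]
  rfl

variable (I) in
/-- The lift `σ (b^* θ)` of the connection form along `b`. -/
def splitPull (θ : B → EB →L[ℝ] F) (σ : F →L[ℝ] Fh) (b : M → B) (x : M) : E →L[ℝ] Fh :=
  σ.comp (pull I 𝓘(ℝ, EB) b θ x)

theorem splitPull_congr {b b' : M → B} {x : M} (h : b =ᶠ[𝓝 x] b') :
    splitPull I θ σ b x = splitPull I θ σ b' x := by
  simp only [splitPull, pull_congr h]

theorem splitPull_const (b : B) (x : M) : splitPull I θ σ (fun _ : M => b) x = 0 := by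
  simp [splitPull, pull]

theorem formSmoothAt_splitPull [IsManifold I ∞ M] [I.Boundaryless] [IsManifold 𝓘(ℝ, EB) ∞ B]
    {b : M → B} {x : M} (hθ : FormSmoothAt 𝓘(ℝ, EB) θ (b x))
    (hb : ContMDiffAt I 𝓘(ℝ, EB) ∞ b x) : FormSmoothAt I (splitPull I θ σ b) x :=
  (hθ.pull hb).const_clm_comp σ

theorem dq_comp_splitPull (hσ : 𝔼.IsSplit σ) (b : M → B) (x : M) :
    𝔼.dq.comp (splitPull I θ σ b x) = pull I 𝓘(ℝ, EB) b θ x := by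
  ext v
  exact hσ _

theorem dq_comp_splitPull_act (hB : IsPrincipalBundle 𝓘(ℝ, F) 𝓘(ℝ, EB) 𝓘(ℝ, EX) proj act)
    (hθ : IsPrincipalConnection (IM := 𝓘(ℝ, EB)) act θ) (hσ : 𝔼.IsSplit σ)
    {b : M → B} {g : M → Γh} {x : M} (hb : MDifferentiableAt I 𝓘(ℝ, EB) b x)
    (hg : MDifferentiableAt I 𝓘(ℝ, Fh) g x) :
    𝔼.dq.comp (splitPull I θ σ (fun y => act (b y) (𝔼.q (g y))) x) =
      𝔼.dq.comp (gauge I (splitPull I θ σ b) g x) :=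
  𝔼.dq_comp_eq_dq_comp_gauge hB hθ hg hb (dq_comp_splitPull hσ _ _) (dq_comp_splitPull hσ _ _)
    (Filter.EventuallyEq.refl _ _)

/-- The pull-back of the gerbe connection under `(b, g)` is `(σ b^* θ) · g - σ (b · q g)^* θ`. -/
theorem pull_gerbeConnection (hB : IsPrincipalBundle 𝓘(ℝ, F) 𝓘(ℝ, EB) 𝓘(ℝ, EX) proj act)
    (hθ : IsPrincipalConnection (IM := 𝓘(ℝ, EB)) act θ)
    {f : M → B × Γh} {x : M} (hf : MDifferentiableAt I (𝓘(ℝ, EB).prod 𝓘(ℝ, Fh)) f x) :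
    pull I (𝓘(ℝ, EB).prod 𝓘(ℝ, Fh)) f (gerbeConnection 𝔼 θ σ) x =
      -𝔼.defect I (splitPull I θ σ fun y => (f y).1)
        (splitPull I θ σ fun y => act (f y).1 (𝔼.q (f y).2)) (fun y => (f y).2) x := by
  have hb : MDifferentiableAt I 𝓘(ℝ, EB) (fun y => (f y).1) x := mdifferentiableAt_fst.comp x hf
  have hg : MDifferentiableAt I 𝓘(ℝ, Fh) (fun y => (f y).2) x := mdifferentiableAt_snd.comp x hf
  have hqg : MDifferentiableAt I 𝓘(ℝ, F) (fun y => 𝔼.q (f y).2) x :=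
    (𝔼.mdifferentiable_q _).comp x hg
  have h1 := hθ.pull_act hB hb hqg
  have h2 : pull I 𝓘(ℝ, EB) (fun y => (f y).1) θ x = (θ (f x).1).comp
      ((tder (𝓘(ℝ, EB).prod 𝓘(ℝ, Fh)) 𝓘(ℝ, EB) Prod.fst (f x)).comp
        (tder I (𝓘(ℝ, EB).prod 𝓘(ℝ, Fh)) f x)) :=
    congrArg (θ (f x).1).comp (tder_comp (g := Prod.fst) mdifferentiableAt_fst hf)
  have h3 : (pullMC I (fun y => (f y).2) x : E →L[ℝ] Fh) = (mcForm Γh (f x).2).comp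
      ((tder (𝓘(ℝ, EB).prod 𝓘(ℝ, Fh)) 𝓘(ℝ, Fh) Prod.snd (f x)).comp
        (tder I (𝓘(ℝ, EB).prod 𝓘(ℝ, Fh)) f x)) :=
    congrArg (mcForm Γh (f x).2).comp (tder_comp (g := Prod.snd) mdifferentiableAt_snd hf)
  have h4 : (pullMC I (fun y => 𝔼.q (f y).2) x : E →L[ℝ] F) =
      (mcForm Γ (𝔼.q (f x).2)).comp ((tder 𝓘(ℝ, Fh) 𝓘(ℝ, F) 𝔼.q (f x).2).comp
        ((tder (𝓘(ℝ, EB).prod 𝓘(ℝ, Fh)) 𝓘(ℝ, Fh) Prod.snd (f x)).comp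
          (tder I (𝓘(ℝ, EB).prod 𝓘(ℝ, Fh)) f x))) := by
    refine congrArg (mcForm Γ (𝔼.q (f x).2)).comp ?_
    rw [tder_comp (g := 𝔼.q) (f := fun y => (f y).2) (𝔼.mdifferentiable_q _) hg,
      tder_comp (g := Prod.snd) mdifferentiableAt_snd hf]
  have hZ : 𝔼.groupCocycle σ (𝔼.q (f x).2)⁻¹ = 𝔼.scalarPart.comp
      ((Ad (f x).2⁻¹ : Fh →L[ℝ] Fh).comp σ - σ.comp (Ad (𝔼.q (f x).2)⁻¹)) := by
    rw [CentralExtension.groupCocycle, ← map_inv, 𝔼.adLift_q]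
  simp only [CentralExtension.defect, splitPull, h1, gauge, h2, h3, h4]
  ext v
  set w := tder I (𝓘(ℝ, EB).prod 𝓘(ℝ, Fh)) f x v with hw
  change 𝔼.scalarPart (mcForm Γh (f x).2
        (tder (𝓘(ℝ, EB).prod 𝓘(ℝ, Fh)) 𝓘(ℝ, Fh) Prod.snd (f x) w) -
      σ (mcForm Γ (𝔼.q (f x).2) (tder 𝓘(ℝ, Fh) 𝓘(ℝ, F) 𝔼.q (f x).2
        (tder (𝓘(ℝ, EB).prod 𝓘(ℝ, Fh)) 𝓘(ℝ, Fh) Prod.snd (f x) w)))) +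
    𝔼.groupCocycle σ (𝔼.q (f x).2)⁻¹ (θ (f x).1
      (tder (𝓘(ℝ, EB).prod 𝓘(ℝ, Fh)) 𝓘(ℝ, EB) Prod.fst (f x) w)) = _
  rw [hZ]
  simp only [ContinuousLinearMap.comp_apply, neg_apply, sub_apply, add_apply, map_add, map_sub,
    ← hw]
  ring

/-- The gerbe connection in terms of the two projections from `B × Γh`, i.e. from the total space
of the gerbe, to `B`. -/
theorem gerbeConnection_eq (hB : IsPrincipalBundle 𝓘(ℝ, F) 𝓘(ℝ, EB) 𝓘(ℝ, EX) proj act)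
    (hθ : IsPrincipalConnection (IM := 𝓘(ℝ, EB)) act θ) (p : B × Γh) :
    (gerbeConnection 𝔼 θ σ p : EB × Fh →L[ℝ] ℝ) =
      -𝔼.defect (𝓘(ℝ, EB).prod 𝓘(ℝ, Fh)) (splitPull (𝓘(ℝ, EB).prod 𝓘(ℝ, Fh)) θ σ Prod.fst)
        (splitPull (𝓘(ℝ, EB).prod 𝓘(ℝ, Fh)) θ σ fun p : B × Γh => act p.1 (𝔼.q p.2))
        Prod.snd p := by
  refine Eq.trans ?_ (pull_gerbeConnection (f := fun p => p) hB hθ mdifferentiableAt_id)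
  exact ((congrArg (gerbeConnection 𝔼 θ σ p : EB × Fh →L[ℝ] ℝ).comp (tder_id p)).trans
    (ContinuousLinearMap.comp_id _)).symm

theorem IsPrincipalConnection.formSmoothAt
    (hθ : IsPrincipalConnection (IM := 𝓘(ℝ, EB)) act θ) (b : B) : FormSmoothAt 𝓘(ℝ, EB) θ b :=
  hθ.smooth.formSmoothAt isOpen_univ (mem_univ b)

theorem IsPrincipalBundle.contMDiff_act_q
    (hB : IsPrincipalBundle 𝓘(ℝ, F) 𝓘(ℝ, EB) 𝓘(ℝ, EX) proj act) :
    ContMDiff (𝓘(ℝ, EB).prod 𝓘(ℝ, Fh)) 𝓘(ℝ, EB) ∞ (fun p : B × Γh => act p.1 (𝔼.q p.2)) :=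
  hB.smooth_act.comp (contMDiff_fst.prodMk (𝔼.isPrincipal.smooth_proj.comp contMDiff_snd))

/-- Smoothness of the defect which, by `gerbeConnection_eq`, is minus the gerbe connection. -/
theorem formSmoothAt_gerbeConnection [IsManifold 𝓘(ℝ, EB) ∞ B]
    (hB : IsPrincipalBundle 𝓘(ℝ, F) 𝓘(ℝ, EB) 𝓘(ℝ, EX) proj act)
    (hθ : IsPrincipalConnection (IM := 𝓘(ℝ, EB)) act θ) (p : B × Γh) :
    FormSmoothAt (𝓘(ℝ, EB).prod 𝓘(ℝ, Fh)) (𝔼.defect (𝓘(ℝ, EB).prod 𝓘(ℝ, Fh))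
      (splitPull (𝓘(ℝ, EB).prod 𝓘(ℝ, Fh)) θ σ Prod.fst)
      (splitPull (𝓘(ℝ, EB).prod 𝓘(ℝ, Fh)) θ σ fun p : B × Γh => act p.1 (𝔼.q p.2)) Prod.snd) p :=
  𝔼.formSmoothAt_defect (formSmoothAt_splitPull (hθ.formSmoothAt _) contMDiffAt_fst)
    (formSmoothAt_splitPull (hθ.formSmoothAt _) (hB.contMDiff_act_q _)) contMDiffAt_snd

theorem isCircleConnection_gerbeConnection [IsManifold 𝓘(ℝ, EB) ∞ B]
    (hB : IsPrincipalBundle 𝓘(ℝ, F) 𝓘(ℝ, EB) 𝓘(ℝ, EX) proj act)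
    (hθ : IsPrincipalConnection (IM := 𝓘(ℝ, EB)) act θ) :
    IsCircleConnection (𝓘(ℝ, EB).prod 𝓘(ℝ, Fh)) (liftingGerbe 𝔼 hB).act
      (gerbeConnection 𝔼 θ σ) where
  smooth := by
    refine FormSmoothAt.oneForm_smoothOn fun p _ => ?_
    refine ((formSmoothAt_gerbeConnection (𝔼 := 𝔼) (σ := σ) hB hθ p).const_clm_comp
      (-ContinuousLinearMap.id ℝ ℝ)).congr (Filter.Eventually.of_forall fun p => ?_)
    refine (gerbeConnection_eq hB hθ p).trans ?_
    ext v
    rfl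
  vertical := by
    rintro ⟨b, g⟩
    have hg : MDifferentiableAt 𝓘(ℝ, ℝ) 𝓘(ℝ, Fh) (fun t : ℝ => 𝔼.incl (Circle.exp t)) 0 :=
      (𝔼.contMDiff_incl_exp 0).mdifferentiableAt (by simp)
    have hf : MDifferentiableAt 𝓘(ℝ, ℝ) (𝓘(ℝ, EB).prod 𝓘(ℝ, Fh))
        (fun t : ℝ => (b, g * 𝔼.incl (Circle.exp t))) 0 :=
      mdifferentiableAt_const.prodMk ((mdifferentiableAt_const (c := g)).lieGroup_mul hg)
    have h := pull_gerbeConnection (𝔼 := 𝔼) (σ := σ) hB hθ hf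
    -- along a fibre the point of `B` is constant, and only the Maurer-Cartan term contributes
    have h1 : 𝔼.defect 𝓘(ℝ, ℝ) (splitPull 𝓘(ℝ, ℝ) θ σ fun _ : ℝ => b)
        (splitPull 𝓘(ℝ, ℝ) θ σ fun t : ℝ => act b (𝔼.q (g * 𝔼.incl (Circle.exp t))))
        (fun t => g * 𝔼.incl (Circle.exp t)) 0 = -ContinuousLinearMap.id ℝ ℝ := by
      simp only [map_mul, 𝔼.q_incl, CentralExtension.defect, gauge, splitPull_const,
        ContinuousLinearMap.comp_zero, zero_add, zero_sub, pullMC_const_mul hg]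
      rw [pullMC_eq_of_eq_one hg (by simp)]
      ext
      exact (map_neg 𝔼.scalarPart _).trans (congrArg (- ·) (𝔼.scalarPart_dincl 1))
    rw [h1] at h
    have h2 := congrArg (fun T : ℝ →L[ℝ] ℝ => T 1) h
    exact h2.trans (by simp)
  invariant := by
    rintro z ⟨b, g⟩
    have hm : MDifferentiableAt (𝓘(ℝ, EB).prod 𝓘(ℝ, Fh)) 𝓘(ℝ, Fh)
        (fun p : B × Γh => p.2 * 𝔼.incl z) (b, g) :=
      mdifferentiableAt_snd.lieGroup_mul mdifferentiableAt_const
    have hf : MDifferentiableAt (𝓘(ℝ, EB).prod 𝓘(ℝ, Fh)) (𝓘(ℝ, EB).prod 𝓘(ℝ, Fh))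
        (fun p : B × Γh => (p.1, p.2 * 𝔼.incl z)) (b, g) := mdifferentiableAt_fst.prodMk hm
    have h := pull_gerbeConnection (𝔼 := 𝔼) (σ := σ) hB hθ hf
    refine h.trans (Eq.trans ?_ (gerbeConnection_eq hB hθ (b, g)).symm)
    simp only [map_mul, 𝔼.q_incl, mul_one]
    rw [𝔼.defect_mul_incl (z := fun _ => z) mdifferentiableAt_snd contMDiffAt_const,
      dlogForm_const, sub_zero]

/-- The forms `∇_{θ,σ}` are a bundle gerbe connection. -/
theorem isConnection_gerbeConnection [IsManifold 𝓘(ℝ, EB) ∞ B]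
    (hB : IsPrincipalBundle 𝓘(ℝ, F) 𝓘(ℝ, EB) 𝓘(ℝ, EX) proj act)
    (hθ : IsPrincipalConnection (IM := 𝓘(ℝ, EB)) act θ) (hσ : 𝔼.IsSplit σ) :
    (liftingGerbe 𝔼 hB).IsConnection (gerbeConnection 𝔼 θ σ) where
  isCircleConnection := isCircleConnection_gerbeConnection hB hθ
  mul_compatible p p' hp hp' hpp' t := by
    have hpt := (hp t).mdifferentiableAt (by simp)
    have hpt' := (hp' t).mdifferentiableAt (by simp)
    have hb : MDifferentiableAt 𝓘(ℝ, ℝ) 𝓘(ℝ, EB) (fun t => (p t).1) t :=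
      mdifferentiableAt_fst.comp t hpt
    have hg : MDifferentiableAt 𝓘(ℝ, ℝ) 𝓘(ℝ, Fh) (fun t => (p t).2) t :=
      mdifferentiableAt_snd.comp t hpt
    have hg' : MDifferentiableAt 𝓘(ℝ, ℝ) 𝓘(ℝ, Fh) (fun t => (p' t).2) t :=
      mdifferentiableAt_snd.comp t hpt'
    have hb' : (fun t => (p' t).1) = fun t => act (p t).1 (𝔼.q (p t).2) :=
      funext fun t => (hpp' t).symm
    have hbt' : ∀ t, (p' t).1 = act (p t).1 (𝔼.q (p t).2) := fun t => (hpp' t).symm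
    have h1 := pull_gerbeConnection (𝔼 := 𝔼) (σ := σ) hB hθ hpt
    have h2 := pull_gerbeConnection (𝔼 := 𝔼) (σ := σ) hB hθ hpt'
    have h3 := pull_gerbeConnection (𝔼 := 𝔼) (σ := σ) hB hθ (hb.prodMk (hg.lieGroup_mul hg'))
    have h4 := CentralExtension.defect_mul (𝔼 := 𝔼)
      (θ₃ := splitPull 𝓘(ℝ, ℝ) θ σ fun t => act (p t).1 (𝔼.q ((p t).2 * (p' t).2))) hg hg'
      (dq_comp_splitPull_act hB hθ hσ hb hg)
    have h5 : (fun t => act (p' t).1 (𝔼.q (p' t).2)) =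
        fun t => act (p t).1 (𝔼.q ((p t).2 * (p' t).2)) := by
      funext t
      rw [hbt' t, map_mul, hB.act_mul]
    rw [h5, hb'] at h2
    refine (congrArg₂ (· + ·) h1 h2).trans (Eq.trans ?_ h3.symm)
    exact (neg_add_rev _ _).symm.trans (congrArg (- ·) h4.symm)

/-- The curving is `-L(b, dθh + [θh, θh]/2)` for the lift `θh = σ θ` of the connection form. -/
theorem gerbeCurving_eq [IsManifold 𝓘(ℝ, EB) ∞ B]
    (hθ : IsPrincipalConnection (IM := 𝓘(ℝ, EB)) act θ) (𝓛 : Splitting EB 𝔼 act)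
    (hσ : 𝔼.IsSplit σ) (b : B) (v w : EB) :
    gerbeCurving 𝔼 θ 𝓛 σ b v w = -𝓛.L b (curv Γh 𝓘(ℝ, EB) (fun b => σ.comp (θ b)) b v w) := by
  have h1 : gerbeCurving 𝔼 θ 𝓛 σ b v w =
      -𝔼.scalarPart (bracketL Γh (σ (θ b v)) (σ (θ b w)) - σ (bracketL Γ (θ b v) (θ b w))) -
        𝓛.L b (σ (curv Γ 𝓘(ℝ, EB) θ b v w)) := by
    refine congrArg₂ (fun a c => -𝔼.scalarPart a - 𝓛.L b (σ c)) ?_ (curvature_eq_curv θ b v w)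
    exact (congrArg₂ (fun a c => a - σ c) (bracketL_apply (G := Γh) (σ (θ b v)) (σ (θ b w)))
      (bracketL_apply (G := Γ) (θ b v) (θ b w))).symm
  -- `[σ v, σ w] - σ [v, w]` is central, so that `L` evaluates it
  have h2 : 𝔼.dq (bracketL Γh (σ (θ b v)) (σ (θ b w)) - σ (bracketL Γ (θ b v) (θ b w))) = 0 := by
    rw [map_sub, 𝔼.dq_bracketL, hσ, hσ, hσ, sub_self]
  rw [h1, ← 𝓛.L_eq_scalarPart b h2, curv, curv, extD_const_clm_comp (hθ.formSmoothAt b)]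
  simp only [map_add, map_sub, ContinuousLinearMap.comp_apply]
  ring

/-- The forms `f_{θ,σ}` are a curving of the bundle gerbe connection. -/
theorem isCurving_gerbeCurving [IsManifold 𝓘(ℝ, EB) ∞ B]
    (hB : IsPrincipalBundle 𝓘(ℝ, F) 𝓘(ℝ, EB) 𝓘(ℝ, EX) proj act)
    (hθ : IsPrincipalConnection (IM := 𝓘(ℝ, EB)) act θ) (𝓛 : Splitting EB 𝔼 act)
    (hσ : 𝔼.IsSplit σ) :
    (liftingGerbe 𝔼 hB).IsCurving (gerbeConnection 𝔼 θ σ) (gerbeCurving 𝔼 θ 𝓛 σ) where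
  smooth := by
    have h := 𝓛.smoothOn_L_curv (I := 𝓘(ℝ, EB)) (s := fun b => b) (U := univ)
      (θ := fun b => σ.comp (θ b)) contMDiffOn_id isOpen_univ
      fun b _ => (hθ.formSmoothAt b).const_clm_comp σ
    refine ⟨fun b hb v => (gerbeCurving_eq hθ 𝓛 hσ b v v).trans
      ((congrArg (- ·) (h.1 b hb v)).trans neg_zero), fun b₀ => ?_⟩
    obtain ⟨G, hG, hGe⟩ := h.2 b₀
    exact ⟨fun e => -G e, hG.neg, fun e he v w => (gerbeCurving_eq hθ 𝓛 hσ _ _ _).trans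
      (congrArg (- ·) (hGe e he v w))⟩
  d_eq := by
    intro p v w
    have h1 : OneForm.d (gerbeConnection 𝔼 θ σ) p v w = _ :=
      OneForm.d_eq_extD (E := EB × Fh) (I := 𝓘(ℝ, EB).prod 𝓘(ℝ, Fh)) _ p v w
    have h2 : gerbeConnection 𝔼 θ σ =ᶠ[𝓝 p] fun p => (-ContinuousLinearMap.id ℝ ℝ).comp
        (𝔼.defect (𝓘(ℝ, EB).prod 𝓘(ℝ, Fh)) (splitPull (𝓘(ℝ, EB).prod 𝓘(ℝ, Fh)) θ σ Prod.fst)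
        (splitPull (𝓘(ℝ, EB).prod 𝓘(ℝ, Fh)) θ σ fun p : B × Γh => act p.1 (𝔼.q p.2))
        Prod.snd p) :=
      Filter.Eventually.of_forall fun p => (gerbeConnection_eq hB hθ p).trans (by ext v; rfl)
    have hfst : ContMDiffAt (𝓘(ℝ, EB).prod 𝓘(ℝ, Fh)) 𝓘(ℝ, EB) ∞
      (Prod.fst : B × Γh → B) p := contMDiffAt_fst
    have hact : ContMDiffAt (𝓘(ℝ, EB).prod 𝓘(ℝ, Fh)) 𝓘(ℝ, EB) ∞
      (fun p : B × Γh => act p.1 (𝔼.q p.2)) p := hB.contMDiff_act_q p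
    have hσθ : ∀ b, FormSmoothAt 𝓘(ℝ, EB) (fun b => σ.comp (θ b)) b := fun b =>
      (hθ.formSmoothAt b).const_clm_comp σ
    have h3 := 𝓛.L_curv_sub (θ := splitPull (𝓘(ℝ, EB).prod 𝓘(ℝ, Fh)) θ σ Prod.fst)
      (θ' := splitPull (𝓘(ℝ, EB).prod 𝓘(ℝ, Fh)) θ σ fun p : B × Γh => act p.1 (𝔼.q p.2))
      (g := Prod.snd)
      (formSmoothAt_splitPull (hθ.formSmoothAt _) hfst)
      (formSmoothAt_splitPull (hθ.formSmoothAt _) hact) contMDiffAt_snd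
      (Filter.Eventually.of_forall fun p =>
        dq_comp_splitPull_act hB hθ hσ mdifferentiableAt_fst mdifferentiableAt_snd) p.1 v w
    have h4 := curv_pull (Γh := Γh) (hσθ _) hfst v w
    have h5 := curv_pull (Γh := Γh) (hσθ _) hact v w
    refine h1.trans ((extD_congr h2 v w).trans ?_)
    refine (extD_const_clm_comp (formSmoothAt_gerbeConnection hB hθ p) _ v w).trans ?_
    refine (congrArg (-ContinuousLinearMap.id ℝ ℝ) h3.symm).trans ?_
    refine Eq.trans ?_ (congrArg₂ (fun a b : ℝ => -a + b)
      ((gerbeCurving_eq hθ 𝓛 hσ p.1 _ _).trans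
        (congrArg (fun u => -𝓛.L p.1 u) h4.symm)).symm
      ((gerbeCurving_eq hθ 𝓛 hσ (act p.1 (𝔼.q p.2)) _ _).trans
        (congrArg (fun u => -𝓛.L _ u) h5.symm)).symm)
    have hring : ∀ a c : ℝ, (-ContinuousLinearMap.id ℝ ℝ) (a - c) = - -c + -a := fun a c => by
      simp [sub_eq_add_neg]
    exact hring _ _

end GerbeConnection

/-! ### The choices for the two classes as lifted data -/

section Comparison

universe u

variable {E : Type*} [NormedAddCommGroup E] [NormedSpace ℝ E]
  {X : Type u} [TopologicalSpace X] [ChartedSpace E X]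
  {EB : Type*} [NormedAddCommGroup EB] [NormedSpace ℝ EB]
  {B : Type*} [TopologicalSpace B] [ChartedSpace EB B]
  {Fh : Type*} [NormedAddCommGroup Fh] [NormedSpace ℝ Fh]
  {Γh : Type*} [Group Γh] [TopologicalSpace Γh] [ChartedSpace Fh Γh]
  {F : Type*} [NormedAddCommGroup F] [NormedSpace ℝ F]
  {Γ : Type*} [Group Γ] [TopologicalSpace Γ] [ChartedSpace F Γ]
  [LieGroup 𝓘(ℝ, F) ∞ Γ] [LieGroup 𝓘(ℝ, Fh) ∞ Γh]
  {𝔼 : CentralExtension Fh Γh F Γ} {proj : B → X} {act : B → Γ → B}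
  {θ : B → EB →L[ℝ] F} {σ : F →L[ℝ] Fh} {𝔘 : Cover X}

/-- `translation` is defined by choice, and uniqueness determines its value. -/
theorem translation_eq {P G : Type*} [Group G] {act : P → G → P} {p p' : P} {g : G}
    (h : act p g = p') (hinj : ∀ g', act p g' = p' → g' = g) : translation act p p' = g := by
  have h' : ∃ g, act p g = p' := ⟨g, h⟩
  rw [translation, dif_pos h']
  exact hinj _ h'.choose_spec

/-- The choices for the obstruction class, as lifted data. -/
def ObstructionData.toLiftData [IsManifold 𝓘(ℝ, E) ∞ X]
    (O : ObstructionData E 𝔼 proj act θ 𝔘) : LiftData E 𝔼 proj act θ 𝔘 where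
  s := O.s
  smooth_s := O.smooth_s
  proj_s := O.proj_s
  g := O.g
  smooth_g := O.smooth_g
  act_g := O.act_g
  θh := O.θh
  smooth_θh α _ hx := (O.smooth_θh α).formSmoothAt (𝔘.U α).isOpen hx
  dq_θh := O.dq_θh

theorem ObstructionData.cochain_agree [IsManifold 𝓘(ℝ, E) ∞ X]
    (hB : IsPrincipalBundle 𝓘(ℝ, F) 𝓘(ℝ, EB) 𝓘(ℝ, E) proj act)
    (O : ObstructionData E 𝔼 proj act θ 𝔘) (𝓛 : Splitting EB 𝔼 act) :
    (O.cochain 𝓛).Agree 𝓘(ℝ, E) 𝔘 (O.toLiftData.cochain 𝓛) where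
  z_eq α β γ x hα hβ hγ := by
    have h := O.toLiftData.g_mul hB 𝓛 hα hβ hγ
    change 𝔼.circlePart (O.g α β x * O.g β γ x * O.g γ α x) = _
    change O.g α β x * O.g β γ x = O.g α γ x * _ at h
    rw [h, O.g_inv α γ x hα hγ, ← 𝔼.central, mul_inv_cancel_right, 𝔼.circlePart_incl]
  u_eq _ _ _ _ _ := rfl
  K_eq α x _ v w := congrArg (𝓛.L (O.s α x)) (curvature_eq_curv (O.θh α) x v w)

variable {hB : IsPrincipalBundle 𝓘(ℝ, F) 𝓘(ℝ, EB) 𝓘(ℝ, E) proj act}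

theorem localData_fst (D : (liftingGerbe 𝔼 hB).LocalData 𝔘) {α β : 𝔘.ι} {x : X}
    (hα : x ∈ 𝔘.U α) (hβ : x ∈ 𝔘.U β) : (D.σ α β x).1 = D.s α x :=
  D.pr₁_σ α β x hα hβ

theorem localData_act (D : (liftingGerbe 𝔼 hB).LocalData 𝔘) {α β : 𝔘.ι} {x : X}
    (hα : x ∈ 𝔘.U α) (hβ : x ∈ 𝔘.U β) : act (D.s α x) (𝔼.q (D.σ α β x).2) = D.s β x := by
  rw [← localData_fst D hα hβ]
  exact D.pr₂_σ α β x hα hβ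

/-- The choices for the class of the lifting gerbe, as lifted data: a section of `J_B` over
`(s_α, s_β)` is a lift of the transition function, and the split `σ` lifts the connection forms. -/
def liftDataOfLocalData [IsManifold 𝓘(ℝ, E) ∞ X] [IsManifold 𝓘(ℝ, EB) ∞ B]
    (hθ : IsPrincipalConnection (IM := 𝓘(ℝ, EB)) act θ) (hσ : 𝔼.IsSplit σ)
    (D : (liftingGerbe 𝔼 hB).LocalData 𝔘) : LiftData E 𝔼 proj act θ 𝔘 where
  s := D.s
  smooth_s := D.smooth_s
  proj_s := D.π_s
  g α β x := (D.σ α β x).2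
  smooth_g α β := contMDiff_snd.comp_contMDiffOn (D.smooth_σ α β)
  act_g _ _ _ hα hβ := localData_act D hα hβ
  θh α := splitPull 𝓘(ℝ, E) θ σ (D.s α)
  smooth_θh α _ hx := formSmoothAt_splitPull (hθ.formSmoothAt _)
    ((D.smooth_s α).contMDiffAt ((𝔘.U α).isOpen.mem_nhds hx))
  dq_θh _ x _ := dq_comp_splitPull hσ _ x

theorem localData_cochain_agree [IsManifold 𝓘(ℝ, E) ∞ X] [IsManifold 𝓘(ℝ, EB) ∞ B]
    (hθ : IsPrincipalConnection (IM := 𝓘(ℝ, EB)) act θ) (𝓛 : Splitting EB 𝔼 act)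
    (hσ : 𝔼.IsSplit σ) (D : (liftingGerbe 𝔼 hB).LocalData 𝔘) :
    (D.cochain (gerbeConnection 𝔼 θ σ) (gerbeCurving 𝔼 θ 𝓛 σ)).Agree 𝓘(ℝ, E) 𝔘
      ((liftDataOfLocalData hθ hσ D).cochain 𝓛) where
  z_eq α β γ x hα hβ hγ := by
    have h : (D.σ α β x).2 * (D.σ β γ x).2 = (D.σ α γ x).2 * _ :=
      (liftDataOfLocalData hθ hσ D).g_mul hB 𝓛 hα hβ hγ
    change translation (fun (p : B × Γh) (z : Circle) => (p.1, p.2 * 𝔼.incl z)) (D.σ α γ x)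
      ((D.σ α β x).1, (D.σ α β x).2 * (D.σ β γ x).2) = _
    refine translation_eq (Prod.ext ?_ h.symm) fun z hz => ?_
    · exact (localData_fst D hα hγ).trans (localData_fst D hα hβ).symm
    · have h' : (D.σ α γ x).2 * 𝔼.incl z = (D.σ α β x).2 * (D.σ β γ x).2 := congrArg Prod.snd hz
      exact 𝔼.incl_injective (mul_left_cancel (h'.trans h))
  u_eq α β x hα hβ := by
    have hx := LiftData.mem_nhds_inter hα hβ
    have hf : MDifferentiableAt 𝓘(ℝ, E) (𝓘(ℝ, EB).prod 𝓘(ℝ, Fh)) (D.σ α β) x :=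
      ((D.smooth_σ α β).contMDiffAt hx).mdifferentiableAt (by simp)
    have h1 := pull_gerbeConnection (𝔼 := 𝔼) (σ := σ) hB hθ hf
    have h2 : (fun y => (D.σ α β y).1) =ᶠ[𝓝 x] D.s α := by
      filter_upwards [hx] with y hy using localData_fst D hy.1 hy.2
    have h3 : (fun y => act (D.σ α β y).1 (𝔼.q (D.σ α β y).2)) =ᶠ[𝓝 x] D.s β := by
      filter_upwards [hx] with y hy using D.pr₂_σ α β y hy.1 hy.2
    refine (congrArg (- ·) h1).trans ((neg_neg _).trans ?_)
    refine congrArg 𝔼.scalarPart.comp ?_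
    rw [splitPull_congr h3, gauge_congr (splitPull_congr h2) (Filter.EventuallyEq.refl _ _)]
    rfl
  K_eq α x hx v w := by
    have hs : ContMDiffAt 𝓘(ℝ, E) 𝓘(ℝ, EB) ∞ (D.s α) x :=
      (D.smooth_s α).contMDiffAt ((𝔘.U α).isOpen.mem_nhds hx)
    have h1 := curv_pull (E := E) (Γh := Γh)
      ((hθ.formSmoothAt (D.s α x)).const_clm_comp σ) hs v w
    exact (congrArg (- ·) (gerbeCurving_eq hθ 𝓛 hσ (D.s α x) _ _)).trans
      ((neg_neg _).trans (congrArg (𝓛.L (D.s α x)) h1.symm))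

/-- For given sections and lifts of the transition functions, the obstruction data with connection
forms `σ (s_α^* θ)`. -/
def ObstructionData.withSplit [IsManifold 𝓘(ℝ, E) ∞ X] [IsManifold 𝓘(ℝ, EB) ∞ B]
    (O : ObstructionData E 𝔼 proj act θ 𝔘)
    (hθ : IsPrincipalConnection (IM := 𝓘(ℝ, EB)) act θ) (hσ : 𝔼.IsSplit σ) :
    ObstructionData E 𝔼 proj act θ 𝔘 where
  s := O.s
  smooth_s := O.smooth_s
  proj_s := O.proj_s
  g := O.g
  smooth_g := O.smooth_g
  act_g := O.act_g
  g_inv := O.g_inv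
  θh α := splitPull 𝓘(ℝ, E) θ σ (O.s α)
  smooth_θh α := FormSmoothAt.oneForm_smoothOn fun _ hx =>
    formSmoothAt_splitPull (hθ.formSmoothAt _)
      ((O.smooth_s α).contMDiffAt ((𝔘.U α).isOpen.mem_nhds hx))
  dq_θh α _ _ := dq_comp_splitPull (E := E) hσ (O.s α) _

variable (hB) in
/-- The local data `(s_α, g_αβ)` of the lifting gerbe given by obstruction data. -/
def ObstructionData.toLocalData (O : ObstructionData E 𝔼 proj act θ 𝔘) :
    (liftingGerbe 𝔼 hB).LocalData 𝔘 where
  s := O.s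
  smooth_s := O.smooth_s
  π_s := O.proj_s
  σ α β x := (O.s α x, O.g α β x)
  smooth_σ α β := ((O.smooth_s α).mono inter_subset_left).prodMk (O.smooth_g α β)
  pr₁_σ _ _ _ _ _ := rfl
  pr₂_σ := O.act_g

theorem ObstructionData.toLocalData_cochain_agree [IsManifold 𝓘(ℝ, E) ∞ X]
    [IsManifold 𝓘(ℝ, EB) ∞ B] (hθ : IsPrincipalConnection (IM := 𝓘(ℝ, EB)) act θ)
    (𝓛 : Splitting EB 𝔼 act) (hσ : 𝔼.IsSplit σ) (O : ObstructionData E 𝔼 proj act θ 𝔘) :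
    ((O.toLocalData hB).cochain (gerbeConnection 𝔼 θ σ) (gerbeCurving 𝔼 θ 𝓛 σ)).Agree 𝓘(ℝ, E) 𝔘
      ((O.withSplit hθ hσ).cochain 𝓛) := by
  have h : liftDataOfLocalData hθ hσ (O.toLocalData hB) = (O.withSplit hθ hσ).toLiftData := rfl
  have h' := localData_cochain_agree hθ 𝓛 hσ (O.toLocalData hB)
  rw [h] at h'
  exact h'.trans ((O.withSplit hθ hσ).cochain_agree hB 𝓛).symm

/-- The class of any lifted data is the class of the lifting gerbe, if local data of the gerbe
exist. -/
theorem LiftData.isDeligneClass [IsManifold 𝓘(ℝ, E) ∞ X] [IsManifold 𝓘(ℝ, EB) ∞ B]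
    (hθ : IsPrincipalConnection (IM := 𝓘(ℝ, EB)) act θ) (𝓛 : Splitting EB 𝔼 act)
    (hσ : 𝔼.IsSplit σ) (D : LiftData E 𝔼 proj act θ 𝔘)
    (hex : ∃ 𝔙 : Cover X, Nonempty ((liftingGerbe 𝔼 hB).LocalData 𝔙)) :
    (liftingGerbe 𝔼 hB).IsDeligneClass (gerbeConnection 𝔼 θ σ) (gerbeCurving 𝔼 θ 𝓛 σ)
      (deligneClass 𝓘(ℝ, E) 𝔘 (D.cochain 𝓛) (D.isCocycle hB hθ 𝓛)) where
  exists_data := hex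
  represents 𝔙 D' := by
    have h := localData_cochain_agree hθ 𝓛 hσ D'
    have hc := (liftDataOfLocalData hθ hσ D').isCocycle hB hθ 𝓛
    exact ⟨hc.of_agree h, (deligneClass_eq_of_agree hc (hc.of_agree h) h).trans
      (LiftData.class_eq hB hθ 𝓛 _ _)⟩

/-- The class of any lifted data is the obstruction class, if obstruction data exist. -/
theorem LiftData.isObstructionClass [IsManifold 𝓘(ℝ, E) ∞ X]
    (hB : IsPrincipalBundle 𝓘(ℝ, F) 𝓘(ℝ, EB) 𝓘(ℝ, E) proj act)
    (hθ : IsPrincipalConnection (IM := 𝓘(ℝ, EB)) act θ) (𝓛 : Splitting EB 𝔼 act)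
    (D : LiftData E 𝔼 proj act θ 𝔘)
    (hex : ∃ 𝔙 : Cover X, Nonempty (ObstructionData E 𝔼 proj act θ 𝔙)) :
    IsObstructionClass 𝔼 proj act θ 𝓛
      (deligneClass 𝓘(ℝ, E) 𝔘 (D.cochain 𝓛) (D.isCocycle hB hθ 𝓛)) where
  exists_data := hex
  represents 𝔙 O := by
    have h := O.cochain_agree hB 𝓛
    have hc := O.toLiftData.isCocycle hB hθ 𝓛
    exact ⟨hc.of_agree h, (deligneClass_eq_of_agree hc (hc.of_agree h) h).trans
      (LiftData.class_eq hB hθ 𝓛 _ _)⟩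

end Comparison

/-! ### Existence of the choices -/

section Existence

universe u

variable {E : Type*} [NormedAddCommGroup E] [NormedSpace ℝ E]
  {X : Type u} [TopologicalSpace X] [ChartedSpace E X]
  {EB : Type*} [NormedAddCommGroup EB] [NormedSpace ℝ EB]
  {B : Type*} [TopologicalSpace B] [ChartedSpace EB B]
  {Fh : Type*} [NormedAddCommGroup Fh] [NormedSpace ℝ Fh]
  {Γh : Type*} [Group Γh] [TopologicalSpace Γh] [ChartedSpace Fh Γh]
  {F : Type*} [NormedAddCommGroup F] [NormedSpace ℝ F]
  {Γ : Type*} [Group Γ] [TopologicalSpace Γ] [ChartedSpace F Γ]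
  [LieGroup 𝓘(ℝ, F) ∞ Γ] [LieGroup 𝓘(ℝ, Fh) ∞ Γh]
  {𝔼 : CentralExtension Fh Γh F Γ} {proj : B → X} {act : B → Γ → B}
  {θ : B → EB →L[ℝ] F} {σ : F →L[ℝ] Fh}

variable (𝔼) in
/-- On `W`, the section `s'` is `s · q r` for a smooth function `r` to `Γh`. -/
def LiftableOn (act : B → Γ → B) (s s' : X → B) (W : Set X) : Prop :=
  ∃ r : X → Γh, ContMDiffOn 𝓘(ℝ, E) 𝓘(ℝ, Fh) ∞ r W ∧ ∀ y ∈ W, act (s y) (𝔼.q (r y)) = s' y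

theorem LiftableOn.mono {s s' : X → B} {W W' : Set X}
    (h : LiftableOn (E := E) 𝔼 act s s' W) (hW : W' ⊆ W) :
    LiftableOn (E := E) 𝔼 act s s' W' := by
  obtain ⟨r, hr, hrs⟩ := h
  exact ⟨r, hr.mono hW, fun y hy => hrs y (hW hy)⟩

theorem exists_liftableOn (hB : IsPrincipalBundle 𝓘(ℝ, F) 𝓘(ℝ, EB) 𝓘(ℝ, E) proj act)
    {U : Set X} (hU : IsOpen U) {s s' : X → B} (hs : ContMDiffOn 𝓘(ℝ, E) 𝓘(ℝ, EB) ∞ s U)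
    (hs' : ContMDiffOn 𝓘(ℝ, E) 𝓘(ℝ, EB) ∞ s' U) (hps : ∀ x ∈ U, proj (s x) = x)
    (hps' : ∀ x ∈ U, proj (s' x) = x) {x : X} (hx : x ∈ U) :
    ∃ W ∈ 𝓝 x, LiftableOn (E := E) 𝔼 act s s' W := by
  obtain ⟨V, γ, hV, hxV, -, hγ, hact⟩ := hB.exists_local_transition hU hs hs' hps hps' hx
  obtain ⟨W, r, hW, hxW, hWV, hr, hq⟩ := 𝔼.exists_local_lift hV hγ hxV
  exact ⟨W, hW.mem_nhds hxW, r, hr, fun y hy => by rw [hq y hy, hact y (hWV hy)]⟩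

/-- On a paracompact manifold there is a cover with sections whose transition functions lift on all
overlaps.  A locally finite cover by domains `U_β` of sections is shrunk to sets `V_β` with closure
in `U_β`, and the small neighbourhoods `W_x` are chosen so that `W_x` lies in some `V_α`, meets only
those `V_β` with `x ∈ U_β`, and carries lifts of the finitely many transition functions between
sections defined at `x`. -/
theorem exists_cover_liftableOn [T2Space X] [ParacompactSpace X]
    (hB : IsPrincipalBundle 𝓘(ℝ, F) 𝓘(ℝ, EB) 𝓘(ℝ, E) proj act) :
    ∃ (𝔘 : Cover X) (s : 𝔘.ι → X → B),
      (∀ α, ContMDiffOn 𝓘(ℝ, E) 𝓘(ℝ, EB) ∞ (s α) (𝔘.U α : Set X)) ∧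
      (∀ α, ∀ x ∈ 𝔘.U α, proj (s α x) = x) ∧
      ∀ α β, LiftableOn (E := E) 𝔼 act (s α) (s β) (𝔘.U α ∩ 𝔘.U β : Set X) := by
  choose U₀ s t hU₀ hxU₀ hs₀ _ hps₀ _ _ using hB.locally_trivial
  obtain ⟨U, hU, hUcov, hUfin, hUU₀⟩ := precise_refinement U₀ hU₀
    (iUnion_eq_univ_iff.2 fun x => ⟨x, hxU₀ x⟩)
  obtain ⟨V, hVcov, hV, hVU⟩ := exists_iUnion_eq_closure_subset hU hUfin.point_finite hUcov
  have hs : ∀ α, ContMDiffOn 𝓘(ℝ, E) 𝓘(ℝ, EB) ∞ (s α) (U α) := fun α => (hs₀ α).mono (hUU₀ α)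
  have hps : ∀ α, ∀ y ∈ U α, proj (s α y) = y := fun α y hy => hps₀ α y (hUU₀ α hy)
  have hVfin : LocallyFinite fun α => closure (V α) := hUfin.subset hVU
  choose a ha using fun x => iUnion_eq_univ_iff.1 hVcov x
  have key : ∀ x, ∃ W : Set X, IsOpen W ∧ x ∈ W ∧ W ⊆ V (a x) ∧
      (∀ β, (W ∩ V β).Nonempty → x ∈ U β) ∧
      ∀ β γ, x ∈ U β → x ∈ U γ → LiftableOn (E := E) 𝔼 act (s β) (s γ) W := by
    intro x
    have hlift : ∀ β γ, ∃ W ∈ 𝓝 x, x ∈ U β → x ∈ U γ →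
        LiftableOn (E := E) 𝔼 act (s β) (s γ) W := by
      intro β γ
      by_cases h : x ∈ U β ∩ U γ
      · obtain ⟨W, hW, hl⟩ := exists_liftableOn (𝔼 := 𝔼) hB ((hU β).inter (hU γ))
          ((hs β).mono inter_subset_left) ((hs γ).mono inter_subset_right)
          (fun y hy => hps β y hy.1) (fun y hy => hps γ y hy.2) h
        exact ⟨W, hW, fun _ _ => hl⟩
      · exact ⟨univ, Filter.univ_mem, fun hβ hγ => (h ⟨hβ, hγ⟩).elim⟩
    choose N hN hNl using hlift
    have hfin := hUfin.point_finite x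
    have h1 : ⋂ β ∈ {β | x ∈ U β}, ⋂ γ ∈ {γ | x ∈ U γ}, N β γ ∈ 𝓝 x :=
      (Filter.biInter_mem hfin).2 fun β _ => (Filter.biInter_mem hfin).2 fun γ _ => hN β γ
    have h2 := hVfin.iInter_compl_mem_nhds (fun _ => isClosed_closure) x
    obtain ⟨W, hWsub, hW, hxW⟩ := mem_nhds_iff.1
      (Filter.inter_mem ((hV (a x)).mem_nhds (ha x)) (Filter.inter_mem h1 h2))
    refine ⟨W, hW, hxW, fun y hy => (hWsub hy).1, ?_, ?_⟩
    · rintro β ⟨y, hyW, hyV⟩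
      by_contra hx
      have := (hWsub hyW).2.2
      simp only [mem_iInter] at this
      exact this β (fun h => hx (hVU β h)) (subset_closure hyV)
    · intro β γ hβ hγ
      refine (hNl β γ hβ hγ).mono fun y hy => ?_
      have := (hWsub hy).2.1
      simp only [mem_iInter] at this
      exact this β hβ γ hγ
  choose W hW hxW hWV hWU hWl using key
  refine ⟨⟨X, fun x => ⟨W x, hW x⟩, fun x => ⟨x, hxW x⟩⟩, fun x => s (a x), fun x => ?_, ?_, ?_⟩
  · exact (hs (a x)).mono fun y hy => hVU _ (subset_closure (hWV x hy))
  · exact fun x y hy => hps (a x) y (hVU _ (subset_closure (hWV x hy)))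
  · intro x y
    by_cases h : (W x ∩ W y).Nonempty
    · obtain ⟨z, hzx, hzy⟩ := h
      exact (hWl x (a x) (a y) (hVU _ (subset_closure (ha x)))
        (hWU x (a y) ⟨z, hzx, hWV y hzy⟩)).mono inter_subset_left
    · exact ⟨fun _ => 1, contMDiffOn_const, fun z hz => (h ⟨z, hz⟩).elim⟩

theorem exists_obstructionData [T2Space X] [ParacompactSpace X] [IsManifold 𝓘(ℝ, E) ∞ X]
    [IsManifold 𝓘(ℝ, EB) ∞ B]
    (hB : IsPrincipalBundle 𝓘(ℝ, F) 𝓘(ℝ, EB) 𝓘(ℝ, E) proj act)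
    (hθ : IsPrincipalConnection (IM := 𝓘(ℝ, EB)) act θ) (hσ : 𝔼.IsSplit σ) :
    ∃ 𝔘 : Cover X, Nonempty (ObstructionData E 𝔼 proj act θ 𝔘) := by
  classical
  obtain ⟨𝔘, s, hs, hps, hl⟩ := exists_cover_liftableOn (𝔼 := 𝔼) hB
  choose r hr hrs using hl
  -- an order on the index set selects one lift from each pair of mutually inverse ones
  let _ : LinearOrder 𝔘.ι := linearOrderOfSTO WellOrderingRel
  have hinv : ∀ {α β x}, x ∈ 𝔘.U α → x ∈ 𝔘.U β → act (s β x) (𝔼.q (r α β x)⁻¹) = s α x := by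
    intro α β x hα hβ
    rw [← hrs α β x ⟨hα, hβ⟩, ← hB.act_mul, map_inv, mul_inv_cancel, hB.act_one]
  let g : 𝔘.ι → 𝔘.ι → X → Γh := fun α β =>
    if α < β then r α β else if β < α then fun x => (r β α x)⁻¹ else fun _ => 1
  refine ⟨𝔘, ⟨{
    s := s
    smooth_s := hs
    proj_s := hps
    g := g
    smooth_g := fun α β => ?_
    act_g := fun α β x hα hβ => ?_
    g_inv := fun α β x _ _ => ?_
    θh := fun α => splitPull 𝓘(ℝ, E) θ σ (s α)
    smooth_θh := fun α => FormSmoothAt.oneForm_smoothOn fun x hx =>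
      formSmoothAt_splitPull (hθ.formSmoothAt _)
        ((hs α).contMDiffAt ((𝔘.U α).isOpen.mem_nhds hx))
    dq_θh := fun α _ _ => dq_comp_splitPull (E := E) hσ (s α) _ }⟩⟩
  · rcases lt_trichotomy α β with h | rfl | h
    · simpa only [g, if_pos h] using hr α β
    · simpa only [g, lt_irrefl, if_false] using contMDiffOn_const
    · simpa only [g, if_neg h.not_gt, if_pos h, inter_comm] using (hr β α).inv
  · rcases lt_trichotomy α β with h | rfl | h
    · simpa only [g, if_pos h] using hrs α β x ⟨hα, hβ⟩
    · simp only [g, lt_irrefl, if_false, map_one, hB.act_one]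
    · simpa only [g, if_neg h.not_gt, if_pos h] using hinv hβ hα
  · rcases lt_trichotomy α β with h | rfl | h
    · simp only [g, if_neg h.not_gt, if_pos h]
    · simp only [g, lt_irrefl, if_false, inv_one]
    · simp only [g, if_neg h.not_gt, if_pos h, inv_inv]

end Existence

end LiftingGerbe

end

theorem theorem5 {E : Type*} [NormedAddCommGroup E] [NormedSpace ℝ E] [CompleteSpace E]
    {X : Type*} [TopologicalSpace X] [ChartedSpace E X] [IsManifold 𝓘(ℝ, E) ∞ X]
    [T2Space X] [ParacompactSpace X]
    {F : Type*} [NormedAddCommGroup F] [NormedSpace ℝ F] [CompleteSpace F]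
    {Γ : Type*} [Group Γ] [TopologicalSpace Γ] [ChartedSpace F Γ] [LieGroup 𝓘(ℝ, F) ∞ Γ]
    {Fh : Type*} [NormedAddCommGroup Fh] [NormedSpace ℝ Fh] [CompleteSpace Fh]
    {Γh : Type*} [Group Γh] [TopologicalSpace Γh] [ChartedSpace Fh Γh] [LieGroup 𝓘(ℝ, Fh) ∞ Γh]
    (𝔼 : LiftingGerbe.CentralExtension Fh Γh F Γ)
    {EB : Type*} [NormedAddCommGroup EB] [NormedSpace ℝ EB] [CompleteSpace EB]
    {B : Type*} [TopologicalSpace B] [ChartedSpace EB B] [IsManifold 𝓘(ℝ, EB) ∞ B]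
    {proj : B → X} {act : B → Γ → B}
    (hB : LiftingGerbe.IsPrincipalBundle 𝓘(ℝ, F) 𝓘(ℝ, EB) 𝓘(ℝ, E) proj act)
    (θ : LiftingGerbe.OneForm 𝓘(ℝ, EB) B F) (hθ : LiftingGerbe.IsPrincipalConnection act θ)
    (𝓛 : LiftingGerbe.Splitting EB 𝔼 act)
    (σ : F →L[ℝ] Fh) (hσ : 𝔼.IsSplit σ) :
    -- the constructed forms are a bundle gerbe connection and a curving
    (LiftingGerbe.liftingGerbe 𝔼 hB).IsConnection (LiftingGerbe.gerbeConnection 𝔼 θ σ) ∧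
    (LiftingGerbe.liftingGerbe 𝔼 hB).IsCurving (LiftingGerbe.gerbeConnection 𝔼 θ σ)
      (LiftingGerbe.gerbeCurving 𝔼 θ 𝓛 σ) ∧
    -- the Deligne class is the obstruction class
    (∃ c : LiftingGerbe.DeligneH2 𝓘(ℝ, E) X,
      (LiftingGerbe.liftingGerbe 𝔼 hB).IsDeligneClass (LiftingGerbe.gerbeConnection 𝔼 θ σ)
        (LiftingGerbe.gerbeCurving 𝔼 θ 𝓛 σ) c ∧
      LiftingGerbe.IsObstructionClass 𝔼 proj act θ 𝓛 c) ∧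
    -- for all sections and lifts of the transition functions, the cochains agree exactly when the
    -- remaining choices are `σ (s_α^* θ)` for the connection forms and `(s_α, g_αβ)` for the gerbe
    (∀ (𝔘 : LiftingGerbe.Cover X) (O : LiftingGerbe.ObstructionData E 𝔼 proj act θ 𝔘),
      ∃ (O' : LiftingGerbe.ObstructionData E 𝔼 proj act θ 𝔘)
        (D : (LiftingGerbe.liftingGerbe 𝔼 hB).LocalData 𝔘),
        O'.s = O.s ∧ O'.g = O.g ∧
        (∀ α x, O'.θh α x = σ.comp (LiftingGerbe.OneForm.pullback (O.s α) θ x)) ∧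
        D.s = O.s ∧ (∀ α β x, D.σ α β x = (O.s α x, O.g α β x)) ∧
        (D.cochain (LiftingGerbe.gerbeConnection 𝔼 θ σ)
          (LiftingGerbe.gerbeCurving 𝔼 θ 𝓛 σ)).Agree 𝓘(ℝ, E) 𝔘 (O'.cochain 𝓛)) := by
  have hex := LiftingGerbe.exists_obstructionData (θ := θ) hB hθ hσ
  have hex' : ∃ 𝔘 : LiftingGerbe.Cover X, Nonempty ((LiftingGerbe.liftingGerbe 𝔼 hB).LocalData 𝔘) :=
    hex.imp fun _ ⟨O⟩ => ⟨O.toLocalData hB⟩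
  refine ⟨LiftingGerbe.isConnection_gerbeConnection hB hθ hσ,
    LiftingGerbe.isCurving_gerbeCurving hB hθ 𝓛 hσ, ?_, fun 𝔘 O => ?_⟩
  · obtain ⟨𝔘, ⟨O⟩⟩ := id hex
    exact ⟨_, O.toLiftData.isDeligneClass hθ 𝓛 hσ hex', O.toLiftData.isObstructionClass hB hθ 𝓛 hex⟩
  · exact ⟨O.withSplit hθ hσ, O.toLocalData hB, rfl, rfl, fun _ _ => rfl, rfl, fun _ _ _ => rfl,
      O.toLocalData_cochain_agree hθ 𝓛 hσ⟩
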